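/- **Theorem.** There are a deterministic word-RAM algorithm, absolute constants $A,B,D,c$ and a function $g(n)=o(n)$ such that the following holds. Let $0<\epsilon<1$ and $0<\rho<1/2$ be real numbers, and let $G=(V,E)$ be an unweighted undirected simple graph on $n\ge 2$ vertices, given by a list of its edges; the parameters are given to the algorithm through the integers $\lceil 1/\epsilon\rceil$ and $\lceil 1/\rho\rceil$. Put $$\beta=\left(\frac{B\cdot\left(\log(\rho\log n)+\rho^{-1}\right)}{\epsilon\rho}\right)^{\log(\rho\log n)+\rho^{-1}+D}\qquad(\log=\log_2).$$ Then the algorithm constructs a weighted graph $H$ on the vertex set $V$ with at most $n+g(n)$ edges that is a $(1+\epsilon,\beta)$-emulator for $G$, that is, $$d_G(u,v)\le d_H(u,v)\le(1+\epsilon)\,d_G(u,v)+\beta\qquad\text{for all }u,v\in V,$$ and it runs in at most $A\cdot(|E|+1)\cdot\beta\cdot n^{\rho}$ steps on a word RAM with words of $O(\log(n+1/\epsilon+1/\rho))$ bits. All distances are allowed to be infinite ($G$ need not be connected). The word RAM has unit-cost arithmetic ($+,-,\cdot$, integer division), comparisons and array access; its memory outside the input is initially zero. -/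

import Mathlib

open scoped ENNReal
open Asymptotics Filter

/-! ### Weighted graphs, distances and emulators -/

/-- An undirected graph on the vertex set `V` whose edges carry natural number weights
(the values of `weight` off the edge set are irrelevant). -/
structure WeightedGraph (V : Type*) where
  graph : SimpleGraph V
  weight : Sym2 V → ℕ

/-- The weighted distance: the least total weight of a walk, and `⊤` if there is no walk. -/
noncomputable def WeightedGraph.dist {V : Type*} (H : WeightedGraph V) (u v : V) : ℕ∞ :=
  ⨅ p : H.graph.Walk u v, (((p.edges.map H.weight).sum : ℕ) : ℕ∞)

/-- `H` is an `(α, β)`-emulator for the unweighted graph `G` (on the same vertex set):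
`d_G(u, v) ≤ d_H(u, v) ≤ α d_G(u, v) + β` for all `u`, `v`. Distances are `⊤` between
different components. -/
def IsEmulator {V : Type*} (G : SimpleGraph V) (H : WeightedGraph V) (α β : ℝ) : Prop :=
  ∀ u v : V, G.edist u v ≤ H.dist u v ∧
    (H.dist u v : ℝ≥0∞) ≤ ENNReal.ofReal α * (G.edist u v : ℝ≥0∞) + ENNReal.ofReal β

/-! ### A deterministic word RAM with a step count -/

namespace Ram

/-- The memory: word variables, and arrays of words. A fixed program names only finitely many
variables and arrays. -/
structure Store where
  var : ℕ → ℕ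
  arr : ℕ → ℕ → ℕ

/-- Overwrite one variable. -/
def Store.setVar (s : Store) (x v : ℕ) : Store :=
  { s with var := Function.update s.var x v }

/-- Overwrite one array cell. -/
def Store.setArr (s : Store) (a i v : ℕ) : Store :=
  { s with arr := Function.update s.arr a (Function.update (s.arr a) i v) }

/-- Arithmetic expressions. `arr a i` reads cell `i` of the array `a`; `sub` is truncated and
`div` is the integer quotient. -/
inductive Expr where
  | lit (k : ℕ)
  | var (x : ℕ)
  | arr (a : ℕ) (i : Expr)
  | add (e f : Expr)
  | sub (e f : Expr)
  | mul (e f : Expr)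
  | div (e f : Expr)

namespace Expr

/-- The value of an expression. -/
def eval (s : Store) : Expr → ℕ
  | lit k => k
  | var x => s.var x
  | arr a i => s.arr a (i.eval s)
  | add e f => e.eval s + f.eval s
  | sub e f => e.eval s - f.eval s
  | mul e f => e.eval s * f.eval s
  | div e f => e.eval s / f.eval s

/-- The number of unit-cost operations in the evaluation of an expression. -/
def cost : Expr → ℕ
  | lit _ => 1
  | var _ => 1
  | arr _ i => i.cost + 1
  | add e f => e.cost + f.cost + 1
  | sub e f => e.cost + f.cost + 1
  | mul e f => e.cost + f.cost + 1
  | div e f => e.cost + f.cost + 1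

/-- No overflow: all values that occur in the evaluation are words, that is, at most `W`. -/
def Fits (W : ℕ) (s : Store) : Expr → Prop
  | lit k => k ≤ W
  | var x => s.var x ≤ W
  | arr a i => i.Fits W s ∧ s.arr a (i.eval s) ≤ W
  | add e f => e.Fits W s ∧ f.Fits W s ∧ e.eval s + f.eval s ≤ W
  | sub e f => e.Fits W s ∧ f.Fits W s
  | mul e f => e.Fits W s ∧ f.Fits W s ∧ e.eval s * f.eval s ≤ W
  | div e f => e.Fits W s ∧ f.Fits W s

end Expr

/-- Conditions. -/
inductive Test where
  | lt (e f : Expr)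
  | eq (e f : Expr)
  | not (b : Test)
  | and (b c : Test)

namespace Test

/-- The truth of a condition. -/
def Holds (s : Store) : Test → Prop
  | lt e f => e.eval s < f.eval s
  | eq e f => e.eval s = f.eval s
  | not b => ¬ b.Holds s
  | and b c => b.Holds s ∧ c.Holds s

/-- The number of unit-cost operations in the evaluation of a condition. -/
def cost : Test → ℕ
  | lt e f => e.cost + f.cost + 1
  | eq e f => e.cost + f.cost + 1
  | not b => b.cost + 1
  | and b c => b.cost + c.cost + 1

/-- No overflow in the evaluation of a condition. -/
def Fits (W : ℕ) (s : Store) : Test → Prop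
  | lt e f => e.Fits W s ∧ f.Fits W s
  | eq e f => e.Fits W s ∧ f.Fits W s
  | not b => b.Fits W s
  | and b c => b.Fits W s ∧ c.Fits W s

end Test

/-- Programs in structured form. -/
inductive Cmd where
  | skip
  | assign (x : ℕ) (e : Expr)
  | write (a : ℕ) (i e : Expr)
  | seq (p q : Cmd)
  | ite (b : Test) (p q : Cmd)
  | loop (b : Test) (p : Cmd)

/-- `Exec W p s t s'`: on a machine whose words hold the numbers `0, …, W`, the program `p`
started in `s` halts without overflow after exactly `t` steps, in the state `s'`. The rules are
deterministic, and there is no rule for an overflow. `loop b p` is the loop "while `b` do `p`". -/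
inductive Exec (W : ℕ) : Cmd → Store → ℕ → Store → Prop where
  | skip (s : Store) : Exec W Cmd.skip s 1 s
  | assign (x : ℕ) (e : Expr) (s : Store) (h : e.Fits W s) :
      Exec W (Cmd.assign x e) s (e.cost + 1) (s.setVar x (e.eval s))
  | write (a : ℕ) (i e : Expr) (s : Store) (hi : i.Fits W s) (he : e.Fits W s) :
      Exec W (Cmd.write a i e) s (i.cost + e.cost + 1) (s.setArr a (i.eval s) (e.eval s))
  | seq {p q : Cmd} {s₁ s₂ s₃ : Store} {t₁ t₂ : ℕ}
      (hp : Exec W p s₁ t₁ s₂) (hq : Exec W q s₂ t₂ s₃) :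
      Exec W (Cmd.seq p q) s₁ (t₁ + t₂) s₃
  | ite_true {b : Test} {p q : Cmd} {s s' : Store} {t : ℕ} (hf : b.Fits W s)
      (hb : b.Holds s) (hp : Exec W p s t s') : Exec W (Cmd.ite b p q) s (b.cost + t) s'
  | ite_false {b : Test} {p q : Cmd} {s s' : Store} {t : ℕ} (hf : b.Fits W s)
      (hb : ¬ b.Holds s) (hq : Exec W q s t s') : Exec W (Cmd.ite b p q) s (b.cost + t) s'
  | loop_false {b : Test} {p : Cmd} {s : Store} (hf : b.Fits W s) (hb : ¬ b.Holds s) :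
      Exec W (Cmd.loop b p) s b.cost s
  | loop_true {b : Test} {p : Cmd} {s₁ s₂ s₃ : Store} {t₁ t₂ : ℕ} (hf : b.Fits W s₁)
      (hb : b.Holds s₁) (hp : Exec W p s₁ t₁ s₂) (hl : Exec W (Cmd.loop b p) s₂ t₂ s₃) :
      Exec W (Cmd.loop b p) s₁ (b.cost + t₁ + t₂) s₃

/-- `es` lists every edge of `G` exactly once, in any order and with any order of endpoints. -/
def IsEdgeList {n : ℕ} (G : SimpleGraph (Fin n)) (es : List (Fin n × Fin n)) : Prop :=
  (es.map fun e => s(e.1, e.2)).Nodup ∧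
    ∀ u v : Fin n, G.Adj u v ↔ ((u, v) ∈ es ∨ (v, u) ∈ es)

/-- The initial memory: variables `0, 1, 2, 3` hold the number `n` of vertices, the number of edges
and two integer parameters; arrays `0` and `1` hold the endpoints of the edges; all other cells
are zero. -/
def inputStore {n : ℕ} (es : List (Fin n × Fin n)) (K k : ℕ) : Store where
  var x := match x with
    | 0 => n
    | 1 => es.length
    | 2 => K
    | 3 => k
    | _ => 0
  arr a j := match a with
    | 0 => (es.map fun e => (e.1 : ℕ)).getD j 0
    | 1 => (es.map fun e => (e.2 : ℕ)).getD j 0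
    | _ => 0

/-- The final memory `s` represents `H` by a list of `M` weighted edges: `M` is in variable `4`, and
the endpoints and the weight of the `j`-th listed edge are in cell `j` of the arrays `2`, `3`, `4`.
Every entry is an edge of `H` with its weight, and every edge of `H` is listed. -/
def Outputs {n : ℕ} (s : Store) (M : ℕ) (H : WeightedGraph (Fin n)) : Prop :=
  s.var 4 = M ∧
  (∀ j < M, ∃ u v : Fin n, H.graph.Adj u v ∧
    s.arr 2 j = u ∧ s.arr 3 j = v ∧ s.arr 4 j = H.weight s(u, v)) ∧
  ∀ u v : Fin n, H.graph.Adj u v →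
    ∃ j < M, (s.arr 2 j = u ∧ s.arr 3 j = v) ∨ (s.arr 2 j = v ∧ s.arr 3 j = u)

end Ram

/-- The additive stretch
`(B (log₂ (ρ log₂ n) + 1/ρ) / (ε ρ)) ^ (log₂ (ρ log₂ n) + 1/ρ + D)`, with constants `B` and `D`. -/
noncomputable def additiveStretch (B D : ℝ) (n : ℕ) (ε ρ : ℝ) : ℝ :=
  (B * (Real.logb 2 (ρ * Real.logb 2 n) + 1 / ρ) / (ε * ρ)) ^
    (Real.logb 2 (ρ * Real.logb 2 n) + 1 / ρ + D)

/-!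
# Ultra-sparse near-additive emulators on a word RAM

The algorithm keeps a shrinking set of centres, at first the vertices that are not isolated. In each
phase, every vertex finds a bounded number of centres within the radius of the phase. A centre whose
list is full is chosen for the next phase if no centre on its list is owned, and then owns its list;
otherwise it is joined to an owner. A centre whose list is not full is joined to all of its list.
-/

/-! ### A program calculus for the word RAM -/

namespace Ram

/-! The emulator comes from a sequence of superclustering phases. A phase has a radius δ, a list
capacity and a popularity threshold. By a breadth-first search from all centres with lists of
bounded length, every vertex learns a bounded number of centres within distance δ. The centres are
then scanned. A popular centre with no owned source on its list becomes a centre of the next phase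
and owns its list; a popular centre that meets an owned source gets one edge, of weight at most 2δ,
to the owner; an unpopular centre gets exact edges to its whole list. `PhaseSpec` records the
result, `History` the whole sequence.

Size. In the first phase every centre is popular, so each centre of `A 0` either survives or costs
one edge: this accounts for at most n edges. In the later phases the threshold q is squared from
phase to phase up to a cap Q. Lists of surviving centres are disjoint and have more than q elements,
so their number falls by a factor q, and the product (centres) times (threshold) does not grow. To
make the total o(n) the product must start small, and here only centres with a companion in their
component count (`linked`), since a lonely centre has nothing to connect to. A linked survivor of
the first phase owns more than T = (number of bits of n)² vertices: otherwise its ball of radius T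
would have at most T elements, hence be its whole component (`Near.of_ball_le`), and no second
centre could survive there. So there are at most n/T linked centres, and O(log n) phases add O(n /
log n) edges (`History.count_mul_le`).

Termination. After about log₂ log₂ Q phases the threshold is Q, and every further phase divides the
number of centres by Q. Since Q is chosen with Q^κ > n for κ = `fullPhases n k`, no centre is left
after ℓ + 1 phases (`History.eq_empty`).

Stretch. A vertex has level i if centres of all generations up to i are close to it. Where the walk
meets level i but not i + 1, the nearby centres of generation i are unpopular, so they have exact
edges to everything within the radius. One jumps along the walk from a vertex of level i to the last
one within that radius, crosses the following gap by induction on i, and repeats. Each jump with its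
gap loses only an additive term, while it covers nearly a full radius, which is N times longer than
the loss (`Hierarchy.Bound.start`). So each level adds 1/N to the multiplicative error, and N = ℓK
with K = ⌈1/ε⌉ yields 1 + ε. Radii grow by the factor θ = 104N per phase, which gives the additive
term Tθ^ℓ.

Time. A phase relaxes every arc δ times against lists of length at most T + Q + 1, with Q ≤ 4n^ρ.
Only non-isolated vertices are centres, so there are at most 2|E| of them and no term in n is
needed. The real-number estimates (`phaseCount_cast_le`, `bits_pow_mul_le_additiveStretch`) absorb
all other factors in β.

The machine part is a small weakest-precondition calculus (`wp`, `wp_for`) with a syntactic frame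
rule (`Exec.frame`). -/

instance : Add Expr := ⟨Expr.add⟩
instance : Sub Expr := ⟨Expr.sub⟩
instance : Mul Expr := ⟨Expr.mul⟩
instance : Div Expr := ⟨Expr.div⟩

namespace Expr

variable (W : ℕ) (s : Store) (e f : Expr) (k : ℕ)

@[simp] theorem eval_add : (e + f).eval s = e.eval s + f.eval s := rfl
@[simp] theorem eval_sub : (e - f).eval s = e.eval s - f.eval s := rfl
@[simp] theorem eval_mul : (e * f).eval s = e.eval s * f.eval s := rfl
@[simp] theorem eval_div : (e / f).eval s = e.eval s / f.eval s := rfl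
@[simp] theorem eval_lit : (Expr.lit k).eval s = k := rfl
@[simp] theorem eval_var : (Expr.var k).eval s = s.var k := rfl
@[simp] theorem eval_arr : (Expr.arr k e).eval s = s.arr k (e.eval s) := rfl
@[simp] theorem cost_add : (e + f).cost = e.cost + f.cost + 1 := rfl
@[simp] theorem cost_sub : (e - f).cost = e.cost + f.cost + 1 := rfl
@[simp] theorem cost_mul : (e * f).cost = e.cost + f.cost + 1 := rfl
@[simp] theorem cost_div : (e / f).cost = e.cost + f.cost + 1 := rfl
@[simp] theorem cost_lit : (Expr.lit k).cost = 1 := rfl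
@[simp] theorem cost_var : (Expr.var k).cost = 1 := rfl
@[simp] theorem cost_arr : (Expr.arr k e).cost = e.cost + 1 := rfl
@[simp] theorem fits_add :
    (e + f).Fits W s ↔ e.Fits W s ∧ f.Fits W s ∧ e.eval s + f.eval s ≤ W := Iff.rfl
@[simp] theorem fits_sub : (e - f).Fits W s ↔ e.Fits W s ∧ f.Fits W s := Iff.rfl
@[simp] theorem fits_mul :
    (e * f).Fits W s ↔ e.Fits W s ∧ f.Fits W s ∧ e.eval s * f.eval s ≤ W := Iff.rfl
@[simp] theorem fits_div : (e / f).Fits W s ↔ e.Fits W s ∧ f.Fits W s := Iff.rfl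
@[simp] theorem fits_lit : (Expr.lit k).Fits W s ↔ k ≤ W := Iff.rfl
@[simp] theorem fits_var : (Expr.var k).Fits W s ↔ s.var k ≤ W := Iff.rfl
@[simp] theorem fits_arr :
    (Expr.arr k e).Fits W s ↔ e.Fits W s ∧ s.arr k (e.eval s) ≤ W := Iff.rfl

end Expr

namespace Store

variable (s : Store) (x y a b i v : ℕ)

@[simp] theorem var_setVar : (s.setVar x v).var y = if y = x then v else s.var y := by
  simp [setVar, Function.update_apply]

@[simp] theorem arr_setVar : (s.setVar x v).arr = s.arr := rfl

@[simp] theorem var_setArr : (s.setArr a i v).var = s.var := rfl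

@[simp] theorem arr_setArr :
    (s.setArr a i v).arr b = if b = a then Function.update (s.arr a) i v else s.arr b := by
  simp [setArr, Function.update_apply]

end Store

attribute [simp] Test.Holds Test.cost Test.Fits

/-- The program does not assign the variable `x`. -/
def Cmd.writesVar (x : ℕ) : Cmd → Bool
  | skip => false
  | assign y _ => x == y
  | write _ _ _ => false
  | seq p q => p.writesVar x || q.writesVar x
  | ite _ p q => p.writesVar x || q.writesVar x
  | loop _ p => p.writesVar x

/-- The program writes into the array `a`. -/
def Cmd.writesArr (a : ℕ) : Cmd → Bool
  | skip => false
  | assign _ _ => false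
  | write b _ _ => a == b
  | seq p q => p.writesArr a || q.writesArr a
  | ite _ p q => p.writesArr a || q.writesArr a
  | loop _ p => p.writesArr a

/-- `s'` agrees with `s` on everything that `p` does not write. -/
def Frame (p : Cmd) (s s' : Store) : Prop :=
  (∀ x, p.writesVar x = false → s'.var x = s.var x) ∧
    ∀ a, p.writesArr a = false → s'.arr a = s.arr a

theorem Frame.refl (p : Cmd) (s : Store) : Frame p s s := ⟨fun _ _ => rfl, fun _ _ => rfl⟩

theorem Frame.trans {p : Cmd} {s₁ s₂ s₃ : Store} (h : Frame p s₁ s₂) (h' : Frame p s₂ s₃) :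
    Frame p s₁ s₃ :=
  ⟨fun x hx => (h'.1 x hx).trans (h.1 x hx), fun a ha => (h'.2 a ha).trans (h.2 a ha)⟩

theorem Frame.mono {p q : Cmd} {s s' : Store} (h : Frame p s s')
    (hv : ∀ x, q.writesVar x = false → p.writesVar x = false)
    (ha : ∀ a, q.writesArr a = false → p.writesArr a = false) : Frame q s s' :=
  ⟨fun x hx => h.1 x (hv x hx), fun a h' => h.2 a (ha a h')⟩

/-- Whatever a program does not mention as a target is preserved, by induction on the execution.
Preservation thereby becomes a Boolean computation on syntax, discharged by `rfl`, and loop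
invariants need to mention only the cells that change. -/
theorem Exec.frame {W : ℕ} {p : Cmd} {s s' : Store} {t : ℕ} (h : Exec W p s t s') :
    Frame p s s' := by
  induction h with
  | skip s => exact Frame.refl _ _
  | assign x e s h =>
    refine ⟨fun y hy => ?_, fun _ _ => rfl⟩
    have : y ≠ x := by simpa [Cmd.writesVar] using hy
    simp [this]
  | write a i e s hi he =>
    refine ⟨fun _ _ => rfl, fun b hb => ?_⟩
    have : b ≠ a := by simpa [Cmd.writesArr] using hb
    simp [this]
  | seq _ _ ih₁ ih₂ =>
    exact (ih₁.mono (by simp +contextual [Cmd.writesVar])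
      (by simp +contextual [Cmd.writesArr])).trans
      (ih₂.mono (by simp +contextual [Cmd.writesVar]) (by simp +contextual [Cmd.writesArr]))
  | ite_true _ _ _ ih =>
    exact ih.mono (by simp +contextual [Cmd.writesVar]) (by simp +contextual [Cmd.writesArr])
  | ite_false _ _ _ ih =>
    exact ih.mono (by simp +contextual [Cmd.writesVar]) (by simp +contextual [Cmd.writesArr])
  | loop_false _ _ => exact Frame.refl _ _
  | loop_true _ _ _ _ ih₁ ih₂ =>
    exact (ih₁.mono (by simp [Cmd.writesVar]) (by simp [Cmd.writesArr])).trans ih₂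

/-- Total correctness with a bound on time: `p` halts from `s` without overflow, and `Q` holds of
its running time and its final state. -/
def wp (W : ℕ) (p : Cmd) (s : Store) (Q : ℕ → Store → Prop) : Prop :=
  ∃ t s', Exec W p s t s' ∧ Q t s'

variable {W : ℕ} {p q : Cmd} {s : Store} {Q R : ℕ → Store → Prop}

theorem wp.imp (h : wp W p s R) (hQ : ∀ t s', R t s' → Q t s') : wp W p s Q :=
  let ⟨t, s', he, hr⟩ := h
  ⟨t, s', he, hQ t s' hr⟩

theorem wp.imp_frame (h : wp W p s R) (hQ : ∀ t s', Frame p s s' → R t s' → Q t s') :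
    wp W p s Q :=
  let ⟨t, s', he, hr⟩ := h
  ⟨t, s', he, hQ t s' he.frame hr⟩

theorem wp_skip (h : Q 1 s) : wp W Cmd.skip s Q := ⟨_, _, Exec.skip s, h⟩

theorem wp_assign {x : ℕ} {e : Expr} (hf : e.Fits W s)
    (h : Q (e.cost + 1) (s.setVar x (e.eval s))) : wp W (Cmd.assign x e) s Q :=
  ⟨_, _, Exec.assign x e s hf, h⟩

theorem wp_write {a : ℕ} {i e : Expr} (hi : i.Fits W s) (he : e.Fits W s)
    (h : Q (i.cost + e.cost + 1) (s.setArr a (i.eval s) (e.eval s))) :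
    wp W (Cmd.write a i e) s Q :=
  ⟨_, _, Exec.write a i e s hi he, h⟩

theorem wp_seq (h : wp W p s fun t₁ s₁ => wp W q s₁ fun t₂ s₂ => Q (t₁ + t₂) s₂) :
    wp W (Cmd.seq p q) s Q := by
  obtain ⟨t₁, s₁, h₁, t₂, s₂, h₂, hq⟩ := h
  exact ⟨_, _, Exec.seq h₁ h₂, hq⟩

theorem wp_ite {b : Test} (hf : b.Fits W s)
    (ht : b.Holds s → wp W p s fun t s' => Q (b.cost + t) s')
    (he : ¬ b.Holds s → wp W q s fun t s' => Q (b.cost + t) s') : wp W (Cmd.ite b p q) s Q := by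
  by_cases hb : b.Holds s
  · obtain ⟨t, s', h, hq⟩ := ht hb
    exact ⟨_, _, Exec.ite_true hf hb h, hq⟩
  · obtain ⟨t, s', h, hq⟩ := he hb
    exact ⟨_, _, Exec.ite_false hf hb h, hq⟩

theorem wp_loop {b : Test} (N T : ℕ) (I : ℕ → Store → Prop) (h0 : I 0 s)
    (step : ∀ i s', i < N → Frame p s s' → I i s' →
      b.Fits W s' ∧ b.Holds s' ∧ wp W p s' fun t s'' => t ≤ T ∧ I (i + 1) s'')
    (last : ∀ s', Frame p s s' → I N s' → b.Fits W s' ∧ ¬ b.Holds s') :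
    wp W (Cmd.loop b p) s fun t s' => t ≤ N * (T + b.cost) + b.cost ∧ Frame p s s' ∧ I N s' := by
  suffices h : ∀ d i s', i + d = N → Frame p s s' → I i s' → ∃ t s'', Exec W (Cmd.loop b p) s' t s'' ∧
      t ≤ d * (T + b.cost) + b.cost ∧ Frame p s s'' ∧ I N s'' from
    let ⟨t, s', h⟩ := h N 0 s (by omega) (Frame.refl _ _) h0
    ⟨t, s', h⟩
  intro d
  induction d with
  | zero =>
    intro i s' hi hf hI
    obtain rfl : i = N := by omega
    obtain ⟨hb, hn⟩ := last s' hf hI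
    exact ⟨_, _, Exec.loop_false hb hn, by omega, hf, hI⟩
  | succ d ih =>
    intro i s' hi hf hI
    obtain ⟨hb, hh, t, s₂, he, ht, hI'⟩ := step i s' (by omega) hf hI
    obtain ⟨t', s₃, he', ht', hf', hN⟩ := ih (i + 1) s₂ (by omega) (hf.trans he.frame) hI'
    refine ⟨_, _, Exec.loop_true hb hh he he', ?_, hf', hN⟩
    calc b.cost + t + t' ≤ b.cost + T + (d * (T + b.cost) + b.cost) := by omega
      _ = _ := by ring

/-- `for x from its present value below y do p`. -/
def forLoop (x y : ℕ) (p : Cmd) : Cmd :=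
  .loop (.lt (.var x) (.var y)) (.seq p (.assign x (Expr.var x + Expr.lit 1)))

theorem wp_for {x y : ℕ} (i₀ N T : ℕ) (I : ℕ → Store → Prop) (hx : s.var x = i₀) (hy : s.var y = N)
    (hi : i₀ ≤ N) (hN : N < W) (hpx : p.writesVar x = false) (hpy : p.writesVar y = false)
    (hxy : (y == x) = false)
    (h0 : I i₀ s) (hI : ∀ i s' v, I i s' → I i (s'.setVar x v))
    (step : ∀ i s', i₀ ≤ i → i < N → s'.var x = i → Frame (forLoop x y p) s s' → I i s' →
      wp W p s' fun t s'' => t ≤ T ∧ I (i + 1) s'') :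
    wp W (forLoop x y p) s fun t s' => t ≤ (N - i₀) * (T + 7) + 3 ∧
      s'.var x = N ∧ I N s' := by
  have hxy' : y ≠ x := by simpa using hxy
  have hfr : ∀ s', Frame (.seq p (.assign x (Expr.var x + Expr.lit 1))) s s' → s'.var y = N := fun s' hf => by
    rw [hf.1 y (by simp [Cmd.writesVar, hpy, hxy']), hy]
  -- The increment of the counter costs 4 steps and the test 3; hence the 7 per iteration and the
  -- final 3.
  refine (wp_loop (N - i₀) (T + 4) (fun i s' => s'.var x = i₀ + i ∧ I (i₀ + i) s') ⟨hx, h0⟩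
    ?_ ?_).imp ?_
  · rintro i s' hi' hf ⟨hxi, hIi⟩
    have hyN := hfr s' hf
    refine ⟨by simp only [Test.Fits, Expr.fits_var]; omega,
      by simp only [Test.Holds, Expr.eval_var]; omega, wp_seq ?_⟩
    refine (step (i₀ + i) s' (by omega) (by omega) hxi hf hIi).imp_frame ?_
    rintro t s₂ hf₂ ⟨ht, hI₂⟩
    have hx₂ : s₂.var x = i₀ + i := by rw [hf₂.1 x hpx, hxi]
    refine wp_assign ?_ ⟨?_, ?_, ?_⟩
    · simp only [Expr.fits_add, Expr.fits_var, Expr.eval_var, hx₂, Expr.fits_lit,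
        Expr.eval_lit]
      omega
    · simp; omega
    · simp [hx₂]; omega
    · exact hI _ _ _ hI₂
  · rintro s' hf ⟨hxi, -⟩
    have hyN := hfr s' hf
    refine ⟨by simp only [Test.Fits, Expr.fits_var]; omega,
      by simp only [Test.Holds, Expr.eval_var]; omega⟩
  · rintro t s' ⟨ht, hf, hx', hI'⟩
    rw [Nat.add_sub_cancel' hi] at hx' hI'
    exact ⟨by simpa using ht, hx', hI'⟩

end Ram

/-! ### Bounded distances -/

/-- There is a walk of length at most `r` from `u` to `v`. -/
def Near {V : Type*} (adj : V → V → Prop) : ℕ → V → V → Prop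
  | 0, u, v => u = v
  | r + 1, u, v => Near adj r u v ∨ ∃ w, Near adj r u w ∧ adj w v

namespace Near

variable {V : Type*} {adj : V → V → Prop} {u v w : V} {r r' : ℕ}

theorem refl (adj : V → V → Prop) (r : ℕ) (u : V) : Near adj r u u := by
  induction r with
  | zero => rfl
  | succ r ih => exact Or.inl ih

theorem mono (h : Near adj r u v) (hr : r ≤ r') : Near adj r' u v := by
  induction hr with
  | refl => exact h
  | step _ ih => exact Or.inl ih

theorem step (h : Near adj r u w) (ha : adj w v) : Near adj (r + 1) u v := Or.inr ⟨w, h, ha⟩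

theorem of_adj (ha : adj u v) : Near adj 1 u v := (refl adj 0 u).step ha

theorem trans (h : Near adj r u v) (h' : Near adj r' v w) : Near adj (r + r') u w := by
  induction r' generalizing w with
  | zero => exact (show v = w from h') ▸ h
  | succ r' ih =>
    rcases h' with h' | ⟨x, hx, ha⟩
    · exact (ih h').mono (by omega)
    · exact (ih hx).step ha

theorem symm (hs : ∀ u v, adj u v → adj v u) (h : Near adj r u v) : Near adj r v u := by
  induction r generalizing v with
  | zero => exact Eq.symm h
  | succ r ih =>
    rcases h with h | ⟨x, hx, ha⟩
    · exact (ih h).mono (by omega)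
    · exact ((of_adj (hs _ _ ha)).trans (ih hx)).mono (by omega)

theorem invariant {S : V → Prop} (hS : ∀ u v, adj u v → S u → S v) (h : Near adj r u v)
    (hu : S u) : S v := by
  induction r generalizing v with
  | zero => exact (show u = v from h) ▸ hu
  | succ r ih =>
    rcases h with h | ⟨x, hx, ha⟩
    · exact ih h
    · exact hS _ _ ha (ih hx)

/-- If a ball of radius `δ` has at most `δ` elements, it is a whole component. -/
theorem of_ball_le {adj : ℕ → ℕ → Prop} {p δ d v : ℕ} {S : Finset ℕ}
    (hS : ∀ v, Near adj δ p v → v ∈ S) (hc : S.card ≤ δ)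
    (h : Near adj d p v) : Near adj δ p v := by
  classical
  -- If one enlargement of the radius adds nothing, no later one does.
  have stable : ∀ e, (∀ v, Near adj (e + 1) p v → Near adj e p v) →
      ∀ d v, Near adj d p v → Near adj e p v := by
    intro e he d
    induction d with
    | zero => exact fun v hv => mono hv (Nat.zero_le _)
    | succ d ih =>
      rintro v (hv | ⟨w, hw, ha⟩)
      · exact ih v hv
      · exact he v ((ih w hw).step ha)
  -- Until the ball stops growing, every enlargement adds an element; without a stop up to radius
  -- `δ` there would be `δ + 1` elements in `S`.
  have grow : ∀ d ≤ δ, (∃ e ≤ d, ∀ v, Near adj (e + 1) p v → Near adj e p v) ∨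
      d + 1 ≤ (S.filter fun v => Near adj d p v).card := by
    intro d
    induction d with
    | zero =>
      intro _
      refine Or.inr (Finset.card_pos.2 ⟨p, Finset.mem_filter.2 ⟨hS p (refl _ _ _), rfl⟩⟩)
    | succ d ih =>
      intro hd
      rcases ih (by omega) with ⟨e, he, h⟩ | h
      · exact Or.inl ⟨e, by omega, h⟩
      · by_cases hst : ∀ v, Near adj (d + 1) p v → Near adj d p v
        · exact Or.inl ⟨d, by omega, hst⟩
        · push Not at hst
          obtain ⟨v, hv, hv'⟩ := hst
          refine Or.inr (Nat.succ_le_of_lt (h.trans_lt (Finset.card_lt_card ⟨?_, ?_⟩)))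
          · exact Finset.monotone_filter_right _ fun _ _ h => h.mono (by omega)
          · intro hsub
            exact hv' (Finset.mem_filter.1
              (hsub (Finset.mem_filter.2 ⟨hS v (hv.mono hd), hv⟩))).2
  rcases grow δ le_rfl with ⟨e, he, hst⟩ | h'
  · exact (stable e hst d v h).mono he
  · have := Finset.card_le_card (Finset.filter_subset (fun v => Near adj δ p v) S)
    omega

end Near

/-! ### Lists of nearby sources -/

/-- The cell of row `i` and column `j` of a table with `n` columns. -/
def cell (n i j : ℕ) : ℕ := i * n + j

theorem cell_inj {n i j i' j' : ℕ} (hj : j < n) (hj' : j' < n) :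
    cell n i j = cell n i' j' ↔ i = i' ∧ j = j' := by
  refine ⟨fun h => ?_, fun h => by rw [h.1, h.2]⟩
  unfold cell at h
  have hi : i = i' := by
    have h1 := congrArg (· / n) h
    have hn : 0 < n := by omega
    simpa [Nat.add_comm _ j, Nat.add_comm _ j', Nat.add_mul_div_right _ _ hn,
      Nat.div_eq_of_lt hj, Nat.div_eq_of_lt hj'] using h1
  subst hi
  exact ⟨rfl, by omega⟩

theorem cell_lt {n i j N : ℕ} (hj : j < n) (hi : i < N) : cell n i j < N * n := by
  unfold cell
  calc i * n + j < i * n + n := by omega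
    _ = (i + 1) * n := by ring
    _ ≤ N * n := Nat.mul_le_mul_right _ hi

/-- Every vertex `v` keeps a list `l v 0, …, l v (c v - 1)` of at most `cap` sources (elements of
`A`); `d v x` is one more than the length of a walk from the source `x` to `v`, and `0` if `x` is
not in the list. -/
structure ListInv (adj : ℕ → ℕ → Prop) (n cap r : ℕ) (A : Finset ℕ) (d l : ℕ → ℕ → ℕ)
    (c : ℕ → ℕ) : Prop where
  card : ∀ v < n, c v = ((Finset.range n).filter fun x => d v x ≠ 0).card
  le : ∀ v < n, c v ≤ cap
  enum : ∀ v < n, ∀ j < c v, l v j < n ∧ d v (l v j) ≠ 0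
  surj : ∀ v < n, ∀ x < n, d v x ≠ 0 → ∃ j < c v, l v j = x
  sound : ∀ v < n, ∀ x < n, d v x ≠ 0 → x ∈ A ∧ Near adj (d v x - 1) x v
  bound : ∀ v < n, ∀ x < n, d v x ≤ r + 1
  head : ∀ u ∈ A, 0 < c u ∧ l u 0 = u

/-- The lists have only grown, by entries at distance `r + 1`. -/
structure ListExt (n r : ℕ) (d l : ℕ → ℕ → ℕ) (c : ℕ → ℕ) (d' l' : ℕ → ℕ → ℕ) (c' : ℕ → ℕ) :
    Prop where
  dist : ∀ v < n, ∀ x < n, d' v x = d v x ∨ (d v x = 0 ∧ d' v x = r + 2)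
  count : ∀ v < n, c v ≤ c' v
  list : ∀ v < n, ∀ j < c v, l' v j = l v j

section

variable {adj : ℕ → ℕ → Prop} {n cap r : ℕ} {A : Finset ℕ} {d l d' l' d'' l'' : ℕ → ℕ → ℕ}
  {c c' c'' : ℕ → ℕ}

theorem ListExt.refl (n r : ℕ) (d l : ℕ → ℕ → ℕ) (c : ℕ → ℕ) : ListExt n r d l c d l c :=
  ⟨fun _ _ _ _ => Or.inl rfl, fun _ _ => le_rfl, fun _ _ _ _ => rfl⟩

theorem ListExt.trans (h : ListExt n r d l c d' l' c') (h' : ListExt n r d' l' c' d'' l'' c'') :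
    ListExt n r d l c d'' l'' c'' where
  dist v hv x hx := by
    have h1 := h.dist v hv x hx
    have h2 := h'.dist v hv x hx
    omega
  count v hv := (h.count v hv).trans (h'.count v hv)
  list v hv j hj := by rw [h'.list v hv j (hj.trans_le (h.count v hv)), h.list v hv j hj]

theorem ListInv.mono_radius {r' : ℕ} (h : ListInv adj n cap r A d l c) (hr : r ≤ r') :
    ListInv adj n cap r' A d l c :=
  { h with bound := fun v hv x hx => (h.bound v hv x hx).trans (by omega) }

theorem ListInv.count_le (h : ListInv adj n cap r A d l c) {v : ℕ} (hv : v < n) : c v ≤ n := by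
  rw [h.card v hv]
  exact (Finset.card_filter_le _ _).trans (by simp)

theorem ListInv.count_lt (h : ListInv adj n cap r A d l c) {w y : ℕ} (hw : w < n) (hy : y < n)
    (h0 : d w y = 0) : c w < n := by
  rw [h.card w hw]
  calc _ < (Finset.range n).card := Finset.card_lt_card
        (Finset.filter_ssubset.2 ⟨y, by simpa using hy, by simpa using h0⟩)
    _ = n := by simp

/-- Appending the source `y` to the list of `w`. -/
theorem ListInv.insert (h : ListInv adj n cap (r + 1) A d l c) {w y : ℕ} (hw : w < n) (hy : y < n)
    (hyA : y ∈ A) (hAn : ∀ u ∈ A, u < n) (h0 : d w y = 0) (hc : c w < cap)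
    (hnear : Near adj (r + 1) y w)
    (hd' : ∀ v < n, ∀ x < n, d' v x = if v = w ∧ x = y then r + 2 else d v x)
    (hl' : ∀ v < n, ∀ j < n, l' v j = if v = w ∧ j = c w then y else l v j)
    (hc' : ∀ v < n, c' v = if v = w then c w + 1 else c v) :
    ListInv adj n cap (r + 1) A d' l' c' ∧ ListExt n r d l c d' l' c' := by
  have hcw := h.count_lt hw hy h0
  have hcn : ∀ v < n, c v ≤ n := fun v hv => h.count_le hv
  refine ⟨⟨?_, ?_, ?_, ?_, ?_, ?_, ?_⟩, ?_, ?_, ?_⟩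
  · intro v hv
    rw [hc' v hv]
    split_ifs with e
    · subst e
      rw [h.card v hv]
      rw [← Finset.card_insert_of_notMem (a := y) (by simp [h0])]
      congr 1
      ext x
      simp only [Finset.mem_insert, Finset.mem_filter, Finset.mem_range]
      constructor
      · rintro (rfl | ⟨hx, hx'⟩)
        · exact ⟨hy, by simp [hd' v hv x hy]⟩
        · refine ⟨hx, ?_⟩
          rw [hd' v hv x hx]; split_ifs <;> simp_all
      · rintro ⟨hx, hx'⟩
        rw [hd' v hv x hx] at hx'
        by_cases hxy : x = y
        · exact Or.inl hxy
        · exact Or.inr ⟨hx, by simpa [hxy] using hx'⟩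
    · rw [h.card v hv]
      congr 1
      ext x
      simp only [Finset.mem_filter, Finset.mem_range]
      refine and_congr_right fun hx => ?_
      simp [hd' v hv x hx, e]
  · intro v hv
    rw [hc' v hv]
    have := h.le v hv
    split_ifs <;> omega
  · intro v hv j hj
    have hjn : j < n := by
      rw [hc' v hv] at hj
      have := hcn v hv
      split_ifs at hj <;> omega
    rw [hl' v hv j hjn]
    split_ifs with e
    · exact ⟨hy, by rw [hd' v hv y hy]; simp [e.1]⟩
    · have hj' : j < c v := by
        rw [hc' v hv] at hj
        split_ifs at hj with e'
        · subst e'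
          have : j ≠ c v := fun h => e ⟨rfl, h⟩
          omega
        · exact hj
      obtain ⟨h1, h2⟩ := h.enum v hv j hj'
      refine ⟨h1, ?_⟩
      rw [hd' v hv _ h1]
      split_ifs <;> simp_all
  · intro v hv x hx hdx
    rw [hd' v hv x hx] at hdx
    by_cases e : v = w ∧ x = y
    · obtain ⟨rfl, rfl⟩ := e
      exact ⟨c v, by simp [hc' v hv], by simp [hl' v hv _ hcw]⟩
    · rw [if_neg e] at hdx
      obtain ⟨j, hj, hjx⟩ := h.surj v hv x hx hdx
      have hjn := hj.trans_le (hcn v hv)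
      refine ⟨j, ?_, ?_⟩
      · rw [hc' v hv]
        split_ifs with e'
        · subst e'; omega
        · exact hj
      · rw [hl' v hv j hjn, if_neg, hjx]
        rintro ⟨rfl, rfl⟩
        exact lt_irrefl _ hj
  · intro v hv x hx
    rw [hd' v hv x hx]
    split_ifs with e
    · rintro -
      obtain ⟨rfl, rfl⟩ := e
      exact ⟨hyA, hnear⟩
    · exact h.sound v hv x hx
  · intro v hv x hx
    rw [hd' v hv x hx]
    have := h.bound v hv x hx
    split_ifs <;> omega
  · intro u hu
    have hun := hAn u hu
    obtain ⟨h1, h2⟩ := h.head u hu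
    rw [hc' u hun, hl' u hun 0 (by omega)]
    constructor
    · split_ifs <;> omega
    · rw [if_neg, h2]
      rintro ⟨rfl, h⟩
      omega
  · intro v hv x hx
    rw [hd' v hv x hx]
    split_ifs with e
    · exact Or.inr ⟨by rw [e.1, e.2, h0], rfl⟩
    · exact Or.inl rfl
  · intro v hv
    rw [hc' v hv]
    split_ifs with e
    · subst e; omega
    · exact le_rfl
  · intro v hv j hj
    rw [hl' v hv j (hj.trans_le (hcn v hv)), if_neg]
    rintro ⟨rfl, rfl⟩
    exact lt_irrefl _ hj

/-- After `r` rounds, every list is full or holds all sources at distance at most `r`. -/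
def Complete (adj : ℕ → ℕ → Prop) (n cap r : ℕ) (A : Finset ℕ) (d : ℕ → ℕ → ℕ) (c : ℕ → ℕ) :
    Prop :=
  ∀ v < n, c v = cap ∨ ∀ x ∈ A, ∀ e ≤ r, Near adj e x v → d v x ≠ 0 ∧ d v x ≤ e + 1

/-- The old entries of the list of `v` are passed on to `w`, unless the list of `w` is full. -/
def Passed (n cap r : ℕ) (d : ℕ → ℕ → ℕ) (c : ℕ → ℕ) (v w : ℕ) : Prop :=
  c w = cap ∨ ∀ x < n, d v x ≠ 0 → d v x ≤ r + 1 → d w x ≠ 0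

/-- Entries inserted during the round carry the value `r + 2`, so they never count as old entries of
`v` and create no new obligation; obligations already met stay met because lists only grow. -/
theorem Passed.ext {v w : ℕ} (hv : v < n) (hw : w < n) (h : Passed n cap r d c v w)
    (he : ListExt n r d l c d' l' c') (hle : c' w ≤ cap) : Passed n cap r d' c' v w := by
  rcases h with h | h
  · exact Or.inl (le_antisymm hle (h ▸ he.count w hw))
  · refine Or.inr fun x hx h1 h2 => ?_
    have := h x hx
    have h3 := he.dist v hv x hx
    have h4 := he.dist w hw x hx
    omega

/-- A source at distance `r + 1` from `v` is at distance `r` from a neighbour `w` of `v`. Either `w`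
had listed it, and it was passed on, or the list of `w` was full, and then passing on all of it
fills the list of `v`. Truncating the lists therefore never hides a source from a list that is not
full. -/
theorem Complete.succ (hcomp : Complete adj n cap r A d c) (hl : ListInv adj n cap r A d l c)
    (hl' : ListInv adj n cap (r + 1) A d' l' c') (he : ListExt n r d l c d' l' c')
    (hadj : ∀ u v, adj u v → u < n ∧ v < n) (hAn : ∀ u ∈ A, u < n)
    (hp : ∀ v w, adj v w → Passed n cap r d' c' v w) :
    Complete adj n cap (r + 1) A d' c' := by
  intro v hv
  rcases (hl'.le v hv).eq_or_lt with hfull | hlt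
  · exact Or.inl hfull
  refine Or.inr fun x hx e her hnear => ?_
  have hxn := hAn x hx
  rcases Nat.lt_or_ge r e with h | h
  · obtain rfl : e = r + 1 := by omega
    have hb := hl'.bound v hv x hxn
    refine ⟨?_, by omega⟩
    rcases hnear with hnear | ⟨w, hw, ha⟩
    · rcases hcomp v hv with hc | hc
      · have := he.count v hv
        omega
      · have h1 := hc x hx r le_rfl hnear
        have h2 := he.dist v hv x hxn
        omega
    · have hwn := (hadj w v ha).1
      have hpass := (hp w v ha).resolve_left hlt.ne
      rcases hcomp w hwn with hc | hc
      · exfalso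
        -- All `cap` entries of the full list of `w` are now on the list of `v`, against `hlt`.
        have hsub : ((Finset.range n).filter fun x => d w x ≠ 0) ⊆
            (Finset.range n).filter fun x => d' v x ≠ 0 := by
          intro y hy
          simp only [Finset.mem_filter, Finset.mem_range] at hy ⊢
          have h1 := hl.bound w hwn y hy.1
          have h2 := he.dist w hwn y hy.1
          exact ⟨hy.1, hpass y hy.1 (by omega) (by omega)⟩
        have := Finset.card_le_card hsub
        rw [← hl.card w hwn, ← hl'.card v hv] at this
        omega
      · have h1 := hc x hx r le_rfl hw
        have h2 := he.dist w hwn x hxn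
        exact hpass x hxn (by omega) (by omega)
  · rcases hcomp v hv with hc | hc
    · have := he.count v hv
      omega
    · have h1 := hc x hx e h hnear
      have h2 := he.dist v hv x hxn
      omega

end

/-! ### The program

Variables: `5` number of bits of `n`, `6` number of phases of full growth, `7` exponent of the
largest threshold, `8` largest threshold, `9` number of phases, `10` growth of the radius,
`11` number of centres, `12` phase, `13` radius, `14` capacity of the lists, `15` popularity
threshold, `16` next threshold, `17` number of new centres, `18` arc, `19` round, `20` index of a
centre, `21` centre, `22` number of arcs, `23`–`29` scratch, `30`–`33` edge insertion,
`34` loop bound.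

Arrays: `5` position of an edge in the output, `6` and `7` arcs, `8` distances (plus one) to the
listed sources, `9` lists of sources, `10` their lengths, `11` centres, `12` owners (plus one),
`13` seen vertices. -/

infixr:60 " ;; " => Ram.Cmd.seq

namespace Ram

section Programs

open Ram.Expr Ram.Test Ram.Cmd

/-- Try to append every old entry of the list of row `25` to the list of row `26`. -/
def relax : Cmd :=
  forLoop 28 27 (
    assign 29 (arr 9 (var 25 * var 0 + var 28)) ;;
    ite (and (lt (arr 8 (var 25 * var 0 + var 29)) (var 19 + lit 2))
        (and (eq (arr 8 (var 26 * var 0 + var 29)) (lit 0)) (lt (arr 10 (var 26)) (var 14))))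
      (write 8 (var 26 * var 0 + var 29) (var 19 + lit 2) ;;
        write 9 (var 26 * var 0 + arr 10 (var 26)) (var 29) ;;
        write 10 (var 26) (arr 10 (var 26) + lit 1))
      skip)

/-- One round: relax every arc. -/
def round : Cmd :=
  assign 18 (lit 0) ;;
  forLoop 18 22 (
    assign 25 (var 12 * var 0 + arr 6 (var 18)) ;;
    assign 26 (var 12 * var 0 + arr 7 (var 18)) ;;
    assign 27 (arr 10 (var 25)) ;;
    assign 28 (lit 0) ;;
    relax)

/-- Every centre is put on its own list. -/
def seed : Cmd :=
  assign 20 (lit 0) ;;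
  forLoop 20 11 (
    assign 21 (arr 11 (var 12 * var 0 + var 20)) ;;
    assign 25 (var 12 * var 0 + var 21) ;;
    write 8 (var 25 * var 0 + var 21) (lit 1) ;;
    write 9 (var 25 * var 0) (var 21) ;;
    write 10 (var 25) (lit 1))

/-- Find the sources within the radius. -/
def detect : Cmd :=
  seed ;; assign 19 (lit 0) ;; forLoop 19 13 round

end Programs

/-! ### The tables of a phase and one round of list growth -/

/-- The distance table of phase `ph`. -/
def distTab (n ph : ℕ) (s : Store) (v x : ℕ) : ℕ := s.arr 8 (cell n (cell n ph v) x)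

/-- The lists of phase `ph`. -/
def listTab (n ph : ℕ) (s : Store) (v j : ℕ) : ℕ := s.arr 9 (cell n (cell n ph v) j)

/-- The lengths of the lists of phase `ph`. -/
def countTab (n ph : ℕ) (s : Store) (v : ℕ) : ℕ := s.arr 10 (cell n ph v)

/-- The constants of a phase. -/
structure PhaseEnv (n m ph δ cap X : ℕ) (ax ay : ℕ → ℕ) (s : Store) : Prop where
  n_eq : s.var 0 = n
  m_eq : s.var 22 = m
  ph_eq : s.var 12 = ph
  δ_eq : s.var 13 = δ
  cap_eq : s.var 14 = cap
  ax_eq : s.arr 6 = ax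
  ay_eq : s.arr 7 = ay
  n_le : n ≤ X
  m_le : m ≤ X
  ph_le : ph ≤ X
  δ_le : δ ≤ X
  cap_le : cap ≤ X

/-- All entries of the arrays for the phases from `ph` on are zero. -/
def Fresh (n ph : ℕ) (s : Store) : Prop :=
  (∀ i, ph ≤ i → ∀ v < n, ∀ x < n, s.arr 8 (cell n (cell n i v) x) = 0) ∧
    ∀ i, ph ≤ i → ∀ v < n, s.arr 10 (cell n i v) = 0

section

variable {n m ph δ cap X W : ℕ} {ax ay : ℕ → ℕ} {s s' : Store} {p : Cmd}
  {adj : ℕ → ℕ → Prop} {A : Finset ℕ}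

theorem PhaseEnv.frame (h : PhaseEnv n m ph δ cap X ax ay s) (hf : Frame p s s')
    (h0 : p.writesVar 0 = false := by rfl) (h22 : p.writesVar 22 = false := by rfl)
    (h12 : p.writesVar 12 = false := by rfl) (h13 : p.writesVar 13 = false := by rfl)
    (h14 : p.writesVar 14 = false := by rfl) (h6 : p.writesArr 6 = false := by rfl)
    (h7 : p.writesArr 7 = false := by rfl) : PhaseEnv n m ph δ cap X ax ay s' :=
  { h with
    n_eq := (hf.1 _ h0).trans h.n_eq
    m_eq := (hf.1 _ h22).trans h.m_eq
    ph_eq := (hf.1 _ h12).trans h.ph_eq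
    δ_eq := (hf.1 _ h13).trans h.δ_eq
    cap_eq := (hf.1 _ h14).trans h.cap_eq
    ax_eq := (hf.2 _ h6).trans h.ax_eq
    ay_eq := (hf.2 _ h7).trans h.ay_eq }

/-- Addresses in the tables are at most cubic in the bound `X` on the parameters, so one hypothesis
on `W` excludes overflow in address arithmetic. -/
theorem cell2_le (h : PhaseEnv n m ph δ cap X ax ay s) {v : ℕ} (hv : v < n) :
    ph * n + v ≤ (X + 1) ^ 3 := by
  have h1 := h.n_le
  have h2 := h.ph_le
  calc ph * n + v ≤ X * X + X := Nat.add_le_add (Nat.mul_le_mul h2 h1) (by omega)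
    _ ≤ (X + 1) ^ 3 := by nlinarith [Nat.zero_le X]

theorem cell3_le (h : PhaseEnv n m ph δ cap X ax ay s) {v x : ℕ} (hv : v < n) (hx : x ≤ n) :
    (ph * n + v) * n + x ≤ (X + 1) ^ 3 := by
  have h1 := h.n_le
  have h2 := h.ph_le
  calc (ph * n + v) * n + x ≤ (X * X + X) * X + X :=
        Nat.add_le_add (Nat.mul_le_mul (Nat.add_le_add (Nat.mul_le_mul h2 h1) (by omega)) h1)
          (by omega)
    _ ≤ (X + 1) ^ 3 := by nlinarith [Nat.zero_le X]

/-- The list invariant for the tables of phase `ph` in the memory `s`. -/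
def StoreInv (adj : ℕ → ℕ → Prop) (n ph cap r : ℕ) (A : Finset ℕ) (s : Store) : Prop :=
  ListInv adj n cap r A (distTab n ph s) (listTab n ph s) (countTab n ph s)

/-- The lists of phase `ph` only grow from `s` to `s'`. -/
def StoreExt (n ph r : ℕ) (s s' : Store) : Prop :=
  ListExt n r (distTab n ph s) (listTab n ph s) (countTab n ph s)
    (distTab n ph s') (listTab n ph s') (countTab n ph s')

/-- The test against `r + 2` forwards only entries older than the current round, so an entry cannot
travel over two arcs in one round and the recorded values remain breadth-first distances plus one.
The loop bound is the length of the list of `v` on entry; appending never moves those first entries,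
so the scan stays meaningful while tables change. -/
theorem wp_relax {r v w : ℕ} (env : PhaseEnv n m ph δ cap X ax ay s) (hW : (X + 1) ^ 3 + 3 ≤ W)
    (hadj : ∀ u v, adj u v → u < n ∧ v < n) (hAn : ∀ u ∈ A, u < n) (ha : adj v w)
    (h25 : s.var 25 = cell n ph v) (h26 : s.var 26 = cell n ph w)
    (h27 : s.var 27 = countTab n ph s v) (h28 : s.var 28 = 0) (h19 : s.var 19 = r) (hr : r < δ)
    (hinv : StoreInv adj n ph cap (r + 1) A s) (hfr : Fresh n (ph + 1) s) :
    wp W relax s fun t s' => t ≤ cap * 70 + 3 ∧ StoreInv adj n ph cap (r + 1) A s' ∧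
      StoreExt n ph r s s' ∧ Passed n cap r (distTab n ph s') (countTab n ph s') v w ∧
      Fresh n (ph + 1) s' := by
  obtain ⟨hv, hw⟩ := hadj v w ha
  have hX : X + 1 ≤ (X + 1) ^ 3 := Nat.le_self_pow (by norm_num) _
  have hcle := hinv.le v hv
  have := env.cap_le
  have := env.δ_le
  have := env.n_le
  refine (wp_for 0 (countTab n ph s v) 63 (fun j s' => StoreInv adj n ph cap (r + 1) A s' ∧
      StoreExt n ph r s s' ∧ Fresh n (ph + 1) s' ∧ ∀ j' < j, countTab n ph s' w = cap ∨
        (distTab n ph s v (listTab n ph s v j') ≤ r + 1 →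
          distTab n ph s' w (listTab n ph s v j') ≠ 0))
    h28 h27 (Nat.zero_le _) (by omega) rfl rfl rfl
    ⟨hinv, ListExt.refl _ _ _ _ _, hfr, fun j' hj' => absurd hj' (Nat.not_lt_zero _)⟩
    (fun i s' v h => h) ?_).imp ?_
  · rintro j s₁ - hj hx hf ⟨hinv₁, hext₁, hfr₁, hdone⟩
    have env₁ := env.frame hf
    have e25 : s₁.var 25 = cell n ph v := (hf.1 _ rfl).trans h25
    have e26 : s₁.var 26 = cell n ph w := (hf.1 _ rfl).trans h26
    have e19 : s₁.var 19 = r := (hf.1 _ rfl).trans h19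
    have hj₁ : j < countTab n ph s₁ v := hj.trans_le (hext₁.count v hv)
    have hjn : j < n := hj₁.trans_le (hinv₁.count_le hv)
    set y := listTab n ph s v j with hy
    have hy₁ : listTab n ph s₁ v j = y := hext₁.list v hv j hj
    obtain ⟨hyn, hyd⟩ := hinv₁.enum v hv j hj₁
    rw [hy₁] at hyn hyd
    have hyd0 : distTab n ph s v y ≠ 0 := (hinv.enum v hv j hj).2
    have b1 := hinv₁.bound v hv y hyn
    have b2 := hinv₁.bound w hw y hyn
    have b3 := hinv₁.le w hw
    have b4 := hinv₁.count_le hw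
    have eq9 : s₁.arr 9 ((ph * n + v) * n + j) = y := hy₁
    have eq8v : s₁.arr 8 ((ph * n + v) * n + y) = distTab n ph s₁ v y := rfl
    have eq8w : s₁.arr 8 ((ph * n + w) * n + y) = distTab n ph s₁ w y := rfl
    have eq10 : s₁.arr 10 (ph * n + w) = countTab n ph s₁ w := rfl
    have c1 := cell3_le env₁ hv hjn.le
    have c2 := cell3_le env₁ hv hyn.le
    have c3 := cell3_le env₁ hw hyn.le
    have c4 := cell3_le env₁ hw b4
    have c5 := cell2_le env₁ hv
    have c6 := cell2_le env₁ hw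
    have f5 : (ph * n + v) * n ≤ (X + 1) ^ 3 := by omega
    have f6 : (ph * n + w) * n ≤ (X + 1) ^ 3 := by omega
    unfold cell at e25 e26
    refine wp_seq (wp_assign ?_ (wp_ite ?_ (fun hb => ?_) fun hb => ?_))
    · simp [env₁.n_eq, e25, hx, eq9]
      omega
    · simp [env₁.n_eq, env₁.cap_eq, e25, e26, hx, eq9, eq8v, eq8w, eq10, e19]
      omega
    · simp [env₁.n_eq, env₁.cap_eq, e25, e26, hx, eq9, eq8v, eq8w, eq10, e19] at hb
      have hyA := (hinv₁.sound v hv y hyn hyd).1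
      have hnear : Near adj (r + 1) y w := by
        have h1 := (hinv₁.sound v hv y hyn hyd).2.step ha
        exact h1.mono (by omega)
      refine wp_seq (wp_write ?_ ?_ (wp_seq (wp_write ?_ ?_ (wp_write ?_ ?_ ?_))))
      · simp [env₁.n_eq, e25, e26, hx, eq9]
        omega
      · simp [e19]
        omega
      · simp [env₁.n_eq, e25, e26, hx, eq9, eq10]
        omega
      · simp [env₁.n_eq, e25, e26, hx, eq9]
        omega
      · simp [e26]
        omega
      · simp [e26, eq10]
        omega
      simp only [Expr.cost_add, Expr.cost_mul, Expr.cost_var, Expr.cost_arr, Expr.cost_lit,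
        Test.cost]
      refine ⟨by norm_num, ?_⟩
      generalize hs₂ : Store.setArr _ _ _ _ = s₂
      have h8 : s₂.arr 8 = Function.update (s₁.arr 8) (cell n (cell n ph w) y) (r + 2) := by
        simp [← hs₂, env₁.n_eq, e26, hx, eq9, e19, e25, cell]
      have h9 : s₂.arr 9 = Function.update (s₁.arr 9)
          (cell n (cell n ph w) (countTab n ph s₁ w)) y := by
        simp [← hs₂, env₁.n_eq, e26, hx, eq9, eq10, e25, cell]
      have h10 : s₂.arr 10 = Function.update (s₁.arr 10) (cell n ph w)
          (countTab n ph s₁ w + 1) := by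
        simp [← hs₂, e26, eq10, cell]
      have hcw := hinv₁.count_lt hw hyn hb.2.1
      have hd' : ∀ i, ∀ v' < n, ∀ x < n, s₂.arr 8 (cell n (cell n i v') x) =
          if (i = ph ∧ v' = w) ∧ x = y then r + 2 else s₁.arr 8 (cell n (cell n i v') x) := by
        intro i v' hv' x hx
        rw [h8, Function.update_apply]
        exact if_congr ((cell_inj hx hyn).trans (and_congr_left' (cell_inj hv' hw))) rfl rfl
      have hl' : ∀ i, ∀ v' < n, ∀ x < n, s₂.arr 9 (cell n (cell n i v') x) =
          if (i = ph ∧ v' = w) ∧ x = countTab n ph s₁ w then y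
          else s₁.arr 9 (cell n (cell n i v') x) := by
        intro i v' hv' x hx
        rw [h9, Function.update_apply]
        exact if_congr ((cell_inj hx hcw).trans (and_congr_left' (cell_inj hv' hw))) rfl rfl
      have hc' : ∀ i, ∀ v' < n, s₂.arr 10 (cell n i v') =
          if i = ph ∧ v' = w then countTab n ph s₁ w + 1 else s₁.arr 10 (cell n i v') := by
        intro i v' hv'
        rw [h10, Function.update_apply]
        exact if_congr (cell_inj hv' hw) rfl rfl
      have key := hinv₁.insert (d' := distTab n ph s₂) (l' := listTab n ph s₂)
        (c' := countTab n ph s₂) hw hyn hyA hAn hb.2.1 hb.2.2 hnear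
        (fun v' hv' x hx => by simpa [distTab] using hd' ph v' hv' x hx)
        (fun v' hv' x hx => by simpa [listTab] using hl' ph v' hv' x hx)
        (fun v' hv' => by simpa [countTab] using hc' ph v' hv')
      refine ⟨key.1, hext₁.trans key.2, ⟨?_, ?_⟩, ?_⟩
      · intro i hi v' hv' x hx
        rw [hd' i v' hv' x hx, if_neg (by omega)]
        exact hfr₁.1 i hi v' hv' x hx
      · intro i hi v' hv'
        rw [hc' i v' hv', if_neg (by omega)]
        exact hfr₁.2 i hi v' hv'
      · intro j' hj'
        rcases Nat.lt_succ_iff_lt_or_eq.1 hj' with hj' | rfl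
        · rcases hdone j' hj' with h | h
          · exact absurd h hb.2.2.ne
          · refine Or.inr fun h' => ?_
            have h1 := h h'
            rw [distTab, hd' ph w hw _ (hinv.enum v hv j' (by omega)).1]
            split_ifs
            · omega
            · exact h1
        · refine Or.inr fun _ => ?_
          rw [← hy, distTab, hd' ph w hw y hyn]
          simp
    · simp [env₁.n_eq, env₁.cap_eq, e25, e26, hx, eq9, eq8v, eq8w, eq10, e19] at hb
      refine wp_skip ⟨by norm_num, hinv₁, hext₁, hfr₁, fun j' hj' => ?_⟩
      rcases Nat.lt_succ_iff_lt_or_eq.1 hj' with hj' | rfl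
      · exact hdone j' hj'
      · rw [← hy]
        by_cases h0 : distTab n ph s₁ w y = 0
        · by_cases hlt : distTab n ph s₁ v y < r + 2
          · exact Or.inl (le_antisymm b3 (hb hlt h0))
          · refine Or.inr fun h' => absurd ?_ hlt
            have := hext₁.dist v hv y hyn
            omega
        · exact Or.inr fun _ => h0
  · rintro t s₁ ⟨ht, -, hinv₁, hext₁, hfr₁, hdone⟩
    refine ⟨ht.trans ?_, hinv₁, hext₁, ?_, hfr₁⟩
    · have := Nat.mul_le_mul_right 70 hcle
      simp only [Nat.sub_zero]
      omega
    · by_cases hc : countTab n ph s₁ w = cap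
      · exact Or.inl hc
      refine Or.inr fun x hx h1 h2 => ?_
      have h3 := hext₁.dist v hv x hx
      obtain ⟨j, hj, rfl⟩ := hinv.surj v hv x hx (by omega)
      exact (hdone j hj).resolve_left hc (by omega)

/-- The arcs of the graph are `(ax e, ay e)` for `e < m`. -/
structure IsArcs (adj : ℕ → ℕ → Prop) (n m : ℕ) (ax ay : ℕ → ℕ) : Prop where
  lt : ∀ u v, adj u v → u < n ∧ v < n
  symm : ∀ u v, adj u v → adj v u
  arc : ∀ e < m, adj (ax e) (ay e)
  surj : ∀ u v, adj u v → ∃ e < m, ax e = u ∧ ay e = v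

theorem wp_round {r : ℕ} (env : PhaseEnv n m ph δ cap X ax ay s) (hW : (X + 1) ^ 3 + 3 ≤ W)
    (harc : IsArcs adj n m ax ay) (hAn : ∀ u ∈ A, u < n)
    (h19 : s.var 19 = r) (hr : r < δ)
    (hinv : StoreInv adj n ph cap r A s)
    (hcomp : Complete adj n cap r A (distTab n ph s) (countTab n ph s))
    (hfr : Fresh n (ph + 1) s) :
    wp W round s fun t s' => t ≤ (m + 1) * (cap * 70 + 50) ∧ StoreInv adj n ph cap (r + 1) A s' ∧
      Complete adj n cap (r + 1) A (distTab n ph s') (countTab n ph s') ∧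
      Fresh n (ph + 1) s' := by
  have hX : X + 1 ≤ (X + 1) ^ 3 := Nat.le_self_pow (by norm_num) _
  have := env.cap_le
  have := env.n_le
  have := env.m_le
  refine wp_seq (wp_assign (by simp) ?_)
  have env₀ : PhaseEnv n m ph δ cap X ax ay (s.setVar 18 0) :=
    env.frame (p := .assign 18 (.lit 0)) ⟨fun x hx => by
      have : x ≠ 18 := by simpa [Cmd.writesVar] using hx
      simp [this], fun _ _ => rfl⟩
  refine (wp_for (s := s.setVar 18 0) 0 m (cap * 70 + 33) (fun e s' => StoreInv adj n ph cap (r + 1) A s' ∧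
      StoreExt n ph r s s' ∧ Fresh n (ph + 1) s' ∧ ∀ e' < e,
        Passed n cap r (distTab n ph s') (countTab n ph s') (ax e') (ay e'))
    (by simp) (by simpa using env.m_eq) (Nat.zero_le _) (by omega) rfl rfl rfl
    -- The bound on recorded distances is weakened at once to the one valid after the round, since
    -- entries of both ages coexist during it.
    ⟨hinv.mono_radius (Nat.le_succ r), ListExt.refl _ _ _ _ _, hfr,
      fun j' hj' => absurd hj' (Nat.not_lt_zero _)⟩
    (fun i s' v h => h) ?_).imp ?_
  · rintro e s₁ - he hx hf ⟨hinv₁, hext₁, hfr₁, hdone⟩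
    have env₁ := env₀.frame hf
    have ha := harc.arc e he
    obtain ⟨hv, hw⟩ := harc.lt _ _ ha
    have c1 := cell2_le env₁ hv
    have c2 := cell2_le env₁ hw
    have b1 := hinv₁.le _ hv
    have eq10 : s₁.arr 10 (ph * n + ax e) = countTab n ph s₁ (ax e) := rfl
    refine wp_seq (wp_assign ?_ (wp_seq (wp_assign ?_ (wp_seq (wp_assign ?_
      (wp_seq (wp_assign (by simp) ?_)))))))
    · simp [env₁.n_eq, env₁.ph_eq, env₁.ax_eq, hx]
      have := env.ph_le
      omega
    · simp [env₁.n_eq, env₁.ph_eq, env₁.ay_eq, hx]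
      have := env.ph_le
      omega
    · simp [env₁.n_eq, env₁.ph_eq, env₁.ax_eq, hx, eq10]
      omega
    generalize hs₂ : Store.setVar _ 28 _ = s₂
    have hf₂ : ∀ x, x ≠ 25 → x ≠ 26 → x ≠ 27 → x ≠ 28 → s₂.var x = s₁.var x := by
      intro x h1 h2 h3 h4
      simp [← hs₂, h1, h2, h3, h4]
    have ha₂ : s₂.arr = s₁.arr := by rw [← hs₂]; rfl
    have inv₂ : StoreInv adj n ph cap (r + 1) A s₂ := by
      rw [← hs₂]; exact hinv₁
    have hfr₂ : Fresh n (ph + 1) s₂ := by rw [← hs₂]; exact hfr₁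
    have hext₂ : StoreExt n ph r s s₂ := by rw [← hs₂]; exact hext₁
    have env₂ : PhaseEnv n m ph δ cap X ax ay s₂ := by
      constructor <;>
        first
        | rw [hf₂ _ (by norm_num) (by norm_num) (by norm_num) (by norm_num)]
        | rw [ha₂]
        | skip
      exacts [env₁.n_eq, env₁.m_eq, env₁.ph_eq, env₁.δ_eq, env₁.cap_eq, env₁.ax_eq, env₁.ay_eq,
        env₁.n_le, env₁.m_le, env₁.ph_le, env₁.δ_le, env₁.cap_le]
    refine (wp_relax (r := r) env₂ hW harc.lt hAn ha ?_ ?_ ?_ ?_ ?_ hr inv₂ hfr₂).imp ?_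
    · simp [← hs₂, env₁.n_eq, env₁.ph_eq, env₁.ax_eq, hx, cell]
    · simp [← hs₂, env₁.n_eq, env₁.ph_eq, env₁.ay_eq, hx, cell]
    · simp [← hs₂, env₁.n_eq, env₁.ph_eq, env₁.ax_eq, hx, countTab, cell]
    · simp [← hs₂]
    · rw [hf₂ _ (by norm_num) (by norm_num) (by norm_num) (by norm_num), hf.1 19 rfl]
      simpa using h19
    · rintro t s₃ ⟨ht, inv₃, hext₃, hpass, hfr₃⟩
      refine ⟨?_, inv₃, hext₂.trans hext₃, hfr₃, fun e' he' => ?_⟩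
      · simp only [Expr.cost_add, Expr.cost_mul, Expr.cost_var, Expr.cost_arr, Expr.cost_lit]
        omega
      · rcases Nat.lt_succ_iff_lt_or_eq.1 he' with he' | rfl
        · obtain ⟨hv', hw'⟩ := harc.lt _ _ (harc.arc e' (by omega))
          have := hdone e' he'
          rw [show distTab n ph s₁ = distTab n ph s₂ by rw [← hs₂]; rfl,
            show countTab n ph s₁ = countTab n ph s₂ by rw [← hs₂]; rfl] at this
          -- Arcs treated earlier stay passed while the present arc is relaxed.
          exact this.ext hv' hw' hext₃ (inv₃.le _ hw')
        · exact hpass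
  · rintro t s₁ ⟨ht, -, hinv₁, hext₁, hfr₁, hdone⟩
    refine ⟨?_, hinv₁, ?_, hfr₁⟩
    · simp only [Expr.cost_lit]
      rw [Nat.sub_zero] at ht
      have : (m + 1) * (cap * 70 + 50) = m * (cap * 70 + 33 + 7) + 10 * m + (cap * 70 + 50) := by
        ring
      omega
    · refine hcomp.succ hinv hinv₁ hext₁ harc.lt hAn fun v w ha => ?_
      obtain ⟨e, he, rfl, rfl⟩ := harc.surj v w ha
      exact hdone e he

end

end Ram

/-! ### Seeding the lists and detecting nearby centres -/

namespace Ram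

/-- `f 0, …, f (a - 1)` is a list of `A` without repetitions. -/
structure Enumerates (A : Finset ℕ) (a : ℕ) (f : ℕ → ℕ) : Prop where
  eq_image : A = (Finset.range a).image f
  card_eq : A.card = a

namespace Enumerates

variable {A : Finset ℕ} {a : ℕ} {f g : ℕ → ℕ}

theorem mem (h : Enumerates A a f) {j : ℕ} (hj : j < a) : f j ∈ A := by
  rw [h.eq_image]
  exact Finset.mem_image_of_mem _ (Finset.mem_range.2 hj)

theorem exists_eq (h : Enumerates A a f) {u : ℕ} (hu : u ∈ A) : ∃ j < a, f j = u := by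
  rw [h.eq_image] at hu
  simpa using hu

/-- The image of `a` indices has `a` elements, which leaves no room for a collision. -/
theorem inj (h : Enumerates A a f) {i j : ℕ} (hi : i < a) (hj : j < a) (hij : f i = f j) :
    i = j := by
  have hc : ((Finset.range a).image f).card = (Finset.range a).card := by
    rw [← h.eq_image, h.card_eq, Finset.card_range]
  exact Finset.card_image_iff.1 hc (by simpa using hi) (by simpa using hj) hij

theorem empty (f : ℕ → ℕ) : Enumerates ∅ 0 f := ⟨by simp, rfl⟩

theorem congr (h : Enumerates A a f) (hg : ∀ j < a, g j = f j) : Enumerates A a g := by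
  refine ⟨h.eq_image.trans (Finset.image_congr fun j hj => ?_), h.card_eq⟩
  exact (hg j (by simpa using hj)).symm

theorem insert (h : Enumerates A a f) {u : ℕ} (hu : u ∉ A) (hg : ∀ j < a, g j = f j)
    (hga : g a = u) : Enumerates (insert u A) (a + 1) g := by
  refine ⟨?_, by rw [Finset.card_insert_of_notMem hu, h.card_eq]⟩
  rw [Finset.range_add_one, Finset.image_insert, hga, ← (h.congr hg).eq_image]

end Enumerates

section

variable {n m ph δ cap X W a : ℕ} {ax ay : ℕ → ℕ} {s s' : Store} {p : Cmd}
  {adj : ℕ → ℕ → Prop} {A : Finset ℕ}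

/-- At radius zero the only walk is trivial, so completeness means that every centre lists itself.
Placing it in position 0 matters later: lists grow only at the end, so the first entry of a centre's
list is always the centre. -/
theorem wp_seed (env : PhaseEnv n m ph δ cap X ax ay s) (hW : (X + 1) ^ 3 + 3 ≤ W)
    (hcap : 1 ≤ cap) (hAn : ∀ u ∈ A, u < n) (h11 : s.var 11 = a)
    (hA : Enumerates A a fun j => s.arr 11 (cell n ph j)) (hfr : Fresh n ph s) :
    wp W seed s fun t s' => t ≤ a * 50 + 5 ∧ StoreInv adj n ph cap 0 A s' ∧
      Complete adj n cap 0 A (distTab n ph s') (countTab n ph s') ∧ Fresh n (ph + 1) s' := by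
  have hX : X + 1 ≤ (X + 1) ^ 3 := Nat.le_self_pow (by norm_num) _
  have := env.n_le
  have := env.ph_le
  have han : a ≤ n := by
    rw [← hA.card_eq]
    calc A.card ≤ (Finset.range n).card :=
          Finset.card_le_card fun u hu => Finset.mem_range.2 (hAn u hu)
      _ = n := by simp
  refine wp_seq (wp_assign (by simp) ?_)
  -- The invariant determines the distances and the counts of this phase completely after `i`
  -- centres; this uses that they start out zero.
  refine (wp_for (s := s.setVar 20 0) 0 a 43 (fun i s' =>
      (∀ v < n, ∀ x < n, distTab n ph s' v x =
        if v = x ∧ ∃ j < i, s.arr 11 (cell n ph j) = v then 1 else 0) ∧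
      (∀ v < n, countTab n ph s' v =
        if ∃ j < i, s.arr 11 (cell n ph j) = v then 1 else 0) ∧
      (∀ j < i, listTab n ph s' (s.arr 11 (cell n ph j)) 0 = s.arr 11 (cell n ph j)) ∧
      Fresh n (ph + 1) s')
    (by simp) (by simpa using h11) (Nat.zero_le _) (by omega) rfl rfl rfl
    ⟨fun v hv x hx => by simpa [distTab] using hfr.1 ph le_rfl v hv x hx,
      fun v hv => by simpa [countTab] using hfr.2 ph le_rfl v hv, by simp,
      fun i hi => hfr.1 i (by omega), fun i hi => hfr.2 i (by omega)⟩
    (fun i s' v h => h) ?_).imp ?_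
  · rintro i s₁ - hi hx hf ⟨hd, hc, hl, hfr₁⟩
    set u := s.arr 11 (cell n ph i) with hu
    have huA : u ∈ A := hA.mem hi
    have hun := hAn u huA
    have eq11 : s₁.arr 11 (ph * n + i) = u := by rw [hf.2 11 rfl]; rfl
    have e0 : s₁.var 0 = n := (hf.1 _ rfl).trans (by simpa using env.n_eq)
    have e12 : s₁.var 12 = ph := (hf.1 _ rfl).trans (by simpa using env.ph_eq)
    have c1 := cell2_le env hun
    have c2 := cell3_le env hun hun.le
    have c3 := cell2_le env (hi.trans_le han)
    refine wp_seq (wp_assign ?_ (wp_seq (wp_assign ?_ (wp_seq (wp_write ?_ (by simp; omega)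
      (wp_seq (wp_write ?_ ?_ (wp_write ?_ (by simp; omega) ?_))))))))
    · simp [e0, e12, hx, eq11]
      omega
    · simp [e0, e12, hx, eq11]
      omega
    · simp [e0, e12, hx, eq11]
      omega
    · simp [e0, e12, hx, eq11]
      omega
    · simp [e0, e12, hx, eq11]
      omega
    · simp [e0, e12, hx, eq11]
      omega
    simp only [Expr.cost_add, Expr.cost_mul, Expr.cost_var, Expr.cost_arr, Expr.cost_lit]
    refine ⟨by norm_num, ?_⟩
    generalize hs₂ : Store.setArr _ _ _ _ = s₂
    have h8 : s₂.arr 8 = Function.update (s₁.arr 8) (cell n (cell n ph u) u) 1 := by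
      simp [← hs₂, e0, e12, hx, eq11, cell]
    have h9 : s₂.arr 9 = Function.update (s₁.arr 9) (cell n (cell n ph u) 0) u := by
      simp [← hs₂, e0, e12, hx, eq11, cell]
    have h10 : s₂.arr 10 = Function.update (s₁.arr 10) (cell n ph u) 1 := by
      simp [← hs₂, e0, e12, hx, eq11, cell]
    have hd' : ∀ i, ∀ v' < n, ∀ x < n, s₂.arr 8 (cell n (cell n i v') x) =
        if (i = ph ∧ v' = u) ∧ x = u then 1 else s₁.arr 8 (cell n (cell n i v') x) := by
      intro i v' hv' x hx
      rw [h8, Function.update_apply]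
      exact if_congr ((cell_inj hx hun).trans (and_congr_left' (cell_inj hv' hun))) rfl rfl
    have hc' : ∀ i, ∀ v' < n, s₂.arr 10 (cell n i v') =
        if i = ph ∧ v' = u then 1 else s₁.arr 10 (cell n i v') := by
      intro i v' hv'
      rw [h10, Function.update_apply]
      exact if_congr (cell_inj hv' hun) rfl rfl
    have hex : ∀ v, (∃ j < i + 1, s.arr 11 (cell n ph j) = v) ↔
        v = u ∨ ∃ j < i, s.arr 11 (cell n ph j) = v := by
      intro v
      constructor
      · rintro ⟨j, hj, rfl⟩
        rcases Nat.lt_succ_iff_lt_or_eq.1 hj with hj | rfl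
        · exact Or.inr ⟨j, hj, rfl⟩
        · exact Or.inl rfl
      · rintro (rfl | ⟨j, hj, rfl⟩)
        · exact ⟨i, by omega, rfl⟩
        · exact ⟨j, by omega, rfl⟩
    refine ⟨fun v hv x hx => ?_, fun v hv => ?_, fun j hj => ?_, fun k hk v hv x hx => ?_,
      fun k hk v hv => ?_⟩
    · rw [distTab, hd' ph v hv x hx]
      simp only [hex]
      have := hd v hv x hx
      rw [distTab] at this
      by_cases e : v = u ∧ x = u
      · simp [e]
      · rw [if_neg (by tauto), this]
        refine if_congr ?_ rfl rfl
        constructor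
        · tauto
        · rintro ⟨rfl, rfl | h⟩
          · exact absurd ⟨rfl, rfl⟩ e
          · exact ⟨rfl, h⟩
    · rw [countTab, hc' ph v hv]
      simp only [hex]
      have := hc v hv
      rw [countTab] at this
      by_cases e : v = u
      · simp [e]
      · simp [e, this]
    · have hju : s.arr 11 (cell n ph j) < n := hAn _ (hA.mem (by omega))
      rw [listTab, h9, Function.update_apply]
      split_ifs with e
      · exact (((cell_inj (by omega) (by omega)).1 e).1 |> (cell_inj hju hun).1 |>.2).symm
      · rcases Nat.lt_succ_iff_lt_or_eq.1 hj with hj | rfl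
        · exact hl j hj
        · exact absurd rfl e
    · rw [hd' k v hv x hx, if_neg (by omega)]
      exact hfr₁.1 k hk v hv x hx
    · rw [hc' k v hv, if_neg (by omega)]
      exact hfr₁.2 k hk v hv
  · rintro t s₁ ⟨ht, -, hd, hc, hl, hfr₁⟩
    have hex : ∀ v, (∃ j < a, s.arr 11 (cell n ph j) = v) ↔ v ∈ A := fun v =>
      ⟨fun ⟨j, hj, h⟩ => h ▸ hA.mem hj, hA.exists_eq⟩
    simp only [hex] at hd hc
    have hmem : ∀ v < n, ∀ x < n, distTab n ph s₁ v x ≠ 0 ↔ v = x ∧ v ∈ A := by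
      intro v hv x hx
      rw [hd v hv x hx]
      simp
    refine ⟨?_, ⟨fun v hv => ?_, fun v hv => ?_, fun v hv j hj => ?_, fun v hv x hx h => ?_,
      fun v hv x hx h => ?_, fun v hv x hx => ?_, fun u hu => ?_⟩, fun v hv => ?_, hfr₁⟩
    · simp only [Expr.cost_lit]
      omega
    · rw [hc v hv]
      split_ifs with e
      · symm
        rw [Finset.card_eq_one]
        refine ⟨v, ?_⟩
        ext x
        simp only [Finset.mem_filter, Finset.mem_range, Finset.mem_singleton]
        constructor
        · rintro ⟨hx, h⟩
          exact ((hmem v hv x hx).1 h).1.symm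
        · rintro rfl
          exact ⟨hv, (hmem x hv x hv).2 ⟨rfl, e⟩⟩
      · symm
        rw [Finset.card_eq_zero, Finset.filter_eq_empty_iff]
        intro x hx h
        exact e ((hmem v hv x (by simpa using hx)).1 h).2
    · rw [hc v hv]
      split_ifs <;> omega
    · rw [hc v hv] at hj
      split_ifs at hj with e
      · obtain ⟨i, hi, rfl⟩ := hA.exists_eq e
        obtain rfl : j = 0 := by omega
        have h1 := hl i hi
        rw [h1]
        exact ⟨hv, (hmem _ hv _ hv).2 ⟨rfl, e⟩⟩
      · omega
    · obtain ⟨rfl, e⟩ := (hmem v hv x hx).1 h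
      obtain ⟨i, hi, rfl⟩ := hA.exists_eq e
      exact ⟨0, by rw [hc _ hv, if_pos e]; norm_num, hl i hi⟩
    · obtain ⟨rfl, e⟩ := (hmem v hv x hx).1 h
      exact ⟨e, Near.refl _ _ _⟩
    · rw [hd v hv x hx]
      split_ifs <;> omega
    · obtain ⟨i, hi, rfl⟩ := hA.exists_eq hu
      exact ⟨by rw [hc _ (hAn _ hu), if_pos hu]; norm_num, hl i hi⟩
    · refine Or.inr fun x hx e he hnear => ?_
      obtain rfl : e = 0 := by omega
      obtain rfl : x = v := hnear
      rw [hd x hv x hv]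
      simp [hx]

theorem wp_detect (env : PhaseEnv n m ph δ cap X ax ay s) (hW : (X + 1) ^ 3 + 3 ≤ W)
    (harc : IsArcs adj n m ax ay)
    (hcap : 1 ≤ cap) (hAn : ∀ u ∈ A, u < n) (h11 : s.var 11 = a)
    (hA : Enumerates A a fun j => s.arr 11 (cell n ph j)) (hfr : Fresh n ph s) :
    wp W detect s fun t s' => t ≤ a * 50 + 10 + δ * ((m + 1) * (cap * 70 + 57)) ∧
      StoreInv adj n ph cap δ A s' ∧
      Complete adj n cap δ A (distTab n ph s') (countTab n ph s') ∧ Fresh n (ph + 1) s' := by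
  have hX : X + 1 ≤ (X + 1) ^ 3 := Nat.le_self_pow (by norm_num) _
  have := env.δ_le
  refine wp_seq ((wp_seed (adj := adj) env hW hcap hAn h11 hA hfr).imp_frame ?_)
  rintro t₁ s₁ hf₁ ⟨ht₁, hinv₁, hcomp₁, hfr₁⟩
  have env₁ := env.frame hf₁
  refine wp_seq (wp_assign (by simp) ?_)
  have env₂ : PhaseEnv n m ph δ cap X ax ay (s₁.setVar 19 0) :=
    env₁.frame (p := .assign 19 (.lit 0)) ⟨fun x hx => by
      have : x ≠ 19 := by simpa [Cmd.writesVar] using hx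
      simp [this], fun _ _ => rfl⟩
  refine (wp_for (s := s₁.setVar 19 0) 0 δ ((m + 1) * (cap * 70 + 50))
    (fun r s' => StoreInv adj n ph cap r A s' ∧
      Complete adj n cap r A (distTab n ph s') (countTab n ph s') ∧ Fresh n (ph + 1) s')
    (by simp) (by simpa using env₁.δ_eq) (Nat.zero_le _) (by omega) rfl rfl rfl
    ⟨hinv₁, hcomp₁, hfr₁⟩ (fun i s' v h => h) ?_).imp ?_
  · rintro r s₂ - hr hx hf ⟨hinv₂, hcomp₂, hfr₂⟩
    exact wp_round (env₂.frame hf) hW harc hAn hx hr hinv₂ hcomp₂ hfr₂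
  · rintro t s₂ ⟨ht, -, hinv₂, hcomp₂, hfr₂⟩
    refine ⟨?_, hinv₂, hcomp₂, hfr₂⟩
    have : δ * ((m + 1) * (cap * 70 + 50) + 7) ≤ δ * ((m + 1) * (cap * 70 + 57)) :=
      Nat.mul_le_mul_left _ (by ring_nf; omega)
    simp only [Expr.cost_lit, Nat.sub_zero] at ht ⊢
    omega

end

end Ram

/-! ### Inserting edges into the output list -/

namespace Ram

section Programs

open Ram.Expr Ram.Test Ram.Cmd

/-- Insert the edge from `30` to `31` with weight `32`, or lower its weight. -/
def addEdge : Cmd :=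
  assign 33 (arr 5 (var 30 * var 0 + var 31)) ;;
  ite (eq (var 33) (lit 0))
    (write 2 (var 4) (var 30) ;; write 3 (var 4) (var 31) ;; write 4 (var 4) (var 32) ;;
      assign 4 (var 4 + lit 1) ;;
      write 5 (var 30 * var 0 + var 31) (var 4) ;; write 5 (var 31 * var 0 + var 30) (var 4))
    (ite (lt (var 32) (arr 4 (var 33 - lit 1))) (write 4 (var 33 - lit 1) (var 32)) skip)

/-- Find a source (plus one) in the list of row `25` that has an owner. -/
def findOwned : Cmd :=
  assign 23 (lit 0) ;; assign 28 (lit 0) ;;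
  forLoop 28 27 (
    assign 29 (arr 9 (var 25 * var 0 + var 28)) ;;
    ite (eq (arr 12 (var 12 * var 0 + var 29)) (lit 0)) skip (assign 23 (var 29 + lit 1)))

/-- The centre `21` becomes a new centre and the owner of its list. -/
def promote : Cmd :=
  assign 28 (lit 0) ;;
  forLoop 28 27
    (write 12 (var 12 * var 0 + arr 9 (var 25 * var 0 + var 28)) (var 21 + lit 1)) ;;
  write 11 ((var 12 + lit 1) * var 0 + var 17) (var 21) ;; assign 17 (var 17 + lit 1)

/-- The centre `21` is joined to the owner of the source `23` (plus one) on its list. -/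
def attach : Cmd :=
  assign 23 (var 23 - lit 1) ;; assign 31 (arr 12 (var 12 * var 0 + var 23) - lit 1) ;;
  assign 30 (var 21) ;;
  assign 32 ((arr 8 (var 25 * var 0 + var 23) - lit 1) +
    (arr 8 ((var 12 * var 0 + var 31) * var 0 + var 23) - lit 1)) ;;
  addEdge

/-- The centre `21` is joined to all sources on its list. -/
def connect : Cmd :=
  assign 30 (var 21) ;; assign 28 (lit 1) ;;
  forLoop 28 27 (
    assign 31 (arr 9 (var 25 * var 0 + var 28)) ;;
    assign 32 (arr 8 (var 25 * var 0 + var 31) - lit 1) ;;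
    ite (eq (var 31) (var 30)) skip addEdge)

/-- Treat the `20`-th centre. -/
def treat : Cmd :=
  assign 21 (arr 11 (var 12 * var 0 + var 20)) ;; assign 25 (var 12 * var 0 + var 21) ;;
  assign 27 (arr 10 (var 25)) ;;
  ite (lt (var 27) (var 15)) connect (findOwned ;; ite (eq (var 23) (lit 0)) promote attach)

/-- Choose the new centres and insert the edges of a phase. -/
def choose : Cmd :=
  assign 17 (lit 0) ;; assign 20 (lit 0) ;; forLoop 20 11 treat

end Programs

/-- The output arrays list edges between different vertices without repetition, their weights
are lengths of walks, and array `5` finds the position (plus one) of an edge in the list. -/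
structure OutInv (adj : ℕ → ℕ → Prop) (n W : ℕ) (s : Store) : Prop where
  lt : ∀ j < s.var 4, s.arr 2 j < n ∧ s.arr 3 j < n ∧ s.arr 2 j ≠ s.arr 3 j
  index : ∀ j < s.var 4, s.arr 5 (cell n (s.arr 2 j) (s.arr 3 j)) = j + 1 ∧
    s.arr 5 (cell n (s.arr 3 j) (s.arr 2 j)) = j + 1
  near : ∀ j < s.var 4, Near adj (s.arr 4 j) (s.arr 2 j) (s.arr 3 j) ∧ s.arr 4 j ≤ W
  found : ∀ u < n, ∀ v < n, s.arr 5 (cell n u v) ≠ 0 → s.arr 5 (cell n u v) - 1 < s.var 4 ∧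
    ((s.arr 2 (s.arr 5 (cell n u v) - 1) = u ∧ s.arr 3 (s.arr 5 (cell n u v) - 1) = v) ∨
      (s.arr 2 (s.arr 5 (cell n u v) - 1) = v ∧ s.arr 3 (s.arr 5 (cell n u v) - 1) = u))

/-- There is an edge of weight at most `w` between `u` and `v`. -/
def HasEdge (n : ℕ) (s : Store) (u v w : ℕ) : Prop :=
  s.arr 5 (cell n u v) ≠ 0 ∧ s.arr 4 (s.arr 5 (cell n u v) - 1) ≤ w

/-- No edge is lost or gets heavier. -/
def EdgeMono (n : ℕ) (s s' : Store) : Prop :=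
  ∀ u < n, ∀ v < n, ∀ w, HasEdge n s u v w → HasEdge n s' u v w

theorem EdgeMono.trans {n : ℕ} {s₁ s₂ s₃ : Store} (h : EdgeMono n s₁ s₂) (h' : EdgeMono n s₂ s₃) :
    EdgeMono n s₁ s₃ := fun u hu v hv w hw => h' u hu v hv w (h u hu v hv w hw)

theorem HasEdge.mono {n : ℕ} {s : Store} {u v w w' : ℕ} (h : HasEdge n s u v w) (hw : w ≤ w') :
    HasEdge n s u v w' := ⟨h.1, h.2.trans hw⟩

section

variable {n m ph δ cap X W a : ℕ} {ax ay : ℕ → ℕ} {s s' : Store} {p : Cmd}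
  {adj : ℕ → ℕ → Prop} {A : Finset ℕ}

theorem OutInv.congr (h : OutInv adj n W s) (h4 : s'.var 4 = s.var 4) (a2 : s'.arr 2 = s.arr 2)
    (a3 : s'.arr 3 = s.arr 3) (a4 : s'.arr 4 = s.arr 4) (a5 : s'.arr 5 = s.arr 5) :
    OutInv adj n W s' := by
  constructor <;> rw [h4, a2, a3]
  · exact h.lt
  · rw [a5]; exact h.index
  · rw [a4]; exact h.near
  · rw [a5]; exact h.found

theorem HasEdge.congr {u v w : ℕ} (h : HasEdge n s u v w)
    (a4 : s'.arr 4 = s.arr 4) (a5 : s'.arr 5 = s.arr 5) : HasEdge n s' u v w := by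
  unfold HasEdge
  rw [a4, a5]
  exact h

/-- The index table recovers a position from its pair of endpoints, so positions inject into the `n
* n` cells. This keeps the edge counter within a word. -/
theorem OutInv.count_le (h : OutInv adj n W s) : s.var 4 ≤ n * n := by
  have : (Finset.range (s.var 4)).card ≤ (Finset.range (n * n)).card := by
    refine Finset.card_le_card_of_injOn (fun j => cell n (s.arr 2 j) (s.arr 3 j)) ?_ ?_
    · intro j hj
      have hj := h.lt j (by simpa using hj)
      simpa using cell_lt hj.2.1 hj.1
    · intro i hi j hj hij
      have h1 := (h.index i (by simpa using hi)).1
      have h2 := (h.index j (by simpa using hj)).1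
      simp only at hij
      rw [hij, h2] at h1
      omega
  simpa using this

theorem HasEdge.symm {u v w : ℕ} (h : HasEdge n s u v w) (hs : OutInv adj n W s) (hu : u < n)
    (hv : v < n) : HasEdge n s v u w := by
  obtain ⟨h0, h1⟩ := h
  obtain ⟨hj, hc⟩ := hs.found u hu v hv h0
  have hi := hs.index _ hj
  have he : s.arr 5 (cell n v u) = s.arr 5 (cell n u v) := by
    rcases hc with ⟨e2, e3⟩ | ⟨e2, e3⟩
    · rw [e2, e3] at hi
      omega
    · rw [e2, e3] at hi
      omega
  unfold HasEdge
  rw [he]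
  exact ⟨h0, h1⟩

/-- A pair that is already listed only has its weight lowered; hence the output stays a simple
graph, at most one edge is counted, and no earlier weight bound is lost. The position is stored plus
one, for both orders of the endpoints, because a zero cell of untouched memory must mean absence. -/
theorem wp_addEdge {u v w : ℕ} (h0 : s.var 0 = n) (hn : n ≤ X) (hW : (X + 1) ^ 3 + 3 ≤ W)
    (h30 : s.var 30 = u) (h31 : s.var 31 = v) (h32 : s.var 32 = w) (hu : u < n) (hv : v < n)
    (huv : u ≠ v) (hw : w ≤ W) (hnear : Near adj w u v)
    (hsymm : ∀ u v, adj u v → adj v u) (hs : OutInv adj n W s) :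
    wp W addEdge s fun t s' => t ≤ 60 ∧ OutInv adj n W s' ∧ HasEdge n s' u v w ∧
      EdgeMono n s s' ∧ s'.var 4 ≤ s.var 4 + 1 := by
  have hX : X + 1 ≤ (X + 1) ^ 3 := Nat.le_self_pow (by norm_num) _
  have hMn := hs.count_le
  have hnn : n * n + n ≤ (X + 1) ^ 3 := by
    calc n * n + n ≤ X * X + X := Nat.add_le_add (Nat.mul_le_mul hn hn) hn
      _ ≤ (X + 1) ^ 3 := by nlinarith [Nat.zero_le X]
  have cuv : u * n + v ≤ n * n := (cell_lt hv hu).le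
  have cvu : v * n + u ≤ n * n := (cell_lt hu hv).le
  have i5 : s.arr 5 (u * n + v) ≤ n * n := by
    by_cases h : s.arr 5 (u * n + v) = 0
    · omega
    · have := (hs.found u hu v hv h).1
      unfold cell at this
      omega
  refine wp_seq (wp_assign ?_ (wp_ite ?_ (fun hb => ?_) fun hb => ?_))
  · simp [h0, h30, h31]
    omega
  · simp [h0, h30, h31]
    omega
  · simp [h0, h30, h31] at hb
    -- A position stored for the reversed pair would be stored for the pair as well.
    have hb' : s.arr 5 (cell n v u) = 0 := by
      by_contra hne
      obtain ⟨hj, hc⟩ := hs.found v hv u hu hne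
      have hi := hs.index _ hj
      unfold cell at hi hc hj hne
      rcases hc with ⟨e2, e3⟩ | ⟨e2, e3⟩ <;> rw [e2, e3] at hi <;> omega
    set M := s.var 4 with hM
    refine wp_seq (wp_write ?_ ?_ (wp_seq (wp_write ?_ ?_ (wp_seq (wp_write ?_ ?_
      (wp_seq (wp_assign ?_ (wp_seq (wp_write ?_ ?_ (wp_write ?_ ?_ ?_))))))))))
    iterate 11
      · simp [h0, h30, h31, h32, ← hM]; omega
    simp only [Expr.cost_add, Expr.cost_mul, Expr.cost_var, Expr.cost_arr, Expr.cost_lit,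
      Test.cost]
    refine ⟨by norm_num, ?_⟩
    generalize hs₂ : Store.setArr _ _ _ _ = s₂
    have v4 : s₂.var 4 = M + 1 := by simp [← hs₂, ← hM]
    have a2 : s₂.arr 2 = Function.update (s.arr 2) M u := by simp [← hs₂, ← hM, h30]
    have a3 : s₂.arr 3 = Function.update (s.arr 3) M v := by simp [← hs₂, ← hM, h31]
    have a4 : s₂.arr 4 = Function.update (s.arr 4) M w := by simp [← hs₂, ← hM, h32]
    have a5 : s₂.arr 5 = Function.update (Function.update (s.arr 5) (cell n u v) (M + 1))
        (cell n v u) (M + 1) := by simp [← hs₂, ← hM, h0, h30, h31, cell]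
    have g5 : ∀ x < n, ∀ y < n, s₂.arr 5 (cell n x y) =
        if x = v ∧ y = u then M + 1 else if x = u ∧ y = v then M + 1 else s.arr 5 (cell n x y) := by
      intro x hx y hy
      rw [a5, Function.update_apply, Function.update_apply]
      exact if_congr (cell_inj hy hu) rfl (if_congr (cell_inj hy hv) rfl rfl)
    have old : ∀ x < n, ∀ y < n, s.arr 5 (cell n x y) ≠ 0 →
        s₂.arr 5 (cell n x y) = s.arr 5 (cell n x y) := by
      intro x hx y hy hne
      rw [g5 x hx y hy, if_neg, if_neg]
      · rintro ⟨rfl, rfl⟩; exact hne hb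
      · rintro ⟨rfl, rfl⟩; exact hne hb'
    refine ⟨⟨fun j hj => ?_, fun j hj => ?_, fun j hj => ?_, fun x hx y hy hne => ?_⟩, ?_, ?_, ?_⟩
    · rw [a2, a3, Function.update_apply, Function.update_apply]
      split_ifs with e
      · exact ⟨hu, hv, huv⟩
      · exact hs.lt j (by omega)
    · rw [a2, a3, Function.update_apply, Function.update_apply]
      split_ifs with e
      · rw [g5 u hu v hv, g5 v hv u hu]
        simp [e]
      · obtain ⟨h1, h2, -⟩ := hs.lt j (by omega)
        obtain ⟨h3, h4⟩ := hs.index j (by omega)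
        rw [old _ h1 _ h2 (by omega), old _ h2 _ h1 (by omega)]
        exact ⟨h3, h4⟩
    · rw [a2, a3, a4, Function.update_apply, Function.update_apply, Function.update_apply]
      split_ifs with e
      · exact ⟨hnear, hw⟩
      · exact hs.near j (by omega)
    · by_cases e : (x = v ∧ y = u) ∨ (x = u ∧ y = v)
      · have : s₂.arr 5 (cell n x y) = M + 1 := by
          rw [g5 x hx y hy]
          rcases e with e | e <;> simp [e]
        rw [this, v4, a2, a3]
        simp only [Nat.add_sub_cancel, Function.update_self]
        refine ⟨by omega, ?_⟩
        rcases e with ⟨rfl, rfl⟩ | ⟨rfl, rfl⟩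
        · exact Or.inr ⟨rfl, rfl⟩
        · exact Or.inl ⟨rfl, rfl⟩
      · have h5 : s₂.arr 5 (cell n x y) = s.arr 5 (cell n x y) := by
          rw [g5 x hx y hy, if_neg (by tauto), if_neg (by tauto)]
        rw [h5] at hne ⊢
        obtain ⟨h1, h2⟩ := hs.found x hx y hy hne
        rw [v4, a2, a3, Function.update_of_ne (by omega), Function.update_of_ne (by omega)]
        exact ⟨by omega, h2⟩
    · refine ⟨?_, ?_⟩ <;> rw [g5 u hu v hv]
      · simp [huv]
      · simp [huv, a4]
    · rintro x hx y hy w' ⟨h1, h2⟩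
      have h3 := (hs.found x hx y hy h1).1
      refine ⟨?_, ?_⟩ <;> rw [old x hx y hy h1]
      · exact h1
      · rwa [a4, Function.update_of_ne (by omega)]
    · omega
  · simp [h0, h30, h31] at hb
    obtain ⟨hj, hc⟩ := hs.found u hu v hv hb
    have hnr := hs.near _ hj
    refine wp_ite ?_ (fun hb' => ?_) fun hb' => ?_
    · simp [h0, h30, h31, h32]
      have := hnr.2
      unfold cell at this
      omega
    · simp [h0, h30, h31, h32] at hb'
      refine wp_write ?_ ?_ ?_
      · simp [h0, h30, h31]
        omega
      · simp [h32, hw]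
      simp only [Expr.cost_add, Expr.cost_mul, Expr.cost_var, Expr.cost_arr, Expr.cost_lit,
        Test.cost, Expr.cost_sub]
      refine ⟨by norm_num, ?_⟩
      set i := s.arr 5 (cell n u v) - 1 with hi
      generalize hs₂ : Store.setArr _ _ _ _ = s₂
      have v4 : s₂.var 4 = s.var 4 := by simp [← hs₂]
      have a2 : s₂.arr 2 = s.arr 2 := by simp [← hs₂]
      have a3 : s₂.arr 3 = s.arr 3 := by simp [← hs₂]
      have a5 : s₂.arr 5 = s.arr 5 := by simp [← hs₂]
      have a4 : s₂.arr 4 = Function.update (s.arr 4) i w := by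
        simp [← hs₂, h0, h30, h31, h32, hi, cell]
      have lt4 : w < s.arr 4 i := by rw [hi]; exact hb'
      refine ⟨⟨?_, ?_, ?_, ?_⟩, ?_, ?_, ?_⟩
      · rw [v4, a2, a3]; exact hs.lt
      · rw [v4, a2, a3, a5]; exact hs.index
      · rw [v4, a2, a3, a4]
        intro j hj
        rw [Function.update_apply]
        split_ifs with e
        · subst e
          refine ⟨?_, hw⟩
          rcases hc with ⟨e2, e3⟩ | ⟨e2, e3⟩
          · rw [e2, e3]; exact hnear
          · rw [e2, e3]; exact hnear.symm hsymm
        · exact hs.near j hj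
      · rw [v4, a2, a3, a5]; exact hs.found
      · refine ⟨by rw [a5]; exact hb, ?_⟩
        rw [a5, ← hi, a4]
        simp
      · rintro x hx y hy w' ⟨h1, h2⟩
        refine ⟨by rwa [a5], ?_⟩
        rw [a5, a4, Function.update_apply]
        split_ifs with e
        · rw [e] at h2
          omega
        · exact h2
      · omega
    · simp [h0, h30, h31, h32] at hb'
      refine wp_skip ⟨by simp, hs.congr (by simp) rfl rfl rfl rfl, ⟨hb, hb'⟩, ?_, by simp⟩
      exact fun x hx y hy w' h => h

theorem PhaseEnv.setVar {x v : ℕ} (h : PhaseEnv n m ph δ cap X ax ay s)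
    (hx : x ≠ 0 ∧ x ≠ 22 ∧ x ≠ 12 ∧ x ≠ 13 ∧ x ≠ 14 := by decide) :
    PhaseEnv n m ph δ cap X ax ay (s.setVar x v) :=
  h.frame (p := .assign x (.lit 0)) ⟨fun y hy => by
    have : y ≠ x := by simpa [Cmd.writesVar] using hy
    simp [this], fun _ _ => rfl⟩ (by simp [Cmd.writesVar]; omega)
    (by simp [Cmd.writesVar]; omega) (by simp [Cmd.writesVar]; omega)
    (by simp [Cmd.writesVar]; omega) (by simp [Cmd.writesVar]; omega)

end

end Ram

namespace Ram

/-! ### The ways to treat a centre: finding an owner, promoting, attaching, connecting -/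

section

variable {n m ph δ cap X W a : ℕ} {ax ay : ℕ → ℕ} {s s' : Store} {p : Cmd}
  {adj : ℕ → ℕ → Prop} {A : Finset ℕ} {u : ℕ}

/-- The scan does not stop early, so the last owned source is reported; which one it is plays no
role. Sources are reported plus one, so zero can mean that the whole list is free. -/
theorem wp_findOwned (env : PhaseEnv n m ph δ cap X ax ay s) (hW : (X + 1) ^ 3 + 3 ≤ W)
    (hinv : StoreInv adj n ph cap δ A s) (hu : u < n) (h25 : s.var 25 = cell n ph u)
    (h27 : s.var 27 = countTab n ph s u) (htk : ∀ x < n, s.arr 12 (cell n ph x) ≤ n) :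
    wp W findOwned s fun t s' => t ≤ cap * 50 + 10 ∧
      ((s'.var 23 = 0 ∧ ∀ x < n, distTab n ph s u x ≠ 0 → s.arr 12 (cell n ph x) = 0) ∨
        ∃ x < n, s'.var 23 = x + 1 ∧ distTab n ph s u x ≠ 0 ∧ s.arr 12 (cell n ph x) ≠ 0) := by
  have hX : X + 1 ≤ (X + 1) ^ 3 := Nat.le_self_pow (by norm_num) _
  have := env.cap_le
  have := env.n_le
  have := env.ph_le
  have hcle := hinv.le u hu
  have hcn := hinv.count_le hu
  refine wp_seq (wp_assign (by simp) (wp_seq (wp_assign (by simp) ?_)))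
  refine (wp_for (s := (s.setVar 23 0).setVar 28 0) 0 (countTab n ph s u) 43 (fun j s' =>
      (s'.var 23 = 0 ∧ ∀ i < j, s.arr 12 (cell n ph (listTab n ph s u i)) = 0) ∨
        ∃ x < n, s'.var 23 = x + 1 ∧ distTab n ph s u x ≠ 0 ∧ s.arr 12 (cell n ph x) ≠ 0)
    (by simp) (by simpa using h27) (Nat.zero_le _) (by omega) rfl rfl rfl
    (Or.inl ⟨by simp, fun i hi => absurd hi (Nat.not_lt_zero _)⟩)
    (fun i s' v h => by simpa using h) ?_).imp ?_
  · rintro j s₁ - hj hx hf hI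
    have env₁ := (env.setVar (x := 23) (v := 0)).setVar (x := 28) (v := 0) |>.frame hf
    have e25 : s₁.var 25 = ph * n + u := by rw [hf.1 _ rfl]; simpa [cell] using h25
    have hjn : j < n := by omega
    obtain ⟨hy, hyd⟩ := hinv.enum u hu j hj
    set y := listTab n ph s u j with hydef
    have eq9 : s₁.arr 9 ((ph * n + u) * n + j) = y := by rw [hf.2 9 rfl]; rfl
    have eq12 : s₁.arr 12 (ph * n + y) = s.arr 12 (cell n ph y) := by rw [hf.2 12 rfl]; rfl
    have c0 := cell2_le env₁ hu
    have c1 := cell3_le env₁ hu hjn.le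
    have c2 := cell2_le env₁ hy
    have := htk y hy
    refine wp_seq (wp_assign ?_ (wp_ite ?_ (fun hb => ?_) fun hb => ?_))
    · simp [env₁.n_eq, e25, hx, eq9]
      omega
    · simp [env₁.n_eq, env₁.ph_eq, e25, hx, eq9, eq12]
      omega
    · simp [env₁.n_eq, env₁.ph_eq, e25, hx, eq9, eq12] at hb
      refine wp_skip ⟨by simp, ?_⟩
      rcases hI with ⟨h0, h⟩ | h
      · refine Or.inl ⟨by simpa using h0, fun i hi => ?_⟩
        rcases Nat.lt_succ_iff_lt_or_eq.1 hi with hi | rfl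
        · exact h i hi
        · exact hb
      · exact Or.inr (by simpa using h)
    · simp [env₁.n_eq, env₁.ph_eq, e25, hx, eq9, eq12] at hb
      refine wp_assign ?_ ⟨by simp, Or.inr ⟨y, hy, ?_, hyd, hb⟩⟩
      · simp [env₁.n_eq, e25, hx, eq9]
        omega
      · simp [env₁.n_eq, e25, hx, eq9]
  · rintro t s₁ ⟨ht, -, hI⟩
    refine ⟨?_, ?_⟩
    · simp only [Expr.cost_lit, Nat.sub_zero] at ht ⊢
      have := Nat.mul_le_mul_right 50 hcle
      omega
    · rcases hI with ⟨h0, h⟩ | h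
      · refine Or.inl ⟨h0, fun x hx hd => ?_⟩
        obtain ⟨i, hi, rfl⟩ := hinv.surj u hu x hx hd
        exact h i hi
      · exact Or.inr h

theorem wp_promote {b : ℕ} (env : PhaseEnv n m ph δ cap X ax ay s) (hW : (X + 1) ^ 3 + 3 ≤ W)
    (hinv : StoreInv adj n ph cap δ A s) (hu : u < n) (h25 : s.var 25 = cell n ph u)
    (h27 : s.var 27 = countTab n ph s u) (h21 : s.var 21 = u) (h17 : s.var 17 = b) (hb : b < n) :
    wp W promote s fun t s' => t ≤ cap * 50 + 30 ∧ s'.var 17 = b + 1 ∧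
      s'.arr 11 = Function.update (s.arr 11) (cell n (ph + 1) b) u ∧
      ∀ i, ∀ x < n, s'.arr 12 (cell n i x) =
        if i = ph ∧ distTab n ph s u x ≠ 0 then u + 1 else s.arr 12 (cell n i x) := by
  have hX : X + 1 ≤ (X + 1) ^ 3 := Nat.le_self_pow (by norm_num) _
  have := env.cap_le
  have := env.n_le
  have := env.ph_le
  have hcle := hinv.le u hu
  have hcn := hinv.count_le hu
  refine wp_seq (wp_assign (by simp) (wp_seq ?_))
  refine (wp_for (s := s.setVar 28 0) 0 (countTab n ph s u) 43 (fun j s' =>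
      s'.var 17 = b ∧ ∀ i, ∀ x < n, s'.arr 12 (cell n i x) =
        if i = ph ∧ ∃ j' < j, listTab n ph s u j' = x then u + 1 else s.arr 12 (cell n i x))
    (by simp) (by simpa using h27) (Nat.zero_le _) (by omega) rfl rfl rfl
    ⟨by simpa using h17, by simp⟩ (fun i s' v h => by simpa using h) ?_).imp_frame ?_
  · rintro j s₁ - hj hx hf ⟨h17', hI⟩
    have env₁ := (env.setVar (x := 28) (v := 0)).frame hf
    have e25 : s₁.var 25 = ph * n + u := by rw [hf.1 _ rfl]; simpa [cell] using h25
    have e21 : s₁.var 21 = u := by rw [hf.1 _ rfl]; simpa [cell] using h21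
    have hjn : j < n := by omega
    obtain ⟨hy, hyd⟩ := hinv.enum u hu j hj
    set y := listTab n ph s u j with hydef
    have eq9 : s₁.arr 9 ((ph * n + u) * n + j) = y := by rw [hf.2 9 rfl]; rfl
    have c0 := cell2_le env₁ hu
    have c1 := cell3_le env₁ hu hjn.le
    have c2 := cell2_le env₁ hy
    refine wp_write ?_ ?_ ⟨by simp, by simpa using h17', fun i x hxn => ?_⟩
    · simp [env₁.n_eq, env₁.ph_eq, e25, hx, eq9]
      omega
    · simp [e21]
      omega
    · have h12 : cell n i x = ph * n + y ↔ i = ph ∧ x = y := cell_inj hxn hy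
      have hex : (∃ j' < j + 1, listTab n ph s u j' = x) ↔
          x = y ∨ ∃ j' < j, listTab n ph s u j' = x := by
        constructor
        · rintro ⟨j', hj', rfl⟩
          rcases Nat.lt_succ_iff_lt_or_eq.1 hj' with hj' | rfl
          · exact Or.inr ⟨j', hj', rfl⟩
          · exact Or.inl rfl
        · rintro (rfl | ⟨j', hj', rfl⟩)
          · exact ⟨j, by omega, rfl⟩
          · exact ⟨j', by omega, rfl⟩
      simp only [hex]
      simp [env₁.n_eq, env₁.ph_eq, e25, e21, hx, eq9, Function.update_apply, h12, hI i x hxn]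
      by_cases h1 : i = ph
      · by_cases h2 : x = y
        · rw [if_pos ⟨h1, h2⟩, if_pos ⟨h1, Or.inl h2⟩]
        · rw [if_neg fun h => h2 h.2]
          simp only [h2, false_or]
      · rw [if_neg fun h => h1 h.1, if_neg fun h => h1 h.1, if_neg fun h => h1 h.1]
  · rintro t s₁ hf ⟨ht, -, h17', hI⟩
    have env₁ := (env.setVar (x := 28) (v := 0)).frame hf
    have e21 : s₁.var 21 = u := by rw [hf.1 _ rfl]; simpa [cell] using h21
    have c1 : (ph + 1) * n + b ≤ (X + 1) ^ 3 := by
      calc (ph + 1) * n + b ≤ (X + 1) * X + X :=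
            Nat.add_le_add (Nat.mul_le_mul (by omega) (by omega)) (by omega)
        _ ≤ (X + 1) ^ 3 := by nlinarith [Nat.zero_le X]
    refine wp_seq (wp_write ?_ ?_ (wp_assign ?_ ⟨?_, ?_, ?_, fun i x hx => ?_⟩))
    · simp [env₁.n_eq, env₁.ph_eq, h17']
      omega
    · simp [e21]
      omega
    · simp [h17']
      omega
    · simp only [Expr.cost_lit, Nat.sub_zero, Expr.cost_add, Expr.cost_mul, Expr.cost_var] at ht ⊢
      have := Nat.mul_le_mul_right 50 hcle
      omega
    · simp [h17']
    · simp [env₁.n_eq, env₁.ph_eq, h17', e21, hf.2 11 rfl, cell]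
    · simp only [Store.arr_setVar, Store.arr_setArr]
      rw [if_neg (by norm_num), hI i x hx]
      refine if_congr (and_congr_right fun _ => ?_) rfl rfl
      constructor
      · rintro ⟨j, hj, rfl⟩
        exact (hinv.enum u hu j hj).2
      · exact hinv.surj u hu x hx

/-- The weight is the length of the walk from `u` to the shared source `x` and on to the owner `q`.
Both halves are recorded distances on lists of radius `δ`, which gives a genuine walk and the bound
`2 * δ`. -/
theorem wp_attach {x q : ℕ} (env : PhaseEnv n m ph δ cap X ax ay s) (hW : (X + 1) ^ 3 + 3 ≤ W)
    (hsymm : ∀ u v, adj u v → adj v u) (hinv : StoreInv adj n ph cap δ A s)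
    (hout : OutInv adj n W s) (hu : u < n) (h25 : s.var 25 = cell n ph u)
    (h21 : s.var 21 = u) (h23 : s.var 23 = x + 1) (hx : x < n)
    (hq : s.arr 12 (cell n ph x) = q + 1) (hqn : q < n) (huq : u ≠ q)
    (hdu : distTab n ph s u x ≠ 0) (hdq : distTab n ph s q x ≠ 0) :
    wp W attach s fun t s' => t ≤ 150 ∧ OutInv adj n W s' ∧ HasEdge n s' u q (2 * δ) ∧
      EdgeMono n s s' ∧ s'.var 4 ≤ s.var 4 + 1 := by
  have hX : X + 1 ≤ (X + 1) ^ 3 := Nat.le_self_pow (by norm_num) _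
  have hX3 : 2 * X ≤ (X + 1) ^ 3 := by
    have : (X + 1) ^ 3 = X ^ 3 + 3 * X ^ 2 + 3 * X + 1 := by ring
    nlinarith [Nat.zero_le (X ^ 3), Nat.zero_le (X ^ 2)]
  have := env.n_le
  have := env.ph_le
  have := env.δ_le
  have b1 := hinv.bound u hu x hx
  have b2 := hinv.bound q hqn x hx
  have c0 := cell2_le env hu
  have c1 := cell2_le env hx
  have c2 := cell2_le env hqn
  have c3 := cell3_le env hu hx.le
  have c4 := cell3_le env hqn hx.le
  have eq12 : s.arr 12 (ph * n + x) = q + 1 := hq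
  have eq8u : s.arr 8 ((ph * n + u) * n + x) = distTab n ph s u x := rfl
  have eq8q : s.arr 8 ((ph * n + q) * n + x) = distTab n ph s q x := rfl
  unfold cell at h25
  refine wp_seq (wp_assign ?_ (wp_seq (wp_assign ?_ (wp_seq (wp_assign ?_ (wp_seq
    (wp_assign ?_ ?_)))))))
  · simp [h23]
    omega
  · simp [h23, env.n_eq, env.ph_eq, eq12]
    omega
  · simp [h21]
    omega
  · simp [h23, h25, env.n_eq, env.ph_eq, eq12, eq8u, eq8q]
    omega
  simp only [Expr.cost_add, Expr.cost_mul, Expr.cost_var, Expr.cost_arr, Expr.cost_lit,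
    Expr.cost_sub]
  have hnear : Near adj (distTab n ph s u x - 1 + (distTab n ph s q x - 1)) u q :=
    ((hinv.sound u hu x hx hdu).2.symm hsymm).trans (hinv.sound q hqn x hx hdq).2
  generalize hs₂ : Store.setVar _ 32 _ = s₂
  have hout₂ : OutInv adj n W s₂ := by
    rw [← hs₂]; exact hout.congr (by simp) rfl rfl rfl rfl
  have hmono₂ : EdgeMono n s s₂ := by rw [← hs₂]; exact fun _ _ _ _ _ h => h
  have e4 : s₂.var 4 = s.var 4 := by simp [← hs₂]
  refine (wp_addEdge (u := u) (v := q) (X := X)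
    (w := distTab n ph s u x - 1 + (distTab n ph s q x - 1)) ?_ env.n_le hW ?_ ?_ ?_ hu hqn huq
    (by omega) hnear hsymm hout₂).imp ?_
  · simp [← hs₂, env.n_eq]
  · simp [← hs₂, h21]
  · simp [← hs₂, h23, env.n_eq, env.ph_eq, eq12]
  · simp [← hs₂, h23, h25, env.n_eq, env.ph_eq, eq12, eq8u, eq8q]
  · rintro t s₁ ⟨ht, h1, h2, h3, h4⟩
    exact ⟨by omega, h1, h2.mono (by omega), hmono₂.trans h3, by omega⟩

/-- The loop starts at position 1 because position 0 holds `u` itself. This saves one edge per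
centre, so that a centre alone on its list costs nothing, and the saving is essential for the edge
count. -/
theorem wp_connect (env : PhaseEnv n m ph δ cap X ax ay s) (hW : (X + 1) ^ 3 + 3 ≤ W)
    (hsymm : ∀ u v, adj u v → adj v u) (hinv : StoreInv adj n ph cap δ A s)
    (hout : OutInv adj n W s) (hu : u < n) (huA : u ∈ A) (h25 : s.var 25 = cell n ph u)
    (h27 : s.var 27 = countTab n ph s u) (h21 : s.var 21 = u) :
    wp W connect s fun t s' => t ≤ cap * 150 + 10 ∧ OutInv adj n W s' ∧ EdgeMono n s s' ∧
      (∀ x < n, x ≠ u → distTab n ph s u x ≠ 0 → HasEdge n s' u x (distTab n ph s u x - 1)) ∧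
      s'.var 4 ≤ s.var 4 + (countTab n ph s u - 1) := by
  have hX : X + 1 ≤ (X + 1) ^ 3 := Nat.le_self_pow (by norm_num) _
  have := env.cap_le
  have := env.δ_le
  have := env.n_le
  have := env.ph_le
  have hcle := hinv.le u hu
  have hcn := hinv.count_le hu
  have hhead := hinv.head u huA
  refine wp_seq (wp_assign (by simp [h21]; omega) (wp_seq (wp_assign (by simp; omega) ?_)))
  refine (wp_for (s := (s.setVar 30 (s.var 21)).setVar 28 1) 1 (countTab n ph s u) 140
      (fun j s' => OutInv adj n W s' ∧ EdgeMono n s s' ∧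
        (∀ i < j, listTab n ph s u i ≠ u →
          HasEdge n s' u (listTab n ph s u i) (distTab n ph s u (listTab n ph s u i) - 1)) ∧
        -- The loop index starts at 1, so `j - 1` insertions have been tried.
        s'.var 4 + 1 ≤ s.var 4 + j)
    (by simp) (by simpa using h27) (by omega) (by omega) rfl rfl rfl
    ⟨hout.congr (by simp) rfl rfl rfl rfl, fun _ _ _ _ _ h => h, fun i hi h => ?_, by simp⟩
    (fun i s' v h => ⟨h.1.congr ?_ rfl rfl rfl rfl, h.2.1, h.2.2.1, ?_⟩) ?_).imp ?_
  · obtain rfl : i = 0 := by omega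
    exact absurd hhead.2 h
  · simp only [Store.var_setVar]; rfl
  · exact h.2.2.2
  · rintro j s₁ - hj hx hf ⟨hout₁, hmono₁, hedge₁, hcnt₁⟩
    have env₁ := (env.setVar (x := 30) (v := s.var 21)).setVar (x := 28) (v := 1) |>.frame hf
    have e25 : s₁.var 25 = ph * n + u := by rw [hf.1 _ rfl]; simpa [cell] using h25
    have e30 : s₁.var 30 = u := by rw [hf.1 _ rfl]; simpa using h21
    have hjn : j < n := by omega
    obtain ⟨hy, hyd⟩ := hinv.enum u hu j hj
    set y := listTab n ph s u j with hydef
    have eq9 : s₁.arr 9 ((ph * n + u) * n + j) = y := by rw [hf.2 9 rfl]; rfl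
    have eq8 : s₁.arr 8 ((ph * n + u) * n + y) = distTab n ph s u y := by rw [hf.2 8 rfl]; rfl
    have c0 := cell2_le env₁ hu
    have c1 := cell3_le env₁ hu hjn.le
    have c2 := cell3_le env₁ hu hy.le
    have b1 := hinv.bound u hu y hy
    refine wp_seq (wp_assign ?_ (wp_seq (wp_assign ?_ (wp_ite ?_ (fun hb => ?_) fun hb => ?_))))
    · simp [env₁.n_eq, e25, hx, eq9]
      omega
    · simp [env₁.n_eq, e25, hx, eq9, eq8]
      omega
    · simp [env₁.n_eq, e25, e30, hx, eq9]
      omega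
    · simp [env₁.n_eq, e25, e30, hx, eq9] at hb
      refine wp_skip ⟨by simp, hout₁.congr (by simp) rfl rfl rfl rfl, hmono₁, fun i hi h => ?_,
        by simp; omega⟩
      rcases Nat.lt_succ_iff_lt_or_eq.1 hi with hi | rfl
      · exact hedge₁ i hi h
      · exact absurd hb h
    · simp [env₁.n_eq, e25, e30, hx, eq9] at hb
      generalize hs₂ : Store.setVar _ 32 _ = s₂
      have hout₂ : OutInv adj n W s₂ := by
        rw [← hs₂]; exact hout₁.congr (by simp) rfl rfl rfl rfl
      have hmono₂ : EdgeMono n s₁ s₂ := by rw [← hs₂]; exact fun _ _ _ _ _ h => h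
      have e4 : s₂.var 4 = s₁.var 4 := by simp [← hs₂]
      refine (wp_addEdge (u := u) (v := y) (X := X) (w := distTab n ph s u y - 1) ?_
        env.n_le hW ?_ ?_ ?_ hu hy (Ne.symm hb) (by omega)
        ((hinv.sound u hu y hy hyd).2.symm hsymm) hsymm hout₂).imp ?_
      · simp [← hs₂, env₁.n_eq]
      · simp [← hs₂, e30]
      · simp [← hs₂, env₁.n_eq, e25, hx, eq9]
      · simp [← hs₂, env₁.n_eq, e25, hx, eq9, eq8]
      · rintro t s₃ ⟨ht, h1, h2, h3, h4⟩
        refine ⟨?_, h1, hmono₁.trans (hmono₂.trans h3), fun i hi h => ?_, ?_⟩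
        · simp only [Expr.cost_add, Expr.cost_mul, Expr.cost_var, Expr.cost_arr, Expr.cost_lit,
            Expr.cost_sub, Test.cost]
          omega
        · rcases Nat.lt_succ_iff_lt_or_eq.1 hi with hi | rfl
          · exact (hmono₂.trans h3) u hu _ (hinv.enum u hu i (by omega)).1 _ (hedge₁ i hi h)
          · exact h2
        · omega
  · rintro t s₁ ⟨ht, -, hout₁, hmono₁, hedge₁, hcnt₁⟩
    refine ⟨?_, hout₁, hmono₁, fun x hx hxu hd => ?_, by omega⟩
    · simp only [Expr.cost_lit, Expr.cost_var] at ht ⊢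
      have : (countTab n ph s u - 1) * (140 + 7) ≤ cap * 147 := Nat.mul_le_mul_right _ (by omega)
      omega
    · obtain ⟨i, hi, rfl⟩ := hinv.surj u hu x hx hd
      exact hedge₁ i hi hxu

end

end Ram

/-! ### Scanning the centres and choosing the new ones -/

namespace Ram

/-- The first `j` centres `cur 0, …, cur (j - 1)` of a phase have been treated, and `S` is the set
of new centres. -/
structure ChooseInv (adj : ℕ → ℕ → Prop) (n W ph δ thr a M₀ : ℕ) (d : ℕ → ℕ → ℕ) (c cur : ℕ → ℕ)
    (j : ℕ) (S : Finset ℕ) (s : Store) : Prop where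
  sub : ∀ q ∈ S, ∃ i < j, cur i = q
  enum : Enumerates S (s.var 17) fun i => s.arr 11 (cell n (ph + 1) i)
  cur_eq : ∀ i < a, s.arr 11 (cell n ph i) = cur i
  owner : ∀ x < n, s.arr 12 (cell n ph x) ≠ 0 →
    ∃ q ∈ S, s.arr 12 (cell n ph x) = q + 1 ∧ d q x ≠ 0
  owned : ∀ q ∈ S, ∀ x < n, d q x ≠ 0 → s.arr 12 (cell n ph x) = q + 1
  fresh : ∀ i, ph + 1 ≤ i → ∀ x < n, s.arr 12 (cell n i x) = 0
  thr_le : ∀ q ∈ S, thr ≤ c q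
  alt : ∀ i < j, cur i ∈ S ∨ (∃ q ∈ S, HasEdge n s (cur i) q (2 * δ)) ∨
    (c (cur i) < thr ∧ ∀ x < n, x ≠ cur i → d (cur i) x ≠ 0 →
      HasEdge n s (cur i) x (d (cur i) x - 1))
  count_zero : thr = 0 → s.var 4 + S.card ≤ M₀ + j
  count : 2 ≤ thr → s.var 4 ≤ M₀ + ∑ i ∈ Finset.range j, (c (cur i) - 1)
  out : OutInv adj n W s

section

variable {n m ph δ cap X W a thr M₀ : ℕ} {ax ay : ℕ → ℕ} {s s' s₀ : Store} {p : Cmd}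
  {adj : ℕ → ℕ → Prop} {A S : Finset ℕ} {u : ℕ} {d : ℕ → ℕ → ℕ} {c cur : ℕ → ℕ} {j : ℕ}

theorem ChooseInv.setVar {x v : ℕ} (h : ChooseInv adj n W ph δ thr a M₀ d c cur j S s)
    (h4 : x ≠ 4) (h17 : x ≠ 17) :
    ChooseInv adj n W ph δ thr a M₀ d c cur j S (s.setVar x v) := by
  have e4 : (s.setVar x v).var 4 = s.var 4 := by simp [h4.symm]
  have e17 : (s.setVar x v).var 17 = s.var 17 := by simp [h17.symm]
  exact ⟨h.sub, by rw [e17]; exact h.enum, h.cur_eq, h.owner, h.owned, h.fresh, h.thr_le, h.alt,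
    by rw [e4]; exact h.count_zero, by rw [e4]; exact h.count,
    h.out.congr e4 rfl rfl rfl rfl⟩

/-- The centre `cur j` is not chosen, and edges are inserted for it. -/
theorem ChooseInv.skip (h : ChooseInv adj n W ph δ thr a M₀ d c cur j S s)
    (hcur : Enumerates A a cur) (hAn : ∀ u ∈ A, u < n) (hj : j < a)
    (e17 : s'.var 17 = s.var 17) (e11 : s'.arr 11 = s.arr 11) (e12 : s'.arr 12 = s.arr 12)
    (hout : OutInv adj n W s') (hmono : EdgeMono n s s')
    (halt : (∃ q ∈ S, HasEdge n s' (cur j) q (2 * δ)) ∨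
      (c (cur j) < thr ∧ ∀ x < n, x ≠ cur j → d (cur j) x ≠ 0 →
        HasEdge n s' (cur j) x (d (cur j) x - 1)))
    (h0 : thr = 0 → s'.var 4 ≤ s.var 4 + 1)
    (h2 : 2 ≤ thr → s'.var 4 ≤ s.var 4 + (c (cur j) - 1)) :
    ChooseInv adj n W ph δ thr a M₀ d c cur (j + 1) S s' where
  sub q hq := by
    obtain ⟨i, hi, h⟩ := h.sub q hq
    exact ⟨i, by omega, h⟩
  enum := by rw [e17, e11]; exact h.enum
  cur_eq := by rw [e11]; exact h.cur_eq
  owner := by rw [e12]; exact h.owner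
  owned := by rw [e12]; exact h.owned
  fresh := by rw [e12]; exact h.fresh
  thr_le := h.thr_le
  alt i hi := by
    rcases Nat.lt_succ_iff_lt_or_eq.1 hi with hi | rfl
    · have hin := hAn _ (hcur.mem (hi.trans hj))
      rcases h.alt i hi with h1 | ⟨q, hq, h1⟩ | ⟨h1, h2⟩
      · exact Or.inl h1
      · obtain ⟨k, hk, rfl⟩ := h.sub q hq
        exact Or.inr (Or.inl ⟨_, hq, hmono _ hin _ (hAn _ (hcur.mem (hk.trans hj))) _ h1⟩)
      · exact Or.inr (Or.inr ⟨h1, fun x hx hxu hd => hmono _ hin _ hx _ (h2 x hx hxu hd)⟩)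
    · exact Or.inr halt
  count_zero ht := by
    have h1 := h.count_zero ht
    have h2 := h0 ht
    omega
  count ht := by
    have h1 := h.count ht
    have h2 := h2 ht
    rw [Finset.sum_range_succ]
    omega
  out := hout

/-- The three outcomes correspond to `alt` in `ChooseInv`. Disjointness of the lists of new centres
is kept because a centre is promoted only if nothing on its list is owned. For threshold 0, one
treated centre pays for either one edge or one new centre, which is the invariant `count_zero`. -/
theorem wp_treat (env : PhaseEnv n m ph δ cap X ax ay s) (hW : (X + 1) ^ 3 + 3 ≤ W)
    (hsymm : ∀ u v, adj u v → adj v u) (hinv : StoreInv adj n ph cap δ A s)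
    (hthr : thr ≤ cap) (h15 : s.var 15 = thr) (h20 : s.var 20 = j) (hj : j < a)
    (hcur : Enumerates A a cur) (hAn : ∀ u ∈ A, u < n)
    (hI : ChooseInv adj n W ph δ thr a M₀ (distTab n ph s) (countTab n ph s) cur j S s) :
    wp W treat s fun t s' => t ≤ cap * 150 + 260 ∧ EdgeMono n s s' ∧ ∃ S',
      ChooseInv adj n W ph δ thr a M₀ (distTab n ph s) (countTab n ph s) cur (j + 1) S' s' := by
  have hX : X + 1 ≤ (X + 1) ^ 3 := Nat.le_self_pow (by norm_num) _
  have := env.cap_le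
  have := env.n_le
  have := env.ph_le
  have han : a ≤ n := by
    rw [← hcur.card_eq]
    calc A.card ≤ (Finset.range n).card :=
          Finset.card_le_card fun u hu => Finset.mem_range.2 (hAn u hu)
      _ = n := by simp
  have huA : cur j ∈ A := hcur.mem hj
  have hun : cur j < n := hAn _ huA
  have eq11 : s.arr 11 (ph * n + j) = cur j := hI.cur_eq j hj
  have eq10 : s.arr 10 (ph * n + cur j) = countTab n ph s (cur j) := rfl
  have c1 := cell2_le env hun
  have c2 := cell2_le env (hj.trans_le han)
  have b1 := hinv.le _ hun
  have hSn : ∀ q ∈ S, q < n := fun q hq => by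
    obtain ⟨i, hi, rfl⟩ := hI.sub q hq
    exact hAn _ (hcur.mem (hi.trans hj))
  have hjS : cur j ∉ S := fun h => by
    obtain ⟨i, hi, h⟩ := hI.sub _ h
    have := hcur.inj (hi.trans hj) hj h
    omega
  refine wp_seq (wp_assign ?_ (wp_seq (wp_assign ?_ (wp_seq (wp_assign ?_ ?_)))))
  · simp [env.n_eq, env.ph_eq, h20, eq11]
    omega
  · simp [env.n_eq, env.ph_eq, h20, eq11]
    omega
  · simp [env.n_eq, env.ph_eq, h20, eq11, eq10]
    omega
  have env₁ := ((env.setVar (x := 21)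
    (v := ((Expr.arr 11 (Expr.var 12 * Expr.var 0 + Expr.var 20)).eval s))).setVar (x := 25)
    (v := ph * n + cur j)).setVar (x := 27) (v := countTab n ph s (cur j))
  generalize hs₁ : Store.setVar _ 27 _ = s₁
  have hs₁' : s₁ = ((s.setVar 21 (cur j)).setVar 25 (ph * n + cur j)).setVar 27
      (countTab n ph s (cur j)) := by
    rw [← hs₁]
    simp [env.n_eq, env.ph_eq, h20, eq11, eq10]
  replace env₁ : PhaseEnv n m ph δ cap X ax ay s₁ := by
    rw [hs₁']
    exact ((env.setVar (x := 21)).setVar (x := 25)).setVar (x := 27)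
  have hinv₁ : StoreInv adj n ph cap δ A s₁ := by rw [hs₁']; exact hinv
  have hI₁ : ChooseInv adj n W ph δ thr a M₀ (distTab n ph s) (countTab n ph s) cur j S s₁ := by
    rw [hs₁']
    exact ((hI.setVar (by decide) (by decide)).setVar (by decide) (by decide)).setVar
      (by decide) (by decide)
  have ed : distTab n ph s₁ = distTab n ph s := by rw [hs₁']; rfl
  have ec : countTab n ph s₁ = countTab n ph s := by rw [hs₁']; rfl
  have e21 : s₁.var 21 = cur j := by simp [hs₁']
  have e25 : s₁.var 25 = cell n ph (cur j) := by simp [hs₁', cell]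
  have e27 : s₁.var 27 = countTab n ph s₁ (cur j) := by simp [hs₁', countTab]
  have e15 : s₁.var 15 = thr := by simp [hs₁', h15]
  have hmono₁ : EdgeMono n s s₁ := by rw [hs₁']; exact fun _ _ _ _ _ h => h
  clear hs₁ hs₁'
  simp only [Expr.cost_add, Expr.cost_mul, Expr.cost_var, Expr.cost_arr]
  rw [← ed, ← ec] at hI₁ ⊢
  rw [← ec] at b1
  refine wp_ite ?_ (fun hb => ?_) fun hb => ?_
  · simp [e27, e15]
    omega
  · simp [e27, e15] at hb
    refine (wp_connect env₁ hW hsymm hinv₁ hI₁.out hun huA e25 e27 e21).imp_frame ?_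
    rintro t s₂ hf ⟨ht, hout, hmono, hedge, hcnt⟩
    refine ⟨?_, hmono₁.trans hmono, S, hI₁.skip hcur hAn hj (hf.1 _ rfl) (hf.2 _ rfl) (hf.2 _ rfl) hout hmono
      (Or.inr ⟨hb, hedge⟩) (fun h => ?_) fun _ => hcnt⟩
    · simp only [Test.cost, Expr.cost_var]
      omega
    -- With threshold zero no centre is unpopular, so this branch cannot occur.
    · omega
  · simp [e27, e15] at hb
    have htk : ∀ x < n, s₁.arr 12 (cell n ph x) ≤ n := by
      intro x hx
      by_cases h : s₁.arr 12 (cell n ph x) = 0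
      · omega
      · obtain ⟨q, hq, h1, -⟩ := hI₁.owner x hx h
        have := hSn q hq
        omega
    refine wp_seq ((wp_findOwned env₁ hW hinv₁ hun e25 e27 htk).imp_frame ?_)
    rintro t s₂ hf ⟨ht, hfind⟩
    have env₂ := env₁.frame hf
    have ed₂ : distTab n ph s₂ = distTab n ph s₁ := by unfold distTab; rw [hf.2 8 rfl]
    have ec₂ : countTab n ph s₂ = countTab n ph s₁ := by unfold countTab; rw [hf.2 10 rfl]
    have el₂ : listTab n ph s₂ = listTab n ph s₁ := by unfold listTab; rw [hf.2 9 rfl]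
    have hinv₂ : StoreInv adj n ph cap δ A s₂ := by
      unfold StoreInv
      rw [ed₂, ec₂, el₂]
      exact hinv₁
    have f21 : s₂.var 21 = cur j := (hf.1 _ rfl).trans e21
    have f25 : s₂.var 25 = cell n ph (cur j) := (hf.1 _ rfl).trans e25
    have f27 : s₂.var 27 = countTab n ph s₂ (cur j) := by rw [ec₂]; exact (hf.1 _ rfl).trans e27
    have f17 : s₂.var 17 = s₁.var 17 := hf.1 _ rfl
    have f4 : s₂.var 4 = s₁.var 4 := hf.1 _ rfl
    have f11 : s₂.arr 11 = s₁.arr 11 := hf.2 _ rfl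
    have f12 : s₂.arr 12 = s₁.arr 12 := hf.2 _ rfl
    have hout₂ : OutInv adj n W s₂ :=
      hI₁.out.congr f4 (hf.2 _ rfl) (hf.2 _ rfl) (hf.2 _ rfl) (hf.2 _ rfl)
    have hmono₂ : EdgeMono n s₁ s₂ := fun u _ v _ w h =>
      HasEdge.congr h (hf.2 _ rfl) (hf.2 _ rfl)
    refine wp_ite ?_ (fun hb₂ => ?_) fun hb₂ => ?_
    · simp
      rcases hfind with ⟨h, -⟩ | ⟨x, hx, h, -⟩ <;> omega
    · simp at hb₂
      have hnone : ∀ x < n, distTab n ph s₁ (cur j) x ≠ 0 → s₁.arr 12 (cell n ph x) = 0 := by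
        rcases hfind with ⟨-, h⟩ | ⟨x, hx, h, -⟩
        · exact h
        · omega
      have hcardS : S.card ≤ j := by
        have : S ⊆ (Finset.range j).image cur := fun q hq => by
          obtain ⟨i, hi, h⟩ := hI.sub q hq
          exact Finset.mem_image.2 ⟨i, by simpa using hi, h⟩
        calc S.card ≤ _ := Finset.card_le_card this
          _ ≤ (Finset.range j).card := Finset.card_image_le
          _ = j := by simp
      -- Fewer new centres than treated centres: the next free cell lies inside its row of the
      -- table.
      have hbn : s₁.var 17 < n := by
        rw [← hI₁.enum.card_eq]
        omega
      refine (wp_promote env₂ hW hinv₂ hun f25 f27 f21 f17 hbn).imp_frame ?_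
      rintro t' s₃ hf₃ ⟨ht', g17, g11, g12⟩
      rw [ed₂] at g12
      rw [f11] at g11
      simp only [f12] at g12
      have g4 : s₃.var 4 = s₁.var 4 := (hf₃.1 _ rfl).trans f4
      have hmono₃ : EdgeMono n s₁ s₃ := fun u _ v _ w h =>
        HasEdge.congr h ((hf₃.2 _ rfl).trans (hf.2 _ rfl)) ((hf₃.2 _ rfl).trans (hf.2 _ rfl))
      refine ⟨?_, hmono₁.trans hmono₃, insert (cur j) S, ⟨?_, ?_, ?_, ?_, ?_, ?_, ?_, ?_, ?_, ?_, ?_⟩⟩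
      · simp only [Test.cost, Expr.cost_var, Expr.cost_lit]
        omega
      · intro q hq
        rcases Finset.mem_insert.1 hq with rfl | hq
        · exact ⟨j, by omega, rfl⟩
        · obtain ⟨i, hi, h⟩ := hI.sub q hq
          exact ⟨i, by omega, h⟩
      · rw [g17, g11]
        refine hI₁.enum.insert hjS (fun i hi => ?_) (by simp)
        rw [Function.update_of_ne]
        rw [Ne, cell_inj (by omega) hbn]
        omega
      · intro i hi
        rw [g11, Function.update_of_ne]
        · exact hI₁.cur_eq i hi
        · rw [Ne, cell_inj (by omega) hbn]
          omega
      · intro x hx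
        rw [g12 ph x hx]
        split_ifs with e
        · exact fun _ => ⟨cur j, Finset.mem_insert_self _ _, rfl, e.2⟩
        · intro h
          obtain ⟨q, hq, h⟩ := hI₁.owner x hx h
          exact ⟨q, Finset.mem_insert_of_mem hq, h⟩
      · intro q hq x hx hd
        rw [g12 ph x hx]
        rcases Finset.mem_insert.1 hq with rfl | hq
        · rw [if_pos ⟨rfl, hd⟩]
        · have h1 := hI₁.owned q hq x hx hd
          -- A source of an older new centre is owned, so it cannot be on the list of a centre whose
          -- whole list is free.
          rw [if_neg, h1]
          rintro ⟨-, h⟩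
          have := hnone x hx h
          omega
      · intro i hi x hx
        rw [g12 i x hx, if_neg (by omega)]
        exact hI₁.fresh i hi x hx
      · intro q hq
        rcases Finset.mem_insert.1 hq with rfl | hq
        · exact hb
        · exact hI₁.thr_le q hq
      · intro i hi
        rcases Nat.lt_succ_iff_lt_or_eq.1 hi with hi | rfl
        · have hin := hAn _ (hcur.mem (hi.trans hj))
          rcases hI₁.alt i hi with h1 | ⟨q, hq, h1⟩ | ⟨h1, h2⟩
          · exact Or.inl (Finset.mem_insert_of_mem h1)
          · exact Or.inr (Or.inl ⟨q, Finset.mem_insert_of_mem hq,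
              hmono₃ _ hin _ (hSn q hq) _ h1⟩)
          · exact Or.inr (Or.inr ⟨h1, fun x hx hxu hd => hmono₃ _ hin _ hx _ (h2 x hx hxu hd)⟩)
        · exact Or.inl (Finset.mem_insert_self _ _)
      · intro h
        have := hI₁.count_zero h
        rw [g4, Finset.card_insert_of_notMem hjS]
        omega
      · intro h
        have := hI₁.count h
        rw [g4, Finset.sum_range_succ]
        omega
      · exact hout₂.congr (hf₃.1 _ rfl) (hf₃.2 _ rfl) (hf₃.2 _ rfl) (hf₃.2 _ rfl) (hf₃.2 _ rfl)
    · simp at hb₂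
      obtain ⟨x, hx, h23, hd, hx12⟩ : ∃ x < n, s₂.var 23 = x + 1 ∧
          distTab n ph s₁ (cur j) x ≠ 0 ∧ s₁.arr 12 (cell n ph x) ≠ 0 := by
        rcases hfind with ⟨h, -⟩ | h
        · exact absurd h hb₂
        · exact h
      obtain ⟨q, hq, hq12, hqd⟩ := hI₁.owner x hx hx12
      refine (wp_attach env₂ hW hsymm hinv₂ hout₂ hun f25 f21 h23 hx (f12 ▸ hq12) (hSn q hq)
        (fun h => hjS (h ▸ hq)) (by rwa [ed₂]) (by rwa [ed₂])).imp_frame ?_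
      rintro t' s₃ hf₃ ⟨ht', hout, hedge, hmono, hcnt⟩
      refine ⟨?_, hmono₁.trans (hmono₂.trans hmono), S, hI₁.skip hcur hAn hj ((hf₃.1 _ rfl).trans f17) ((hf₃.2 _ rfl).trans f11)
        ((hf₃.2 _ rfl).trans f12) hout (hmono₂.trans hmono) (Or.inl ⟨q, hq, hedge⟩)
        (fun h => ?_) fun h => ?_⟩
      · simp only [Test.cost, Expr.cost_var, Expr.cost_lit]
        omega
      · omega
      -- The one new edge is paid for by the list of the centre, which has at least `thr ≥ 2`
      -- entries.
      · omega

theorem wp_choose (env : PhaseEnv n m ph δ cap X ax ay s) (hW : (X + 1) ^ 3 + 3 ≤ W)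
    (hsymm : ∀ u v, adj u v → adj v u) (hinv : StoreInv adj n ph cap δ A s)
    (hthr : thr ≤ cap) (h15 : s.var 15 = thr) (h11 : s.var 11 = a)
    (hA : Enumerates A a fun j => s.arr 11 (cell n ph j)) (hAn : ∀ u ∈ A, u < n)
    (hfr : ∀ i, ph ≤ i → ∀ x < n, s.arr 12 (cell n i x) = 0) (hout : OutInv adj n W s) :
    wp W choose s fun t s' => t ≤ a * (cap * 150 + 270) + 10 ∧ EdgeMono n s s' ∧ ∃ S,
      ChooseInv adj n W ph δ thr a (s.var 4) (distTab n ph s) (countTab n ph s)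
        (fun j => s.arr 11 (cell n ph j)) a S s' := by
  have hX : X + 1 ≤ (X + 1) ^ 3 := Nat.le_self_pow (by norm_num) _
  have := env.n_le
  have han : a ≤ n := by
    rw [← hA.card_eq]
    calc A.card ≤ (Finset.range n).card :=
          Finset.card_le_card fun u hu => Finset.mem_range.2 (hAn u hu)
      _ = n := by simp
  refine wp_seq (wp_assign (by simp) (wp_seq (wp_assign (by simp) ?_)))
  have env₁ : PhaseEnv n m ph δ cap X ax ay ((s.setVar 17 0).setVar 20 0) :=
    (env.setVar (x := 17)).setVar (x := 20)
  refine (wp_for (s := (s.setVar 17 0).setVar 20 0) 0 a (cap * 150 + 260)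
      (fun j s' => EdgeMono n s s' ∧ ∃ S,
        ChooseInv adj n W ph δ thr a (s.var 4) (distTab n ph s) (countTab n ph s)
          (fun j => s.arr 11 (cell n ph j)) j S s')
    (by simp) (by simpa using h11) (Nat.zero_le _) (by omega) rfl rfl rfl ?_ ?_ ?_).imp ?_
  · refine ⟨fun _ _ _ _ _ h => h, ∅, ⟨by simp, by simpa using Enumerates.empty _,
      fun _ _ => rfl, fun x hx h => ?_, by simp, fun i hi => hfr i (by omega), by simp,
      fun i hi => absurd hi (Nat.not_lt_zero _), by simp, by simp,
      hout.congr (by simp) rfl rfl rfl rfl⟩⟩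
    exact absurd (hfr ph le_rfl x hx) h
  · rintro j s' v ⟨h1, S, h2⟩
    exact ⟨h1, S, h2.setVar (by decide) (by decide)⟩
  · rintro j s₁ - hj hx hf ⟨hmono, S, hI⟩
    have ed : distTab n ph s₁ = distTab n ph s := by unfold distTab; rw [hf.2 8 rfl]; rfl
    have ec : countTab n ph s₁ = countTab n ph s := by unfold countTab; rw [hf.2 10 rfl]; rfl
    have el : listTab n ph s₁ = listTab n ph s := by unfold listTab; rw [hf.2 9 rfl]; rfl
    have hinv₁ : StoreInv adj n ph cap δ A s₁ := by
      unfold StoreInv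
      rw [ed, ec, el]
      exact hinv
    have e15 : s₁.var 15 = thr := (hf.1 _ rfl).trans (by simpa using h15)
    rw [← ed, ← ec] at hI ⊢
    refine (wp_treat (env₁.frame hf) hW hsymm hinv₁ hthr e15 hx hj hA hAn hI).imp ?_
    rintro t s₂ ⟨ht, hm, S', hI'⟩
    exact ⟨ht, hmono.trans hm, S', hI'⟩
  · rintro t s₁ ⟨ht, -, hmono, hI⟩
    refine ⟨?_, hmono, hI⟩
    simp only [Expr.cost_lit, Nat.sub_zero] at ht ⊢
    have : a * (cap * 150 + 260 + 7) ≤ a * (cap * 150 + 270) := Nat.mul_le_mul_left _ (by omega)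
    omega

end

end Ram

/-! ### A complete phase and what it guarantees -/

/-- What a phase achieves: from the centres `A` it makes new centres `A'`, and the number of edges
grows from `M` to `M'`. `E u v w` says that there is an edge of weight at most `w` between `u` and
`v`, and `L u` is the list of sources of `u`. -/
structure PhaseSpec (adj : ℕ → ℕ → Prop) (A A' : Finset ℕ) (δ cap thr M M' : ℕ)
    (E : ℕ → ℕ → ℕ → Prop) (L : ℕ → Finset ℕ) : Prop where
  self : ∀ u ∈ A, u ∈ L u
  sub : ∀ u ∈ A, L u ⊆ A
  near : ∀ u ∈ A, ∀ x ∈ L u, Near adj δ x u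
  card_le : ∀ u ∈ A, (L u).card ≤ cap
  complete : ∀ u ∈ A, (L u).card < cap → ∀ x ∈ A, Near adj δ x u → x ∈ L u
  disj : ∀ p ∈ A', ∀ q ∈ A', ∀ x, x ∈ L p → x ∈ L q → p = q
  subset : A' ⊆ A
  thr_le : ∀ q ∈ A', thr ≤ (L q).card
  alt : ∀ u ∈ A, u ∈ A' ∨ (∃ q ∈ A', E u q (2 * δ)) ∨
    ((L u).card < thr ∧ ∀ x ∈ A, x ≠ u → ∀ e ≤ δ, Near adj e x u → E u x e)
  count_zero : thr = 0 → M' + A'.card ≤ M + A.card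
  count : 2 ≤ thr → M' ≤ M + ∑ u ∈ A, ((L u).card - 1)

/-- Edges enter the specification only positively, so it survives all later insertions. This lets
every phase be read in terms of the final output. -/
theorem PhaseSpec.mono {adj : ℕ → ℕ → Prop} {A A' : Finset ℕ} {δ cap thr M M' : ℕ}
    {E E' : ℕ → ℕ → ℕ → Prop} {L : ℕ → Finset ℕ} (h : PhaseSpec adj A A' δ cap thr M M' E L)
    (hE : ∀ u ∈ A, ∀ v ∈ A, ∀ w, E u v w → E' u v w) :
    PhaseSpec adj A A' δ cap thr M M' E' L :=
  { h with
    alt := fun u hu => by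
      rcases h.alt u hu with h1 | ⟨q, hq, h1⟩ | ⟨h1, h2⟩
      · exact Or.inl h1
      · exact Or.inr (Or.inl ⟨q, hq, hE u hu q (h.subset hq) _ h1⟩)
      · exact Or.inr (Or.inr ⟨h1, fun x hx hxu e he hn => hE u hu x hx _ (h2 x hx hxu e he hn)⟩) }

namespace Ram

section Programs

open Ram.Expr Ram.Test Ram.Cmd

/-- Replace the variable `x` by the minimum of `x` and `y`. -/
def clamp (x y : ℕ) : Cmd := ite (lt (var y) (var x)) (assign x (var y)) skip

/-- The parameters of the next phase. -/
def advance : Cmd :=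
  assign 11 (var 17) ;; assign 13 (var 13 * var 10) ;; clamp 13 0 ;;
  assign 14 (var 16 + lit 1) ;; assign 15 (var 16 + lit 1) ;;
  assign 16 (var 16 * var 16) ;; clamp 16 8

/-- A phase. -/
def phase : Cmd := detect ;; choose ;; advance

end Programs

section

variable {n m ph δ cap X W a thr M₀ : ℕ} {ax ay : ℕ → ℕ} {s s' s₀ : Store} {p : Cmd}
  {adj : ℕ → ℕ → Prop} {A S : Finset ℕ} {u : ℕ} {d : ℕ → ℕ → ℕ} {c cur : ℕ → ℕ} {j : ℕ}

theorem wp_clamp {x y : ℕ} (hx : s.var x ≤ W) (hy : s.var y ≤ W) :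
    wp W (clamp x y) s fun t s' => t ≤ 5 ∧ s'.var x = min (s.var x) (s.var y) := by
  refine wp_ite (by simp [hx, hy]) (fun hb => ?_) fun hb => ?_
  · simp at hb
    exact wp_assign (by simpa using hy) ⟨by simp, by simp; omega⟩
  · simp at hb
    exact wp_skip ⟨by simp, by simp [hb]⟩

theorem wp_advance {q Q θ : ℕ} (hW : q + 1 ≤ W ∧ q * q ≤ W ∧ δ * θ ≤ W ∧ n ≤ W ∧ Q ≤ W)
    (hδ : δ ≤ W) (hθ : θ ≤ W)
    (h0 : s.var 0 = n) (h13 : s.var 13 = δ) (h10 : s.var 10 = θ) (h16 : s.var 16 = q)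
    (h8 : s.var 8 = Q) (h17 : s.var 17 ≤ W) :
    wp W advance s fun t s' => t ≤ 60 ∧ s'.var 11 = s.var 17 ∧ s'.var 13 = min (δ * θ) n ∧
      s'.var 14 = q + 1 ∧ s'.var 15 = q + 1 ∧ s'.var 16 = min (q * q) Q := by
  obtain ⟨w1, w2, w3, w4, w5⟩ := hW
  refine wp_seq (wp_assign (by simpa using h17) (wp_seq (wp_assign ?_ (wp_seq
    ((wp_clamp ?_ ?_).imp_frame ?_)))))
  · simpa [h13, h10] using ⟨hδ, hθ, w3⟩
  · simpa [h13, h10] using w3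
  · simpa [h0] using w4
  rintro t₁ s₁ hf₁ ⟨ht₁, g13⟩
  have e16 : s₁.var 16 = q := by rw [hf₁.1 16 rfl]; simpa using h16
  have e8 : s₁.var 8 = Q := by rw [hf₁.1 8 rfl]; simpa using h8
  have e11 : s₁.var 11 = s.var 17 := by rw [hf₁.1 11 rfl]; simp
  simp [h13, h10, h0] at g13
  refine wp_seq (wp_assign (by simp [e16]; omega) (wp_seq (wp_assign (by simp [e16]; omega)
    (wp_seq (wp_assign (by simp [e16]; omega) ((wp_clamp ?_ ?_).imp_frame ?_))))))
  · simpa [e16] using w2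
  · simpa [e8] using w5
  rintro t₂ s₂ hf₂ ⟨ht₂, g16⟩
  simp [e16, e8] at g16
  refine ⟨?_, ?_, ?_, ?_, ?_, g16⟩
  · simp
    omega
  · rw [hf₂.1 11 rfl]; simpa using e11
  · rw [hf₂.1 13 rfl]; simpa using g13
  · rw [hf₂.1 14 rfl]; simp [e16]
  · rw [hf₂.1 15 rfl]; simp [e16]

/-- Here the memory is left behind: the list of `u` becomes the finite set of `x` with nonzero
recorded distance. The hypothesis `a ≤ m` charges the work done per centre to the arcs, which keeps
`n` out of the time bound. -/
theorem wp_phase {q Q θ : ℕ} (env : PhaseEnv n m ph δ cap X ax ay s) (hW : (X + 1) ^ 3 + 3 ≤ W)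
    (harc : IsArcs adj n m ax ay) (hcap : 1 ≤ cap)
    (hthr : thr ≤ cap) (h15 : s.var 15 = thr) (h11 : s.var 11 = a) (ham : a ≤ m)
    (hA : Enumerates A a fun j => s.arr 11 (cell n ph j)) (hAn : ∀ u ∈ A, u < n)
    (hfr : Fresh n ph s)
    (hfr' : ∀ i, ph ≤ i → ∀ x < n, s.arr 12 (cell n i x) = 0) (hout : OutInv adj n W s)
    (hW' : q + 1 ≤ W ∧ q * q ≤ W ∧ δ * θ ≤ W ∧ n ≤ W ∧ Q ≤ W)
    (hδ : δ ≤ W) (hθ : θ ≤ W) (h10 : s.var 10 = θ) (h16 : s.var 16 = q) (h8 : s.var 8 = Q) :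
    wp W phase s fun t s' => t ≤ (δ + 1) * ((m + 1) * ((cap + 1) * 500)) ∧ EdgeMono n s s' ∧
      (∃ S L, PhaseSpec adj A S δ cap thr (s.var 4) (s'.var 4) (HasEdge n s') L ∧
        Enumerates S (s'.var 11) fun j => s'.arr 11 (cell n (ph + 1) j)) ∧
      Fresh n (ph + 1) s' ∧ (∀ i, ph + 1 ≤ i → ∀ x < n, s'.arr 12 (cell n i x) = 0) ∧
      OutInv adj n W s' ∧ s'.var 13 = min (δ * θ) n ∧ s'.var 14 = q + 1 ∧ s'.var 15 = q + 1 ∧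
      s'.var 16 = min (q * q) Q := by
  have hX : X + 1 ≤ (X + 1) ^ 3 := Nat.le_self_pow (by norm_num) _
  refine wp_seq ((wp_detect (adj := adj) env hW harc hcap hAn h11 hA hfr).imp_frame ?_)
  rintro t₁ s₁ hf₁ ⟨ht₁, hinv, hcomp, hfr₁⟩
  have e11 : s₁.arr 11 = s.arr 11 := hf₁.2 _ rfl
  have e12 : s₁.arr 12 = s.arr 12 := hf₁.2 _ rfl
  have e4 : s₁.var 4 = s.var 4 := hf₁.1 _ rfl
  have hmono₁ : EdgeMono n s s₁ := fun u _ v _ w h => h.congr (hf₁.2 _ rfl) (hf₁.2 _ rfl)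
  refine wp_seq ((wp_choose (thr := thr) (A := A) (a := a) (env.frame hf₁) hW harc.symm hinv hthr
    ((hf₁.1 _ rfl).trans h15) ((hf₁.1 _ rfl).trans h11) (by rw [e11]; exact hA) hAn
    (by rw [e12]; exact hfr')
    (hout.congr e4 (hf₁.2 _ rfl) (hf₁.2 _ rfl) (hf₁.2 _ rfl) (hf₁.2 _ rfl))).imp_frame ?_)
  rintro t₂ s₂ hf₂ ⟨ht₂, hmono₂, S, hI⟩
  have hSA : S ⊆ A := fun q hq => by
    obtain ⟨i, hi, rfl⟩ := hI.sub q hq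
    rw [e11]
    exact hA.mem hi
  have han : S.card ≤ n := by
    calc S.card ≤ (Finset.range n).card :=
          Finset.card_le_card fun u hu => Finset.mem_range.2 (hAn u (hSA hu))
      _ = n := by simp
  have h17 : s₂.var 17 ≤ W := by
    rw [← hI.enum.card_eq]
    omega
  refine (wp_advance hW' hδ hθ (((env.frame hf₁).frame hf₂).n_eq) (((env.frame hf₁).frame hf₂).δ_eq)
    (((hf₂.1 _ rfl).trans (hf₁.1 _ rfl)).trans h10) (((hf₂.1 _ rfl).trans (hf₁.1 _ rfl)).trans h16)
    (((hf₂.1 _ rfl).trans (hf₁.1 _ rfl)).trans h8) h17).imp_frame ?_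
  rintro t₃ s₃ hf₃ ⟨ht₃, g11, g13, g14, g15, g16⟩
  have k11 : s₃.arr 11 = s₂.arr 11 := hf₃.2 _ rfl
  have k12 : s₃.arr 12 = s₂.arr 12 := hf₃.2 _ rfl
  have k4 : s₃.var 4 = s₂.var 4 := hf₃.1 _ rfl
  have hmono₃ : EdgeMono n s₂ s₃ := fun u _ v _ w h => h.congr (hf₃.2 _ rfl) (hf₃.2 _ rfl)
  have hfr₃ : Fresh n (ph + 1) s₃ := by
    unfold Fresh
    rw [hf₃.2 8 rfl, hf₃.2 10 rfl, hf₂.2 8 rfl, hf₂.2 10 rfl]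
    exact hfr₁
  refine ⟨?_, hmono₁.trans (hmono₂.trans hmono₃), ⟨S, fun u =>
      (Finset.range n).filter fun x => distTab n ph s₁ u x ≠ 0, ?_, ?_⟩, hfr₃,
    by rw [k12]; exact hI.fresh,
    hI.out.congr k4 (hf₃.2 _ rfl) (hf₃.2 _ rfl) (hf₃.2 _ rfl) (hf₃.2 _ rfl), g13, g14, g15, g16⟩
  · have h1 : a * 50 ≤ (m + 1) * 50 := Nat.mul_le_mul_right _ (by omega)
    have h2 : a * (cap * 150 + 270) ≤ (m + 1) * (cap * 150 + 270) :=
      Nat.mul_le_mul_right _ (by omega)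
    have h3 : δ * ((m + 1) * (cap * 70 + 57)) ≤ δ * ((m + 1) * ((cap + 1) * 500)) :=
      Nat.mul_le_mul_left _ (Nat.mul_le_mul_left _ (by omega))
    have h4 : (m + 1) * 50 + (m + 1) * (cap * 150 + 270) + (m + 1) * 100 ≤
        (m + 1) * ((cap + 1) * 500) := by
      rw [← Nat.mul_add, ← Nat.mul_add]
      exact Nat.mul_le_mul_left _ (by omega)
    have h5 : (δ + 1) * ((m + 1) * ((cap + 1) * 500)) =
        δ * ((m + 1) * ((cap + 1) * 500)) + (m + 1) * ((cap + 1) * 500) := by ring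
    omega
  · have hcur : ∀ u ∈ A, ∃ i < a, s₁.arr 11 (cell n ph i) = u := by
      rw [e11]; exact fun u hu => hA.exists_eq hu
    have hne : ∀ u, ∀ x < n, distTab n ph s₁ u x ≠ 0 → x ∈
        (Finset.range n).filter fun x => distTab n ph s₁ u x ≠ 0 := fun u x hx h => by
      simp [hx, h]
    have hE : ∀ u v w, HasEdge n s₂ u v w → HasEdge n s₃ u v w := fun u v w h =>
      h.congr (hf₃.2 _ rfl) (hf₃.2 _ rfl)
    refine ⟨fun u hu => ?_, fun u hu x hx => ?_, fun u hu x hx => ?_, fun u hu => ?_,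
      fun u hu hlt x hx hn => ?_, fun q hq q' hq' x hx hx' => ?_, hSA, fun q hq => ?_,
      fun u hu => ?_, fun h => ?_, fun h => ?_⟩
    · have hun := hAn u hu
      obtain ⟨h1, h2⟩ := hinv.head u hu
      have := hinv.enum u hun 0 h1
      rw [h2] at this
      exact hne u u hun this.2
    · simp only [Finset.mem_filter, Finset.mem_range] at hx
      exact (hinv.sound u (hAn u hu) x hx.1 hx.2).1
    · simp only [Finset.mem_filter, Finset.mem_range] at hx
      have := hinv.bound u (hAn u hu) x hx.1
      exact (hinv.sound u (hAn u hu) x hx.1 hx.2).2.mono (by omega)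
    · rw [← hinv.card u (hAn u hu)]
      exact hinv.le u (hAn u hu)
    · rw [← hinv.card u (hAn u hu)] at hlt
      exact hne u x (hAn x hx)
        (((hcomp u (hAn u hu)).resolve_left hlt.ne) x hx δ le_rfl hn).1
    · simp only [Finset.mem_filter, Finset.mem_range] at hx hx'
      have h1 := hI.owned q hq x hx.1 hx.2
      have h2 := hI.owned q' hq' x hx'.1 hx'.2
      omega
    · rw [← hinv.card q (hAn q (hSA hq))]
      exact hI.thr_le q hq
    · have hun := hAn u hu
      obtain ⟨i, hi, hiu⟩ := hcur u hu
      have := hI.alt i hi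
      simp only [hiu] at this
      rcases this with h | ⟨q, hq, h⟩ | ⟨h1, h2⟩
      · exact Or.inl h
      · exact Or.inr (Or.inl ⟨q, hq, hE _ _ _ h⟩)
      -- An unpopular centre has fewer than `thr ≤ cap` entries, so its list is not full;
      -- completeness then gives every centre within the radius, at its true distance.
      · refine Or.inr (Or.inr ⟨?_, fun x hx hxu e he hn => ?_⟩)
        · rw [← hinv.card u hun]
          exact h1
        · have h3 := ((hcomp u hun).resolve_left (by omega)) x hx e he hn
          exact hE _ _ _ ((h2 x (hAn x hx) hxu h3.1).mono (by omega))
    · have := hI.count_zero h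
      rw [k4, hA.card_eq, ← e4]
      exact this
    · have := hI.count h
      rw [k4, ← e4]
      refine this.trans (Nat.add_le_add_left (le_of_eq ?_) _)
      -- The sum over positions in the array is turned into a sum over the set of centres.
      have hinj : Set.InjOn (fun j => s.arr 11 (cell n ph j)) (Finset.range a : Set ℕ) :=
        fun i hi j hj hij => hA.inj (by simpa using hi) (by simpa using hj) hij
      rw [hA.eq_image, Finset.sum_image hinj]
      refine Finset.sum_congr rfl fun i hi => ?_
      have hi' := hA.mem (Finset.mem_range.1 hi)
      rw [← hinv.card _ (hAn _ hi'), e11]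
  · rw [g11, k11]
    exact hI.enum

end

end Ram

/-! ### The schedule of the phases and their execution -/

/-- The thresholds of the phases: they are squared until they reach `Q`. -/
def threshold (Q : ℕ) : ℕ → ℕ
  | 0 => 2
  | i + 1 => min (threshold Q i * threshold Q i) Q

/-- The radii of the phases, cut off at `n`. -/
def radius (T θ n : ℕ) : ℕ → ℕ
  | 0 => T
  | i + 1 => min (radius T θ n i * θ) n

/-- The capacities of the lists. -/
def capacity (T Q : ℕ) : ℕ → ℕ
  | 0 => T + 1
  | i + 1 => threshold Q i + 1

/-- A centre is popular if its list has this length; in the first phase, all centres are. -/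
def popularity (Q : ℕ) : ℕ → ℕ
  | 0 => 0
  | i + 1 => threshold Q i + 1

/-- The history of the phases before `N`. -/
structure History (adj : ℕ → ℕ → Prop) (T θ Q n N : ℕ) (E : ℕ → ℕ → ℕ → Prop)
    (A : ℕ → Finset ℕ) (L : ℕ → ℕ → Finset ℕ) (M : ℕ → ℕ) : Prop where
  spec : ∀ i < N, PhaseSpec adj (A i) (A (i + 1)) (radius T θ n i) (capacity T Q i)
    (popularity Q i) (M i) (M (i + 1)) E (L i)

namespace Ram

section Programs

open Ram.Expr Ram.Test Ram.Cmd

/-- All phases. -/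
def phases : Cmd := assign 34 (var 9 + lit 1) ;; forLoop 12 34 phase

end Programs

section

variable {n m X W T θ Q ℓ : ℕ} {ax ay : ℕ → ℕ} {s s' : Store} {adj : ℕ → ℕ → Prop}
  {A₀ : Finset ℕ}

/-- The invariant carries the whole history so far, with the current edge set, and is brought up to
date by `PhaseSpec.mono` after each phase. The inclusion of all centres in `A₀` bounds their number
by the number of arcs throughout. Each phase uses rows of the tables that no earlier phase has
touched, so nothing is ever cleared. -/
theorem wp_phases {R C : ℕ} (hW : (X + 1) ^ 3 + 3 ≤ W) (hn : n ≤ X) (hm : m ≤ X) (hℓ : ℓ + 1 ≤ X)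
    (hR : ∀ i ≤ ℓ, radius T θ n i ≤ R) (hRX : R ≤ X) (hC : ∀ i ≤ ℓ, capacity T Q i ≤ C)
    (hCX : C ≤ X) (hRθ : X * θ ≤ W) (hQ : ∀ i, threshold Q i * threshold Q i ≤ X) (hQX : Q ≤ X)
    (harc : IsArcs adj n m ax ay)
    (h0 : s.var 0 = n) (h22 : s.var 22 = m) (h12 : s.var 12 = 0) (h13 : s.var 13 = T)
    (h14 : s.var 14 = T + 1) (h15 : s.var 15 = 0) (h16 : s.var 16 = 2) (h8 : s.var 8 = Q)
    (h9 : s.var 9 = ℓ) (h10 : s.var 10 = θ) (h4 : s.var 4 = 0) (h6 : s.arr 6 = ax)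
    (h7 : s.arr 7 = ay) (hA : Enumerates A₀ (s.var 11) fun j => s.arr 11 (cell n 0 j))
    (hAn : ∀ u ∈ A₀, u < n) (hAm : A₀.card ≤ m) (hzero : ∀ a i, a ≠ 0 → a ≠ 1 → a ≠ 6 → a ≠ 7 →
      a ≠ 11 → a ≠ 13 → s.arr a i = 0) :
    wp W phases s fun t s' => t ≤ (ℓ + 2) * ((R + 1) * ((m + 1) * ((C + 1) * 510))) ∧
      OutInv adj n W s' ∧ ∃ A L M, A 0 = A₀ ∧ M 0 = 0 ∧ M (ℓ + 1) = s'.var 4 ∧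
        History adj T θ Q n (ℓ + 1) (HasEdge n s') A L M := by
  have hX : X + 1 ≤ (X + 1) ^ 3 := Nat.le_self_pow (by norm_num) _
  refine wp_seq (wp_assign ?_ ?_)
  · simp [h9]
    omega
  refine (wp_for (s := s.setVar 34 (s.var 9 + 1)) 0 (ℓ + 1) ((R + 1) * ((m + 1) * ((C + 1) * 500)))
    (fun i s' => s'.var 0 = n ∧ s'.var 22 = m ∧ s'.var 13 = radius T θ n i ∧
      s'.var 14 = capacity T Q i ∧ s'.var 15 = popularity Q i ∧ s'.var 16 = threshold Q i ∧
      s'.var 8 = Q ∧ s'.var 10 = θ ∧ s'.arr 6 = ax ∧ s'.arr 7 = ay ∧ Fresh n i s' ∧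
      (∀ i', i ≤ i' → ∀ x < n, s'.arr 12 (cell n i' x) = 0) ∧ OutInv adj n W s' ∧
      ∃ A L M, A 0 = A₀ ∧ M 0 = 0 ∧ M i = s'.var 4 ∧
        Enumerates (A i) (s'.var 11) (fun j => s'.arr 11 (cell n i j)) ∧ (∀ j ≤ i, A j ⊆ A₀) ∧
        History adj T θ Q n i (HasEdge n s') A L M)
    ?_ ?_ (Nat.zero_le _) (by omega) rfl rfl rfl ?_ ?_ ?_).imp ?_
  · simpa using h12
  · simp [h9]
  · refine ⟨by simpa using h0, by simpa using h22, by simpa [radius] using h13,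
      by simpa [capacity] using h14, by simpa [popularity] using h15,
      by simpa [threshold] using h16, by simpa using h8, by simpa using h10, h6, h7,
      ⟨fun _ _ _ _ _ _ => hzero _ _ ?_ ?_ ?_ ?_ ?_ ?_, fun _ _ _ _ => hzero _ _ ?_ ?_ ?_ ?_ ?_ ?_⟩,
      fun _ _ _ _ => hzero _ _ ?_ ?_ ?_ ?_ ?_ ?_, ?_, fun _ => A₀, fun _ _ => ∅, fun _ => 0,
      rfl, rfl, by simpa using h4.symm, by simpa using hA, fun _ _ => subset_rfl,
      ⟨fun i hi => absurd hi (Nat.not_lt_zero _)⟩⟩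
    any_goals norm_num
    have hz : ∀ i, s.arr 5 i = 0 := fun i => by
      apply hzero <;> norm_num
    constructor <;> simp [h4, hz]
  · rintro i s' v ⟨i1, i2, i3, i4, i5, i6, i7, i8, i9, i10, i11, i12, i13, A, L, M, j1, j2, j3, j4,
      j5, j6⟩
    exact ⟨by simpa using i1, by simpa using i2, by simpa using i3, by simpa using i4,
      by simpa using i5, by simpa using i6, by simpa using i7, by simpa using i8, i9, i10, i11, i12,
      i13.congr (by simp) rfl rfl rfl rfl, A, L, M, j1, j2, by simpa using j3, by simpa using j4,
      j5, j6⟩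
  · rintro i s₁ - hi hx hf ⟨i1, i2, i3, i4, i5, i6, i7, i8, i9, i10, i11, i12, i13, A, L, M, j1,
      j2, j3, j4, j5, j6⟩
    have hRi := hR i (by omega)
    have hCi := hC i (by omega)
    have env : PhaseEnv n m i (radius T θ n i) (capacity T Q i) X ax ay s₁ :=
      ⟨i1, i2, hx, i3, i4, i9, i10, hn, hm, by omega, by omega, by omega⟩
    have hθW : θ ≤ W := (Nat.le_mul_of_pos_left θ (by omega)).trans hRθ
    have hcap : 1 ≤ capacity T Q i := by cases i <;> simp [capacity]
    have hthr : popularity Q i ≤ capacity T Q i := by cases i <;> simp [capacity, popularity]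
    have hA₁ : ∀ u ∈ A i, u < n := fun u hu => hAn u (j5 i le_rfl hu)
    have hqq := hQ i
    have hq1 : threshold Q i ≤ threshold Q i * threshold Q i := Nat.le_mul_self _
    refine (wp_phase (q := threshold Q i) (Q := Q) (θ := θ) env hW harc hcap hthr i5 rfl ?_ j4
      hA₁ i11 i12 i13
      ⟨by omega, by omega, (Nat.mul_le_mul_right θ (hRi.trans hRX)).trans hRθ, by omega, by omega⟩
      (by omega) hθW i8 i6 i7).imp_frame ?_
    · rw [← j4.card_eq]
      exact (Finset.card_le_card (j5 i le_rfl)).trans hAm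
    rintro t s₂ hf₂ ⟨ht, hmono, ⟨S, L', hspec, hS⟩, k1, k2, k3, k4, k5, k6, k7⟩
    -- Lists belong to the phase `i` itself, whereas new centres and the edge count belong to index
    -- `i + 1`; hence the different comparisons in the extended families.
    refine ⟨ht.trans (Nat.mul_le_mul (by omega) (Nat.mul_le_mul_left _
      (Nat.mul_le_mul_right _ (by omega)))), (hf₂.1 _ rfl).trans i1, (hf₂.1 _ rfl).trans i2, k4,
      k5, k6, k7, (hf₂.1 _ rfl).trans i7, (hf₂.1 _ rfl).trans i8, (hf₂.2 _ rfl).trans i9,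
      (hf₂.2 _ rfl).trans i10, k1, k2, k3, fun j => if j ≤ i then A j else S,
      fun j => if j < i then L j else L', fun j => if j ≤ i then M j else s₂.var 4, ?_, ?_, ?_, ?_,
      ?_, ⟨fun j hj => ?_⟩⟩
    · simpa using j1
    · simpa using j2
    · simp
    · simpa using hS
    · intro j hj
      dsimp only
      split_ifs with h
      · exact j5 j h
      · exact hspec.subset.trans (j5 i le_rfl)
    · rcases Nat.lt_succ_iff_lt_or_eq.1 hj with hj | rfl
      · have h1 : j ≤ i := by omega
        have h2 : j + 1 ≤ i := by omega
        simp only [h1, h2, hj, if_true]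
        exact (j6.spec j hj).mono fun u hu v hv w h =>
          hmono u (hAn u (j5 j h1 hu)) v (hAn v (j5 j h1 hv)) w h
      · have h1 : ¬ j + 1 ≤ j := by omega
        simp only [le_refl, h1, lt_irrefl, if_true, if_false]
        rw [j3]
        exact hspec
  · rintro t s₁ ⟨ht, -, i1, i2, i3, i4, i5, i6, i7, i8, i9, i10, i11, i12, i13, A, L, M, j1, j2, j3,
      j4, j5, j6⟩
    refine ⟨?_, i13, A, L, M, j1, j2, j3, j6⟩
    simp only [Expr.cost_add, Expr.cost_var, Expr.cost_lit, Nat.sub_zero] at ht ⊢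
    have h1 : 1 ≤ (R + 1) * ((m + 1) * (C + 1)) := Nat.mul_pos (by omega)
      (Nat.mul_pos (by omega) (by omega))
    have h2 : (R + 1) * ((m + 1) * ((C + 1) * 500)) = (R + 1) * ((m + 1) * (C + 1)) * 500 := by ring
    have h3 : (R + 1) * ((m + 1) * ((C + 1) * 510)) = (R + 1) * ((m + 1) * (C + 1)) * 510 := by ring
    rw [h2] at ht
    rw [h3]
    set Z := (R + 1) * ((m + 1) * (C + 1))
    have h4 : (ℓ + 1) * (Z * 500 + 7) ≤ (ℓ + 1) * (Z * 510) := Nat.mul_le_mul_left _ (by omega)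
    have h5 : (ℓ + 2) * (Z * 510) = (ℓ + 1) * (Z * 510) + Z * 510 := by ring
    omega

end

end Ram

/-! ### The integer parameters and their computation -/

/-- The number of bits of `n`. -/
def bits (n : ℕ) : ℕ := Nat.log 2 n + 1

/-- The number of phases with the largest threshold. -/
def fullPhases (n k : ℕ) : ℕ := min k (bits n)

/-- The largest threshold is `2 ^ exponent n k`. -/
def exponent (n k : ℕ) : ℕ := (bits n + fullPhases n k - 1) / fullPhases n k

/-- The number of phases after the first. -/
def phaseCount (n k : ℕ) : ℕ := fullPhases n k + Nat.clog 2 (exponent n k)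

theorem lt_two_pow_bits (n : ℕ) : n < 2 ^ bits n := Nat.lt_pow_succ_log_self (by norm_num) n

theorem two_pow_le_of_lt_bits {n i : ℕ} (hn : n ≠ 0) (hi : i < bits n) : 2 ^ i ≤ n :=
  (Nat.pow_le_pow_right (by norm_num) (Nat.lt_succ_iff.1 hi)).trans (Nat.pow_log_le_self 2 hn)

theorem bits_le {n : ℕ} (hn : n ≠ 0) : bits n ≤ n := Nat.log_lt_self 2 hn

theorem exponent_le {n k : ℕ} (hk : k ≠ 0) : exponent n k ≤ bits n := by
  have h : 0 < fullPhases n k := by unfold fullPhases bits; omega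
  have hb : 0 < bits n := by unfold bits; omega
  refine Nat.div_le_of_le_mul ?_
  have : bits n + fullPhases n k ≤ fullPhases n k * bits n + 1 := by nlinarith
  omega

theorem clog_exponent_le {n k : ℕ} (hk : k ≠ 0) : Nat.clog 2 (exponent n k) ≤ bits n :=
  Nat.clog_le_of_le_pow ((exponent_le hk).trans Nat.lt_two_pow_self.le)

theorem phaseCount_le {n k : ℕ} (hk : k ≠ 0) : phaseCount n k ≤ 2 * bits n := by
  have h1 : fullPhases n k ≤ bits n := min_le_right _ _
  have h2 := clog_exponent_le (n := n) hk
  unfold phaseCount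
  omega

namespace Ram

section Programs

open Ram.Expr Ram.Test Ram.Cmd

/-- Compute the parameters of the algorithm. -/
def params : Cmd :=
  (assign 5 (lit 0) ;; assign 24 (lit 1) ;;
    loop (lt (var 24) (var 0 + lit 1)) (assign 24 (var 24 + var 24) ;; assign 5 (var 5 + lit 1))) ;;
  (assign 6 (var 3) ;; clamp 6 5 ;; assign 7 ((var 5 + var 6 - lit 1) / var 6)) ;;
  (assign 8 (lit 1) ;; assign 20 (lit 0) ;; forLoop 20 7 (assign 8 (var 8 + var 8))) ;;
  (assign 9 (var 6) ;; assign 24 (lit 1) ;;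
    loop (lt (var 24) (var 7)) (assign 24 (var 24 + var 24) ;; assign 9 (var 9 + lit 1))) ;;
  assign 13 (var 5 * var 5) ;; assign 10 (lit 104 * var 9 * var 2) ;;
  assign 14 (var 13 + lit 1) ;; assign 16 (lit 2) ;; assign 22 (var 1 + var 1)

/-- List both directions of every edge. -/
def listArcs : Cmd :=
  assign 20 (lit 0) ;;
  forLoop 20 1 (
    write 6 (var 20 + var 20) (arr 0 (var 20)) ;;
    write 7 (var 20 + var 20) (arr 1 (var 20)) ;;
    write 6 (var 20 + var 20 + lit 1) (arr 1 (var 20)) ;;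
    write 7 (var 20 + var 20 + lit 1) (arr 0 (var 20)))

/-- List the vertices that are not isolated. -/
def listVertices : Cmd :=
  assign 20 (lit 0) ;;
  forLoop 20 22 (
    assign 21 (arr 6 (var 20)) ;;
    ite (eq (arr 13 (var 21)) (lit 0))
      (write 13 (var 21) (lit 1) ;; write 11 (var 11) (var 21) ;; assign 11 (var 11 + lit 1))
      skip)

/-- The whole algorithm. -/
def emulatorProgram : Cmd := params ;; listArcs ;; listVertices ;; phases

end Programs

section

variable {n m X W T θ Q ℓ K k : ℕ} {ax ay : ℕ → ℕ} {s s' : Store} {adj : ℕ → ℕ → Prop}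
  {A₀ : Finset ℕ}

/-- The machine has no logarithm or power, so these are found by doubling loops. Each runs at most
`bits n` times, since both `exponent n k` and its `Nat.clog` are at most `bits n`. -/
theorem wp_params (hn : n ≠ 0) (hk : k ≠ 0) (h0 : s.var 0 = n) (h1 : s.var 1 = m)
    (h2 : s.var 2 = K) (h3 : s.var 3 = k) (hW : 104 + 104 * phaseCount n k * K ≤ W)
    (hWT : bits n * bits n + 2 * n + k + 1 ≤ W)
    (hWQ : 2 ^ exponent n k ≤ W) (hWm : m + m ≤ W) (hK : K ≠ 0) :
    wp W params s fun t s' => t ≤ bits n * 200 + 200 ∧ s'.var 8 = 2 ^ exponent n k ∧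
      s'.var 9 = phaseCount n k ∧ s'.var 10 = 104 * phaseCount n k * K ∧
      s'.var 13 = bits n * bits n ∧ s'.var 14 = bits n * bits n + 1 ∧ s'.var 16 = 2 ∧
      s'.var 22 = m + m := by
  have hbn := bits_le hn
  have hpc := phaseCount_le (n := n) hk
  have hb1 : 1 ≤ bits n := by unfold bits; omega
  have hpK : phaseCount n k ≤ phaseCount n k * K := Nat.le_mul_of_pos_right _ (by omega)
  have hKK : K ≤ W := by
    have : 1 ≤ phaseCount n k := by unfold phaseCount fullPhases; omega
    have h : K ≤ 104 * phaseCount n k * K := Nat.le_mul_of_pos_left _ (by omega)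
    omega
  have hp4 : phaseCount n k ≤ 104 * phaseCount n k * K := by
    rw [Nat.mul_assoc]
    omega
  refine wp_seq (wp_seq (wp_assign (by simp) (wp_seq (wp_assign (by simp; omega)
    ((wp_loop (bits n) 12 (fun i s' => s'.var 5 = i ∧ s'.var 24 = 2 ^ i)
      ⟨by simp, by simp⟩ ?_ ?_).imp_frame ?_)))))
  · rintro i s' hi hf ⟨h5, h24⟩
    have e0 : s'.var 0 = n := by rw [hf.1 0 rfl]; simpa using h0
    have hp := two_pow_le_of_lt_bits hn hi
    refine ⟨by simp [h24, e0]; omega, by simp [h24, e0]; omega, wp_seq (wp_assign ?_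
      (wp_assign ?_ ⟨by simp, by simp [h5], by simp [h24]; ring⟩))⟩
    · simp [h24]; omega
    · simp [h5]; omega
  · rintro s' hf ⟨h5, h24⟩
    have e0 : s'.var 0 = n := by rw [hf.1 0 rfl]; simpa using h0
    have hp := lt_two_pow_bits n
    -- The first power of two above `n` is still at most `2 * n`, so the last doubling does not
    -- overflow.
    have hp' : 2 ^ bits n ≤ 2 * n := by
      have := two_pow_le_of_lt_bits hn (i := bits n - 1) (by omega)
      calc 2 ^ bits n = 2 ^ (bits n - 1 + 1) := by rw [Nat.sub_add_cancel hb1]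
        _ = 2 * 2 ^ (bits n - 1) := by ring
        _ ≤ 2 * n := by omega
    exact ⟨by simp [h24, e0]; omega, by simp [h24, e0]; omega⟩
  rintro t₁ s₁ hf₁ ⟨ht₁, -, e5, -⟩
  have e3 : s₁.var 3 = k := by rw [hf₁.1 3 rfl]; simpa using h3
  have e2 : s₁.var 2 = K := by rw [hf₁.1 2 rfl]; simpa using h2
  have e1 : s₁.var 1 = m := by rw [hf₁.1 1 rfl]; simpa using h1
  refine wp_seq (wp_seq (wp_assign ?_ (wp_seq ((wp_clamp ?_ ?_).imp_frame ?_))))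
  · simp [e3]; omega
  · simp [e3]; omega
  · simp [e5]; omega
  rintro t₂ s₂ hf₂ ⟨ht₂, e6⟩
  replace e6 : s₂.var 6 = fullPhases n k := by
    simpa [e3, e5, fullPhases] using e6
  have f5 : s₂.var 5 = bits n := by rw [hf₂.1 5 rfl]; simpa using e5
  have hfp : fullPhases n k ≤ bits n := min_le_right _ _
  refine wp_assign ?_ ?_
  · simp [e6, f5]; omega
  have f7 : (s₂.setVar 7 (((Expr.var 5 + Expr.var 6 - Expr.lit 1) / Expr.var 6).eval s₂)).var 7 =
      exponent n k := by simp [e6, f5, exponent]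
  have f2 : s₂.var 2 = K := by rw [hf₂.1 2 rfl]; simpa using e2
  have f1 : s₂.var 1 = m := by rw [hf₂.1 1 rfl]; simpa using e1
  generalize hs₃ : Store.setVar _ 7 _ = s₃ at f7 ⊢
  have g5 : s₃.var 5 = bits n := by simp [← hs₃, f5]
  have g6 : s₃.var 6 = fullPhases n k := by simp [← hs₃, e6]
  have g2 : s₃.var 2 = K := by simp [← hs₃, f2]
  have g1 : s₃.var 1 = m := by simp [← hs₃, f1]
  have hexp := exponent_le (n := n) hk
  refine wp_seq (wp_seq (wp_assign (by simp; omega) (wp_seq (wp_assign (by simp)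
    ((wp_for (s := (s₃.setVar 8 1).setVar 20 0) 0 (exponent n k) 4
      (fun i s' => s'.var 8 = 2 ^ i)
      (by simp) (by simpa using f7) (Nat.zero_le _) (by omega) rfl rfl rfl (by simp)
      (fun i s' v h => by simpa using h) ?_).imp_frame ?_)))))
  · rintro i s' - hi hx hf h8
    have : 2 ^ (i + 1) ≤ 2 ^ exponent n k := Nat.pow_le_pow_right (by norm_num) hi
    have h2 : 2 ^ (i + 1) = 2 ^ i + 2 ^ i := by ring
    refine wp_assign (by simp [h8]; omega) ⟨by simp, by simp [h8]; omega⟩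
  rintro t₄ s₄ hf₄ ⟨ht₄, -, h8⟩
  have k5 : s₄.var 5 = bits n := by rw [hf₄.1 5 rfl]; simpa using g5
  have k6 : s₄.var 6 = fullPhases n k := by rw [hf₄.1 6 rfl]; simpa using g6
  have k7 : s₄.var 7 = exponent n k := by rw [hf₄.1 7 rfl]; simpa using f7
  have k2 : s₄.var 2 = K := by rw [hf₄.1 2 rfl]; simpa using g2
  have k1 : s₄.var 1 = m := by rw [hf₄.1 1 rfl]; simpa using g1
  refine wp_seq (wp_seq (wp_assign (by simp [k6]; omega) (wp_seq (wp_assign (by simp; omega)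
    ((wp_loop (Nat.clog 2 (exponent n k)) 12
      (fun i s' => s'.var 9 = fullPhases n k + i ∧ s'.var 24 = 2 ^ i)
      ⟨by simp [k6], by simp⟩ ?_ ?_).imp_frame ?_)))))
  · rintro i s' hi hf ⟨h9, h24⟩
    have e7 : s'.var 7 = exponent n k := by rw [hf.1 7 rfl]; simpa using k7
    -- By minimality of `Nat.clog` the loop cannot stop earlier.
    have hp : 2 ^ i < exponent n k := by
      by_contra h
      have := Nat.clog_le_of_le_pow (b := 2) (not_lt.1 h)
      omega
    have hph : fullPhases n k + Nat.clog 2 (exponent n k) = phaseCount n k := rfl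
    refine ⟨by simp [h24, e7]; omega, by simp [h24, e7]; omega, wp_seq (wp_assign ?_
      (wp_assign ?_ ⟨by simp, by simp [h9]; omega, by simp [h24]; ring⟩))⟩
    · simp [h24]; omega
    · simp [h9]; omega
  · rintro s' hf ⟨h9, h24⟩
    have e7 : s'.var 7 = exponent n k := by rw [hf.1 7 rfl]; simpa using k7
    have hp : exponent n k ≤ 2 ^ Nat.clog 2 (exponent n k) := Nat.le_pow_clog (by norm_num) _
    have hp' : 2 ^ Nat.clog 2 (exponent n k) ≤ 2 ^ exponent n k :=
      Nat.pow_le_pow_right (by norm_num)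
        (Nat.clog_le_of_le_pow Nat.lt_two_pow_self.le)
    exact ⟨by simp [h24, e7]; omega, by simp [h24, e7]; omega⟩
  rintro t₅ s₅ hf₅ ⟨ht₅, -, h9, -⟩
  replace h9 : s₅.var 9 = phaseCount n k := h9
  have l5 : s₅.var 5 = bits n := by rw [hf₅.1 5 rfl]; simpa using k5
  have l2 : s₅.var 2 = K := by rw [hf₅.1 2 rfl]; simpa using k2
  have l1 : s₅.var 1 = m := by rw [hf₅.1 1 rfl]; simpa using k1
  have l8 : s₅.var 8 = 2 ^ exponent n k := by rw [hf₅.1 8 rfl]; simpa using h8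
  have h104 : 104 * phaseCount n k ≤ 104 * phaseCount n k * K :=
    Nat.le_mul_of_pos_right _ (by omega)
  refine wp_seq (wp_assign ?_ (wp_seq (wp_assign ?_ (wp_seq (wp_assign ?_ (wp_seq (wp_assign ?_
    (wp_assign ?_ ⟨?_, ?_, ?_, ?_, ?_, ?_, ?_, ?_⟩))))))))
  · simp [l5]; omega
  · simp [h9, l2]; omega
  · simp [l5]; omega
  · simp; omega
  · simp [l1]; omega
  · have hcl := clog_exponent_le (n := n) hk
    simp at ht₁ ht₂ ht₄ ht₅ ⊢
    omega
  all_goals simp [l8, h9, l2, l5, l1]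

end

end Ram

/-! ### Reading the graph, and the whole program -/

/-- The adjacency relation of a graph on `Fin n`, on the natural numbers. -/
def natAdj {n : ℕ} (G : SimpleGraph (Fin n)) (u v : ℕ) : Prop :=
  ∃ (hu : u < n) (hv : v < n), G.Adj ⟨u, hu⟩ ⟨v, hv⟩

theorem natAdj_symm {n : ℕ} (G : SimpleGraph (Fin n)) (u v : ℕ) (h : natAdj G u v) :
    natAdj G v u := by
  obtain ⟨hu, hv, h⟩ := h
  exact ⟨hv, hu, h.symm⟩

namespace Ram

section

variable {n m X W T θ Q ℓ K k : ℕ} {ax ay x y : ℕ → ℕ} {s s' : Store} {adj : ℕ → ℕ → Prop}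
  {A₀ : Finset ℕ}

theorem wp_listArcs (h1 : s.var 1 = m) (hx : s.arr 0 = x) (hy : s.arr 1 = y)
    (hxW : ∀ j < m, x j ≤ W) (hyW : ∀ j < m, y j ≤ W) (hW : 2 * m + 1 < W) :
    wp W listArcs s fun t s' => t ≤ m * 50 + 10 ∧ ∀ j < m,
      (s'.arr 6 (j + j) = x j ∧ s'.arr 7 (j + j) = y j) ∧
        (s'.arr 6 (j + j + 1) = y j ∧ s'.arr 7 (j + j + 1) = x j) := by
  refine wp_seq (wp_assign (by simp) ?_)
  refine (wp_for (s := s.setVar 20 0) 0 m 40 (fun i s' => ∀ j < i,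
      (s'.arr 6 (j + j) = x j ∧ s'.arr 7 (j + j) = y j) ∧
        (s'.arr 6 (j + j + 1) = y j ∧ s'.arr 7 (j + j + 1) = x j))
    (by simp) (by simpa using h1) (Nat.zero_le _) (by omega) rfl rfl rfl (by simp)
    (fun i s' v h => h) ?_).imp ?_
  · rintro i s₁ - hi h20 hf hI
    have e0 : s₁.arr 0 = x := (hf.2 0 rfl).trans hx
    have e1 : s₁.arr 1 = y := (hf.2 1 rfl).trans hy
    have := hxW i hi
    have := hyW i hi
    refine wp_seq (wp_write ?_ ?_ (wp_seq (wp_write ?_ ?_ (wp_seq (wp_write ?_ ?_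
      (wp_write ?_ ?_ ⟨by simp, fun j hj => ?_⟩))))))
    · simp [h20]; omega
    · simp [h20, e0]; omega
    · simp [h20]; omega
    · simp [h20, e1]; omega
    · simp [h20]; omega
    · simp [h20, e1]; omega
    · simp [h20]; omega
    · simp [h20, e0]; omega
    · rcases Nat.lt_succ_iff_lt_or_eq.1 hj with hj | rfl
      · have n1 : j + j ≠ i + i := by omega
        have n2 : j + j ≠ i + i + 1 := by omega
        have n3 : j + j + 1 ≠ i + i := by omega
        have n4 : j ≠ i := by omega
        simpa [h20, e0, e1, Function.update_apply, n1, n2, n3, n4] using hI j hj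
      · simp [h20, e0, e1]
  · rintro t s₁ ⟨ht, -, hI⟩
    refine ⟨?_, hI⟩
    simp only [Expr.cost_lit, Nat.sub_zero] at ht ⊢
    omega

/-- The vertices are collected by walking through the tails of the arcs, with array 13 as a mark
against repetition. Isolated vertices are never touched, and the cost depends on the number of arcs
alone. -/
theorem wp_listVertices (h22 : s.var 22 = m) (hx : s.arr 6 = x) (h11 : s.var 11 = 0)
    (h13 : ∀ i, s.arr 13 i = 0) (hxW : ∀ j < m, x j ≤ W) (hW : m < W) :
    wp W listVertices s fun t s' => t ≤ m * 50 + 10 ∧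
      Enumerates ((Finset.range m).image x) (s'.var 11) (s'.arr 11) := by
  refine wp_seq (wp_assign (by simp) ?_)
  refine (wp_for (s := s.setVar 20 0) 0 m 40 (fun i s' =>
      Enumerates ((Finset.range i).image x) (s'.var 11) (s'.arr 11) ∧
      ∀ u, s'.arr 13 u ≤ 1 ∧ (s'.arr 13 u ≠ 0 ↔ u ∈ (Finset.range i).image x))
    (by simp) (by simpa using h22) (Nat.zero_le _) hW rfl rfl rfl
    ⟨by simpa [h11] using Enumerates.empty _, by simp [h13]⟩
    (fun i s' v h => ⟨?_, h.2⟩) ?_).imp ?_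
  · simp only [Store.var_setVar]
    exact h.1
  · rintro i s₁ - hi h20 hf ⟨hE, hI⟩
    have e6 : s₁.arr 6 = x := (hf.2 6 rfl).trans hx
    have := hxW i hi
    have hI1 := (hI (x i)).1
    have hIm := (hI (x i)).2
    have himg : (Finset.range (i + 1)).image x = insert (x i) ((Finset.range i).image x) := by
      rw [Finset.range_add_one, Finset.image_insert]
    have hle : s₁.var 11 ≤ i := by
      rw [← hE.card_eq]
      exact Finset.card_image_le.trans (by simp)
    refine wp_seq (wp_assign ?_ (wp_ite ?_ (fun hb => ?_) fun hb => ?_))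
    · simp [h20, e6]; omega
    · simp [h20, e6]; omega
    · simp [h20, e6] at hb
      have hnot : x i ∉ (Finset.range i).image x := fun h => hIm.2 h hb
      refine wp_seq (wp_write ?_ ?_ (wp_seq (wp_write ?_ ?_ (wp_assign ?_ ⟨by simp, ?_, ?_⟩))))
      · simp [h20, e6]; omega
      · simp; omega
      · simp; omega
      · simp [h20, e6]; omega
      · simp; omega
      · rw [himg]
        simp only [Expr.eval_add, Expr.eval_var, Expr.eval_lit, Expr.eval_arr, Store.var_setVar,
          Store.var_setArr, Store.arr_setVar, Store.arr_setArr]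
        refine hE.insert hnot (fun j hj => ?_) ?_
        · simp [hj.ne]
        · simp [h20, e6]
      · intro u
        rw [himg]
        by_cases hu : u = x i
        · simp [h20, e6, hu]
        · simpa [h20, e6, hu] using hI u
    · simp [h20, e6] at hb
      refine wp_skip ⟨by simp, ?_, ?_⟩
      · rw [himg, Finset.insert_eq_of_mem (hIm.1 hb)]
        simpa using hE
      · rw [himg, Finset.insert_eq_of_mem (hIm.1 hb)]
        simpa using hI
  · rintro t s₁ ⟨ht, -, hE, -⟩
    refine ⟨?_, hE⟩
    simp only [Expr.cost_lit, Nat.sub_zero] at ht ⊢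
    omega

theorem IsEdgeList.getElem {n : ℕ} {G : SimpleGraph (Fin n)} {es : List (Fin n × Fin n)}
    (h : IsEdgeList G es) {j : ℕ} (hj : j < es.length) : G.Adj es[j].1 es[j].2 :=
  (h.2 _ _).2 (Or.inl (List.getElem_mem hj))

theorem inputStore_arr {n : ℕ} {es : List (Fin n × Fin n)} {j : ℕ} (hj : j < es.length) :
    (inputStore es K k).arr 0 j = es[j].1 ∧ (inputStore es K k).arr 1 j = es[j].2 := by
  simp [inputStore, List.getElem?_eq_getElem hj]

theorem wp_emulatorProgram {n : ℕ} {G : SimpleGraph (Fin n)} {es : List (Fin n × Fin n)}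
    (hes : IsEdgeList G es) (hn0 : n ≠ 0) (hk : k ≠ 0) (hK : K ≠ 0) {R C : ℕ}
    (hT : T = bits n * bits n) (hθ : θ = 104 * phaseCount n k * K) (hQ : Q = 2 ^ exponent n k)
    (hW : (X + 1) ^ 3 + 3 ≤ W) (hn : n ≤ X) (hm : 2 * es.length ≤ X) (hℓ : phaseCount n k + 1 ≤ X)
    (hkX : k ≤ X) (hTX : T ≤ X)
    (hR : ∀ i ≤ phaseCount n k, radius T θ n i ≤ R) (hRX : R ≤ X)
    (hC : ∀ i ≤ phaseCount n k, capacity T Q i ≤ C)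
    (hCX : C ≤ X) (hRθ : X * θ + 104 ≤ W) (hQQ : ∀ i, threshold Q i * threshold Q i ≤ X)
    (hQX : Q ≤ X) :
    wp W emulatorProgram (inputStore es K k) fun t s' =>
      t ≤ bits n * 200 + es.length * 150 + 230 +
        (phaseCount n k + 2) * ((R + 1) * ((2 * es.length + 1) * ((C + 1) * 510))) ∧
      OutInv (natAdj G) n W s' ∧ ∃ A L M, (∀ u, u ∈ A 0 ↔ ∃ v, natAdj G u v) ∧ M 0 = 0 ∧
        M (phaseCount n k + 1) = s'.var 4 ∧
        History (natAdj G) T θ Q n (phaseCount n k + 1) (HasEdge n s') A L M := by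
  set s := inputStore es K k with hs
  set m := es.length with hmdef
  have hX3 : X + X + X + X + 1 ≤ (X + 1) ^ 3 + 3 := by
    have : (X + 1) ^ 3 = X ^ 3 + 3 * X ^ 2 + 3 * X + 1 := by ring
    nlinarith [Nat.zero_le (X ^ 3), Nat.zero_le (X ^ 2)]
  have hθW : θ ≤ X * θ := Nat.le_mul_of_pos_left _ (by omega)
  have hx : ∀ j < m, s.arr 0 j < n ∧ s.arr 1 j < n ∧ natAdj G (s.arr 0 j) (s.arr 1 j) := by
    intro j hj
    obtain ⟨e0, e1⟩ := inputStore_arr (K := K) (k := k) hj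
    rw [e0, e1]
    exact ⟨es[j].1.2, es[j].2.2, es[j].1.2, es[j].2.2, hes.getElem hj⟩
  refine wp_seq ((wp_params (s := s) (n := n) (m := m) (K := K) (k := k) hn0 hk rfl rfl rfl rfl
    (by rw [← hθ]; omega) (by rw [← hT]; omega) (by rw [← hQ]; omega) (by omega) hK).imp_frame ?_)
  rintro t₁ s₁ hf₁ ⟨ht₁, h8, h9, h10, h13, h14, h16, h22⟩
  have a0 : s₁.arr 0 = s.arr 0 := hf₁.2 0 rfl
  have a1 : s₁.arr 1 = s.arr 1 := hf₁.2 1 rfl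
  refine wp_seq ((wp_listArcs (s := s₁) (m := m) (x := s.arr 0) (y := s.arr 1) (hf₁.1 1 rfl) a0 a1
    (fun j hj => ?_) (fun j hj => ?_) (by omega)).imp_frame ?_)
  · have := hx j hj
    omega
  · have := hx j hj
    omega
  rintro t₂ s₂ hf₂ ⟨ht₂, harcs⟩
  have hcases : ∀ e < m + m, ∃ j < m, e = j + j ∨ e = j + j + 1 := fun e he =>
    ⟨e / 2, by omega, by omega⟩
  have hA : IsArcs (natAdj G) n (m + m) (s₂.arr 6) (s₂.arr 7) := by
    refine ⟨fun u v ⟨hu, hv, _⟩ => ⟨hu, hv⟩, natAdj_symm G, fun e he => ?_, fun u v huv => ?_⟩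
    · obtain ⟨j, hj, rfl | rfl⟩ := hcases e he
      · obtain ⟨⟨g6, g7⟩, -⟩ := harcs j hj
        rw [g6, g7]
        exact (hx j hj).2.2
      · obtain ⟨-, ⟨g6, g7⟩⟩ := harcs j hj
        rw [g6, g7]
        exact natAdj_symm G _ _ (hx j hj).2.2
    · obtain ⟨hu, hv, hadj⟩ := huv
      have key : ∀ p ∈ es, ∃ j < m, s.arr 0 j = p.1 ∧ s.arr 1 j = p.2 := by
        intro p hp
        obtain ⟨j, hj, rfl⟩ := List.mem_iff_getElem.1 hp
        exact ⟨j, hj, inputStore_arr hj⟩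
      rcases (hes.2 _ _).1 hadj with h | h
      · obtain ⟨j, hj, e0, e1⟩ := key _ h
        obtain ⟨⟨g6, g7⟩, -⟩ := harcs j hj
        exact ⟨j + j, by omega, by rw [g6, e0], by rw [g7, e1]⟩
      · obtain ⟨j, hj, e0, e1⟩ := key _ h
        obtain ⟨-, ⟨g6, g7⟩⟩ := harcs j hj
        exact ⟨j + j + 1, by omega, by rw [g6, e1], by rw [g7, e0]⟩
  have b22 : s₂.var 22 = m + m := (hf₂.1 _ rfl).trans h22
  refine wp_seq ((wp_listVertices (s := s₂) (m := m + m) (x := s₂.arr 6) b22 rfl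
    ((hf₂.1 _ rfl).trans (hf₁.1 _ rfl)) (fun i => ?_) (fun j hj => ?_) (by omega)).imp_frame ?_)
  · rw [hf₂.2 13 rfl, hf₁.2 13 rfl]
    rfl
  · have := (hA.lt _ _ (hA.arc j hj)).1
    omega
  rintro t₃ s₃ hf₃ ⟨ht₃, hE⟩
  have hmem : ∀ u, u ∈ (Finset.range (m + m)).image (s₂.arr 6) ↔ ∃ v, natAdj G u v := by
    intro u
    simp only [Finset.mem_image, Finset.mem_range]
    constructor
    · rintro ⟨e, he, rfl⟩
      exact ⟨_, hA.arc e he⟩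
    · rintro ⟨v, hv⟩
      obtain ⟨e, he, h1, -⟩ := hA.surj _ _ hv
      exact ⟨e, he, h1⟩
  have e14 : s₃.var 14 = T + 1 := by
    rw [hT]; exact ((hf₃.1 _ rfl).trans (hf₂.1 _ rfl)).trans h14
  have e13 : s₃.var 13 = T := by
    rw [hT]; exact ((hf₃.1 _ rfl).trans (hf₂.1 _ rfl)).trans h13
  have e8 : s₃.var 8 = Q := by
    rw [hQ]; exact ((hf₃.1 _ rfl).trans (hf₂.1 _ rfl)).trans h8
  have e10 : s₃.var 10 = θ := by
    rw [hθ]; exact ((hf₃.1 _ rfl).trans (hf₂.1 _ rfl)).trans h10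
  have hv : ∀ x, (x == 0 || x == 4 || x == 12 || x == 15) = true → s₃.var x = s.var x := by
    intro x hx
    simp only [Bool.or_eq_true, beq_iff_eq] at hx
    rcases hx with ((rfl | rfl) | rfl) | rfl <;>
    exact ((hf₃.1 _ rfl).trans (hf₂.1 _ rfl)).trans (hf₁.1 _ rfl)
  refine (wp_phases (s := s₃) (n := n) (m := m + m) (ℓ := phaseCount n k) (R := R) (C := C) hW hn
    (by omega) hℓ hR hRX hC hCX (by omega) hQQ hQX hA (hv 0 rfl)
    ((hf₃.1 _ rfl).trans b22) (hv 12 rfl) e13 e14 (hv 15 rfl)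
    (((hf₃.1 _ rfl).trans (hf₂.1 _ rfl)).trans h16) e8
    (((hf₃.1 _ rfl).trans (hf₂.1 _ rfl)).trans h9) e10 (hv 4 rfl) (hf₃.2 _ rfl) (hf₃.2 _ rfl)
    (A₀ := (Finset.range (m + m)).image (s₂.arr 6)) (by simpa [cell] using hE)
    (fun u hu => ?_) (Finset.card_image_le.trans (by simp)) ?_).imp ?_
  · obtain ⟨v, hv⟩ := (hmem u).1 hu
    exact (hA.lt _ _ hv).1
  -- The preparatory programs write only into arrays 6, 7, 11 and 13, and the input occupies only 0
  -- and 1; everything else is still zero.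
  · intro a i h0 h1 h6 h7 h11 h13
    have w₃ : listVertices.writesArr a = false := by
      simp [listVertices, forLoop, Cmd.writesArr, h11, h13]
    have w₂ : listArcs.writesArr a = false := by
      simp [listArcs, forLoop, Cmd.writesArr, h6, h7]
    have w₁ : params.writesArr a = false := by
      simp [params, forLoop, clamp, Cmd.writesArr]
    rw [hf₃.2 a w₃, hf₂.2 a w₂, hf₁.2 a w₁]
    simp only [hs, inputStore]
  · rintro t s₄ ⟨ht, hout, A, L, M, hA0, hM0, hM1, hist⟩
    refine ⟨?_, hout, A, L, M, fun u => by rw [hA0]; exact hmem u, hM0, hM1, hist⟩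
    rw [← Nat.two_mul] at ht
    omega

end

end Ram

/-! ### The number of edges -/

open Classical in
/-- The centres that share their component with another centre. -/
noncomputable def linked (adj : ℕ → ℕ → Prop) (A : Finset ℕ) : Finset ℕ :=
  A.filter fun u => ∃ v ∈ A, v ≠ u ∧ ∃ d, Near adj d v u

section

variable {adj : ℕ → ℕ → Prop} {A A' B : Finset ℕ} {δ cap thr M₁ M₂ c T θ Q n N ℓ k : ℕ}
  {E : ℕ → ℕ → ℕ → Prop} {L : ℕ → Finset ℕ} {u v : ℕ}

theorem mem_linked : u ∈ linked adj A ↔ u ∈ A ∧ ∃ v ∈ A, v ≠ u ∧ ∃ d, Near adj d v u := by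
  simp [linked]

theorem linked_subset : linked adj A ⊆ A := fun _ hu => (mem_linked.1 hu).1

namespace PhaseSpec

/-- The lists of the chosen centres are disjoint, and each has at least two elements, so each member
shares its component with another member of its list. All these elements are thus linked centres of
the previous generation. -/
theorem card_mul_le (h : PhaseSpec adj A A' δ cap thr M₁ M₂ E L)
    (hadj : ∀ u v, adj u v → adj v u) (hB : B ⊆ A') (hc : 2 ≤ c)
    (hL : ∀ p ∈ B, c ≤ (L p).card) : B.card * c ≤ (linked adj A).card := by
  classical
  have hBA : B ⊆ A := hB.trans h.subset
  calc B.card * c = ∑ p ∈ B, c := by simp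
    _ ≤ ∑ p ∈ B, (L p).card := Finset.sum_le_sum hL
    _ = (B.biUnion L).card := by
      refine (Finset.card_biUnion fun p hp q hq hpq => ?_).symm
      exact Finset.disjoint_left.2 fun x hx hx' => hpq (h.disj p (hB hp) q (hB hq) x hx hx')
    _ ≤ (linked adj A).card := by
      refine Finset.card_le_card fun x hx => ?_
      obtain ⟨p, hp, hx⟩ := Finset.mem_biUnion.1 hx
      have hpA := hBA hp
      refine mem_linked.2 ⟨h.sub p hpA hx, ?_⟩
      by_cases hxp : x = p
      · obtain ⟨y, hy, hyp⟩ := Finset.exists_mem_ne (hc.trans (hL p hp)) p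
        exact ⟨y, h.sub p hpA hy, by rwa [hxp], δ, by rw [hxp]; exact h.near p hpA y hy⟩
      · exact ⟨p, hpA, Ne.symm hxp, δ, (h.near p hpA x hx).symm hadj⟩

/-- This is where ultra-sparsity comes from. If a linked survivor `p` did not have a full list, its
ball of radius `δ` would have at most `δ` elements, hence be its whole component; the second
survivor in that component would lie on the list of `p` and on its own list, against disjointness.
-/
theorem card_linked_mul_le (h : PhaseSpec adj A A' δ (δ + 1) thr M₁ M₂ E L) (hδ : δ ≠ 0)
    (hadj : ∀ u v, adj u v → adj v u) (hA : ∀ u, u ∈ A ↔ ∃ v, adj u v) :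
    (linked adj A').card * (δ + 1) ≤ A.card := by
  refine (h.card_mul_le hadj linked_subset (by omega) fun p hp => ?_).trans
    (Finset.card_le_card linked_subset)
  by_contra hlt
  obtain ⟨hpA', q, hq, hqp, d, hd⟩ := mem_linked.1 hp
  have hpA := h.subset hpA'
  -- Being non-isolated spreads along edges, so every vertex of the ball is a centre and appears on
  -- a list that is not full.
  have hball : ∀ v, Near adj δ p v → v ∈ L p := fun v hv =>
    h.complete p hpA (by omega) v
      ((hA v).2 (hv.invariant (S := fun v => ∃ w, adj v w) (fun u v huv _ => ⟨u, hadj _ _ huv⟩)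
        ((hA p).1 hpA))) (hv.symm hadj)
  have hpq := Near.of_ball_le hball (by omega) (hd.symm hadj)
  exact hqp (h.disj q hq p hpA' q (h.self q (h.subset hq)) (hball q hpq))

/-- A centre alone in its component lists only itself and contributes no edge; each other centre
contributes at most `cap - 1`. -/
theorem count_le (h : PhaseSpec adj A A' δ cap thr M₁ M₂ E L) (ht : 2 ≤ thr) :
    M₂ ≤ M₁ + (linked adj A).card * (cap - 1) := by
  classical
  refine (h.count ht).trans (Nat.add_le_add_left ?_ _)
  have hs : ∑ u ∈ A, ((L u).card - 1) = ∑ u ∈ linked adj A, ((L u).card - 1) := by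
    refine (Finset.sum_subset linked_subset fun u hu hlone => ?_).symm
    have : (L u).card ≤ 1 := Finset.card_le_one.2 fun x hx y hy => by
      have key : ∀ z ∈ L u, z = u := fun z hz => by
        by_contra hzu
        exact hlone (mem_linked.2 ⟨hu, z, h.sub u hu hz, hzu, δ, h.near u hu z hz⟩)
      rw [key x hx, key y hy]
    omega
  rw [hs, ← smul_eq_mul]
  exact Finset.sum_le_card_nsmul _ _ _ fun u hu =>
    Nat.sub_le_sub_right (h.card_le u (linked_subset hu)) 1

end PhaseSpec

theorem two_le_threshold (hQ : 2 ≤ Q) (i : ℕ) : 2 ≤ threshold Q i := by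
  induction i with
  | zero => exact le_rfl
  | succ i ih => exact le_min (by nlinarith) hQ

theorem threshold_le (hQ : 2 ≤ Q) (i : ℕ) : threshold Q i ≤ Q := by
  cases i with
  | zero => exact hQ
  | succ i => exact min_le_right _ _

/-- Starting from 2, repeated squaring gives a tower of squarings until the cap `Q` takes over. -/
theorem min_le_threshold (Q i : ℕ) : min (2 ^ 2 ^ i) Q ≤ threshold Q i := by
  induction i with
  | zero => exact min_le_left _ _
  | succ i ih =>
    refine le_min ?_ (min_le_right _ _)
    rcases Nat.eq_zero_or_pos Q with rfl | hQ
    · simp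
    · rcases le_total (2 ^ 2 ^ i) Q with h | h
      · rw [min_eq_left h] at ih
        exact (min_le_left _ _).trans (by
          rw [pow_succ, pow_mul, sq]; exact Nat.mul_le_mul ih ih)
      · rw [min_eq_right h] at ih
        exact (min_le_right _ _).trans (ih.trans (Nat.le_mul_of_pos_left _ (hQ.trans_le ih)))

namespace History

variable {A : ℕ → Finset ℕ} {L : ℕ → ℕ → Finset ℕ} {M : ℕ → ℕ}

theorem card_mul_threshold_le (h : History adj T θ Q n N E A L M)
    (hadj : ∀ u v, adj u v → adj v u) (hQ : 2 ≤ Q) {i : ℕ} (hi : i + 1 < N) :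
    (A (i + 2)).card * (threshold Q i + 1) ≤ (linked adj (A (i + 1))).card :=
  (h.spec (i + 1) hi).card_mul_le hadj subset_rfl (by have := two_le_threshold hQ i; omega)
    (h.spec (i + 1) hi).thr_le

/-- Squaring the threshold costs one factor `threshold Q i`, and the passage to the next centres
gains at least that factor. The product thus never exceeds its first value, where the threshold is
2. -/
theorem card_linked_mul_threshold_le (h : History adj T θ Q n N E A L M)
    (hadj : ∀ u v, adj u v → adj v u) (hQ : 2 ≤ Q) {i : ℕ} (hi : i < N) :
    (linked adj (A (i + 1))).card * threshold Q i ≤ 2 * (linked adj (A 1)).card := by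
  induction i with
  | zero => simp [threshold, mul_comm]
  | succ i ih =>
    refine le_trans ?_ (ih (by omega))
    have h1 := h.card_mul_threshold_le hadj hQ hi
    have h2 : (linked adj (A (i + 2))).card ≤ (A (i + 2)).card :=
      Finset.card_le_card linked_subset
    calc (linked adj (A (i + 1 + 1))).card * threshold Q (i + 1)
        ≤ (A (i + 2)).card * (threshold Q i * threshold Q i) :=
          Nat.mul_le_mul h2 (min_le_left _ _)
      _ ≤ (A (i + 2)).card * (threshold Q i + 1) * threshold Q i := by
          rw [mul_assoc]
          exact Nat.mul_le_mul_left _ (Nat.mul_le_mul_right _ (Nat.le_succ _))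
      _ ≤ _ := Nat.mul_le_mul_right _ h1

/-- The first phase pays with the centres it removes; every later phase adds at most (linked
centres) times (threshold), which is bounded uniformly. -/
theorem count_le (h : History adj T θ Q n N E A L M) (hadj : ∀ u v, adj u v → adj v u)
    (hQ : 2 ≤ Q) (hM : M 0 = 0) (hN : 0 < N) {i : ℕ} (hi : i < N) :
    M (i + 1) ≤ (A 0).card + i * (2 * (linked adj (A 1)).card) := by
  induction i with
  | zero =>
    have := (h.spec 0 hN).count_zero rfl
    omega
  | succ i ih =>
    have h1 := (h.spec (i + 1) hi).count_le (by
      have := two_le_threshold hQ i; simp only [popularity]; omega)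
    have h2 := h.card_linked_mul_threshold_le hadj hQ (show i < N by omega)
    have h3 := ih (by omega)
    simp only [capacity, Nat.add_sub_cancel] at h1
    have : (i + 1) * (2 * (linked adj (A 1)).card) =
      i * (2 * (linked adj (A 1)).card) + 2 * (linked adj (A 1)).card := by ring
    omega

theorem card_mul_pow_le (h : History adj T θ Q n N E A L M) (hadj : ∀ u v, adj u v → adj v u)
    (hQ : 2 ≤ Q) (hA : ∀ i ≤ N, (A i).card ≤ n) {J : ℕ} (hJ : Q ≤ 2 ^ 2 ^ J) {j : ℕ}
    (hj : J + j + 1 ≤ N) : (A (J + j + 1)).card * Q ^ j ≤ n := by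
  induction j with
  | zero => simpa using hA _ hj
  | succ j ih =>
    have h1 := h.card_mul_threshold_le hadj hQ (i := J + j) (by omega)
    have h2 := Finset.card_le_card (linked_subset (adj := adj) (A := A (J + j + 1)))
    have h3 : Q ≤ threshold Q (J + j) := by
      refine le_trans (le_min ?_ le_rfl) (min_le_threshold Q (J + j))
      exact hJ.trans (Nat.pow_le_pow_right (by norm_num)
        (Nat.pow_le_pow_right (by norm_num) (by omega)))
    calc (A (J + (j + 1) + 1)).card * Q ^ (j + 1) = (A (J + j + 2)).card * Q * Q ^ j := by
          rw [pow_succ]; ring_nf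
      _ ≤ (A (J + j + 1)).card * Q ^ j := Nat.mul_le_mul_right _
          ((Nat.mul_le_mul_left _ (by omega)).trans (h1.trans h2))
      _ ≤ n := ih (by omega)

/-- After `Nat.clog 2 (exponent n k)` squarings the threshold is the full `2 ^ exponent n k`, and
`fullPhases n k` phases remain. The exponent is the rounded-up quotient of `bits n` by `fullPhases n
k`, so together they divide the number of centres by more than `n`. -/
theorem eq_empty (h : History adj T θ (2 ^ exponent n k) n (phaseCount n k + 1) E A L M)
    (hadj : ∀ u v, adj u v → adj v u) (hk : k ≠ 0)
    (hA : ∀ i ≤ phaseCount n k + 1, (A i).card ≤ n) : A (phaseCount n k + 1) = ∅ := by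
  have hκ : 0 < fullPhases n k := by unfold fullPhases bits; omega
  have hmul : bits n ≤ exponent n k * fullPhases n k := by
    have := Nat.lt_div_mul_add (a := bits n + fullPhases n k - 1) hκ
    unfold exponent
    omega
  have hexp : 1 ≤ exponent n k := by
    rcases Nat.eq_zero_or_pos (exponent n k) with h0 | h0
    · rw [h0] at hmul
      unfold bits at hmul
      omega
    · exact h0
  have h1 := h.card_mul_pow_le hadj (Nat.le_self_pow (by omega) 2) hA
    (J := Nat.clog 2 (exponent n k)) (j := fullPhases n k)
    (Nat.pow_le_pow_right (by norm_num) (Nat.le_pow_clog (by norm_num) _))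
    (by unfold phaseCount; omega)
  rw [← pow_mul] at h1
  have h2 : n < 2 ^ (exponent n k * fullPhases n k) :=
    (lt_two_pow_bits n).trans_le (Nat.pow_le_pow_right (by norm_num) hmul)
  rw [show phaseCount n k + 1 = Nat.clog 2 (exponent n k) + fullPhases n k + 1 by
    unfold phaseCount; omega]
  rw [← Finset.card_eq_zero]
  by_contra hne
  have := Nat.le_mul_of_pos_left (2 ^ (exponent n k * fullPhases n k)) (Nat.pos_of_ne_zero hne)
  omega

theorem subset_zero (h : History adj T θ Q n N E A L M) {i : ℕ} (hi : i ≤ N) : A i ⊆ A 0 := by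
  induction i with
  | zero => exact subset_rfl
  | succ i ih => exact (h.spec i hi).subset.trans (ih (by omega))

/-- The emulator is ultra-sparse. -/
theorem count_mul_le (h : History adj T θ Q n (ℓ + 1) E A L M) (hadj : ∀ u v, adj u v → adj v u)
    (hA : ∀ u, u ∈ A 0 ↔ ∃ v, adj u v) (hn : (A 0).card ≤ n) (hQ : 2 ≤ Q) (hT : T ≠ 0)
    (hM : M 0 = 0) : M (ℓ + 1) * T ≤ n * T + 2 * ℓ * n := by
  have h1 := h.count_le hadj hQ hM (Nat.succ_pos ℓ) (Nat.lt_succ_self ℓ)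
  have h2 := (h.spec 0 (Nat.succ_pos ℓ)).card_linked_mul_le hT hadj hA
  calc M (ℓ + 1) * T ≤ ((A 0).card + ℓ * (2 * (linked adj (A 1)).card)) * T :=
        Nat.mul_le_mul_right _ h1
    _ = (A 0).card * T + 2 * ℓ * ((linked adj (A 1)).card * T) := by ring
    _ ≤ n * T + 2 * ℓ * n := by
        refine Nat.add_le_add (Nat.mul_le_mul_right _ hn) (Nat.mul_le_mul_left _ ?_)
        exact (Nat.mul_le_mul_left _ (Nat.le_succ T)).trans (h2.trans hn)

end History

end

/-! ### The stretch -/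

/-- There is a walk from `u` to `v` of total weight at most `x`; `E u v w` says that there is an
edge of weight at most `w` between `u` and `v`. -/
inductive Route {V : Type*} (E : V → V → ℕ → Prop) (u : V) : V → ℕ → Prop where
  | nil (x : ℕ) : Route E u u x
  | cons {v w : V} {x y z : ℕ} (h : Route E u v x) (he : E v w y) (hz : x + y ≤ z) : Route E u w z

namespace Route

variable {V : Type*} {E : V → V → ℕ → Prop} {u v w : V} {x y : ℕ}

theorem mono (h : Route E u v x) (hxy : x ≤ y) : Route E u v y := by
  cases h with
  | nil => exact nil y
  | cons h he hz => exact cons h he (hz.trans hxy)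

theorem of_edge (h : E u v x) : Route E u v x := cons (nil 0) h (by omega)

theorem trans (h : Route E u v x) (h' : Route E v w y) : Route E u w (x + y) := by
  induction h' with
  | nil y => exact h.mono (Nat.le_add_right _ _)
  | cons _ he hz ih => exact cons ih he (by omega)

theorem symm (hE : ∀ u v w, E u v w → E v u w) (h : Route E u v x) : Route E v u x := by
  induction h with
  | nil => exact nil _
  | cons _ he hz ih => exact ((of_edge (hE _ _ _ he)).trans ih).mono (by omega)

theorem near {adj : V → V → Prop} (hE : ∀ u v w, E u v w → Near adj w u v) (h : Route E u v x) :
    Near adj x u v := by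
  induction h with
  | nil => exact Near.refl _ _ _
  | cons _ he hz ih => exact (ih.trans (hE _ _ _ he)).mono hz

end Route

/-- The vertex `z` has centres of all levels up to `i` close to it. -/
def Level (E : ℕ → ℕ → ℕ → Prop) (B : ℕ → Finset ℕ) (ρ : ℕ → ℕ) (i z : ℕ) : Prop :=
  ∀ j ≤ i, ∃ p ∈ B j, Route E z p (ρ j)

/-- The hierarchies of centres for which the stretch is bounded: a centre without a centre of the
next level nearby has exact edges to the centres at distance at most `D i`. -/
structure Hierarchy (adj : ℕ → ℕ → Prop) (E : ℕ → ℕ → ℕ → Prop) (B : ℕ → Finset ℕ)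
    (ρ D β : ℕ → ℕ) (N ℓ : ℕ) : Prop where
  adj_symm : ∀ u v, adj u v → adj v u
  symm : ∀ u v w, E u v w → E v u w
  near : ∀ u v w, E u v w → Near adj w u v
  alt : ∀ i < ℓ, ∀ u ∈ B i, u ∈ B (i + 1) ∨ (∃ q ∈ B (i + 1), Route E u q (2 * D i)) ∨
    ∀ x ∈ B i, ∀ e ≤ D i, Near adj e u x → Route E u x e
  radius : ∀ i < ℓ, ρ i + 2 * D i ≤ ρ (i + 1)
  stretch : ∀ i < ℓ, 2 * β i + 12 * ρ i ≤ β (i + 1)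
  distance : ∀ i < ℓ, N * (12 * ρ i + β i) + 2 * ρ i + 1 ≤ D i

namespace Hierarchy

variable {adj : ℕ → ℕ → Prop} {E : ℕ → ℕ → ℕ → Prop} {B : ℕ → Finset ℕ} {ρ D β : ℕ → ℕ}
  {N ℓ i d a b c m u v : ℕ} {z : ℕ → ℕ}

/-- The centre `p` of generation `i` near `u` was neither promoted nor attached, since otherwise `u`
would have level `i + 1`. So `p` has exact connections, in particular to the centre `q` near `v`, at
distance at most `d + 2 * ρ i`; the two ends add `ρ i` each. -/
theorem route_of_level (h : Hierarchy adj E B ρ D β N ℓ) (hi : i < ℓ) (hu : Level E B ρ i u)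
    (hv : Level E B ρ i v) (hu' : ¬ Level E B ρ (i + 1) u) (hn : Near adj d u v)
    (hd : d + 2 * ρ i ≤ D i) : Route E u v (d + 4 * ρ i) := by
  obtain ⟨p, hp, hup⟩ := hu i le_rfl
  obtain ⟨q, hq, hvq⟩ := hv i le_rfl
  have hr := h.radius i hi
  have hlev : ∀ q ∈ B (i + 1), Route E u q (ρ (i + 1)) → Level E B ρ (i + 1) u := by
    intro q hq huq j hj
    rcases Nat.lt_or_ge i j with hij | hij
    · obtain rfl : j = i + 1 := by omega
      exact ⟨q, hq, huq⟩
    · exact hu j hij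
  rcases h.alt i hi p hp with h1 | ⟨x, hx, h1⟩ | h1
  · exact absurd (hlev p h1 (hup.mono (by omega))) hu'
  · exact absurd (hlev x hx ((hup.trans h1).mono hr)) hu'
  · have hpu := hup.symm h.symm
    have hnear := ((hpu.near h.near).trans hn).trans (hvq.near h.near)
    have hpq := h1 q hq (ρ i + d + ρ i) (by omega) hnear
    exact ((hup.trans hpq).trans (hvq.symm h.symm)).mono (by omega)

theorem radius_mono (h : Hierarchy adj E B ρ D β N ℓ) (hi : i < ℓ) : ρ i ≤ ρ (i + 1) := by
  have := h.radius i hi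
  omega

/-- One looks for a level that both ends have while one of them lacks the next; such a level exists
between 0 and `i`, and the radii increase, so the detour at level `i` bounds the one found. -/
theorem route_of_adj (h : Hierarchy adj E B ρ D β N ℓ) (hi : i < ℓ) (hu : Level E B ρ 0 u)
    (hv : Level E B ρ 0 v) (ha : adj u v)
    (huv : ¬ Level E B ρ (i + 1) u ∨ ¬ Level E B ρ (i + 1) v) : Route E u v (4 * ρ i + 1) := by
  have pair : ∀ i < ℓ, Level E B ρ i u → Level E B ρ i v →
      (¬ Level E B ρ (i + 1) u ∨ ¬ Level E B ρ (i + 1) v) → Route E u v (4 * ρ i + 1) := by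
    intro i hi hu hv huv
    have hd := h.distance i hi
    rcases huv with hu' | hv'
    · exact (h.route_of_level hi hu hv hu' (Near.of_adj ha) (by omega)).mono (by omega)
    · exact ((h.route_of_level hi hv hu hv' (Near.of_adj (h.adj_symm _ _ ha))
        (by omega)).symm h.symm).mono (by omega)
  induction i with
  | zero => exact pair 0 hi hu hv huv
  | succ i ih =>
    by_cases hb : Level E B ρ (i + 1) u ∧ Level E B ρ (i + 1) v
    · exact pair _ hi hb.1 hb.2 huv
    · have := h.radius_mono (i := i) (by omega)
      exact (ih (by omega) (not_and_or.1 hb)).mono (by omega)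

theorem near_walk (hz : ∀ j < m, adj (z j) (z (j + 1))) (hab : a ≤ b) (hb : b ≤ m) :
    Near adj (b - a) (z a) (z b) := by
  induction b, hab using Nat.le_induction with
  | base => exact Near.refl _ _ _
  | succ b hab ih =>
    exact ((ih (by omega)).step (hz b (by omega))).mono (by omega)

/-- The bound for walks without vertices of level `i`. -/
def Bound (E : ℕ → ℕ → ℕ → Prop) (B : ℕ → Finset ℕ) (ρ β : ℕ → ℕ) (N m : ℕ) (z : ℕ → ℕ)
    (i : ℕ) : Prop :=
  ∀ a b, a ≤ b → b ≤ m → (∀ j, a ≤ j → j ≤ b → ¬ Level E B ρ i (z j)) →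
    ∃ x, Route E (z a) (z b) x ∧ N * x ≤ (N + i) * (b - a) + N * β i

/-- The first edge leaves a vertex that may have level `i` and costs a detour `4 * ρ i`; the rest of
the walk is below level `i`. The unit in the cost of the edge is paid by its length. -/
theorem Bound.tail (hc : Bound E B ρ β N m z i) (h : Hierarchy adj E B ρ D β N ℓ) (hi : i < ℓ)
    (hz : ∀ j < m, adj (z j) (z (j + 1))) (h0 : ∀ j ≤ m, Level E B ρ 0 (z j)) (hab : a < b)
    (hb : b ≤ m) (hlow : ∀ j, a < j → j ≤ b → ¬ Level E B ρ i (z j))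
    (ha : ¬ Level E B ρ (i + 1) (z a)) :
    ∃ x, Route E (z a) (z b) x ∧ N * x ≤ (N + i) * (b - a) + N * (4 * ρ i + β i) := by
  obtain ⟨x, hx, hNx⟩ := hc (a + 1) b hab hb fun j hj hj' => hlow j hj hj'
  refine ⟨_, (h.route_of_adj hi (h0 a (by omega)) (h0 _ (by omega)) (hz a (by omega))
    (Or.inl ha)).trans hx, ?_⟩
  obtain ⟨e, rfl⟩ := Nat.exists_eq_add_of_le hab
  rw [show a + 1 + e - (a + 1) = e by omega] at hNx
  rw [show a.succ + e - a = e + 1 by omega]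
  nlinarith

/-- As for `Bound.tail`, with a second detour for the edge that enters the right end. -/
theorem Bound.gap (hc : Bound E B ρ β N m z i) (h : Hierarchy adj E B ρ D β N ℓ) (hi : i < ℓ)
    (hz : ∀ j < m, adj (z j) (z (j + 1))) (h0 : ∀ j ≤ m, Level E B ρ 0 (z j)) (hab : a < b)
    (hb : b ≤ m) (hlow : ∀ j, a < j → j < b → ¬ Level E B ρ i (z j))
    (ha : ¬ Level E B ρ (i + 1) (z a)) (hb' : ¬ Level E B ρ (i + 1) (z b)) :
    ∃ x, Route E (z a) (z b) x ∧ N * x ≤ (N + i) * (b - a) + N * (8 * ρ i + β i) := by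
  obtain ⟨b, rfl⟩ : ∃ b', b = b' + 1 := ⟨b - 1, by omega⟩
  have hlast := h.route_of_adj hi (h0 b (by omega)) (h0 _ hb) (hz b (by omega)) (Or.inr hb')
  rcases (Nat.lt_succ_iff.1 hab).eq_or_lt with rfl | hab
  · refine ⟨_, hlast, ?_⟩
    rw [Nat.add_sub_cancel_left]
    nlinarith
  · obtain ⟨x, hx, hNx⟩ := hc.tail h hi hz h0 hab (by omega)
      (fun j hj hj' => hlow j hj (by omega)) ha
    refine ⟨_, hx.trans hlast, ?_⟩
    obtain ⟨e, rfl⟩ := Nat.exists_eq_add_of_le hab.le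
    rw [Nat.add_sub_cancel_left] at hNx
    rw [show a + e + 1 - a = e + 1 by omega]
    nlinarith

/-- Greedy jumps: from a vertex of level `i`, go to the last vertex of level `i` that is in reach of
the exact edges, then over the gap to the next one. The jump and the gap lose `12 * ρ i + β i`, but
the next vertex was out of reach, so more than `N` times this loss has been covered; the loss raises
the multiplicative part from `N + i` to `N + i + 1`. Only the last stretch leaves an additive term.
-/
theorem Bound.start (hc : Bound E B ρ β N m z i) (h : Hierarchy adj E B ρ D β N ℓ) (hi : i < ℓ)
    (hz : ∀ j < m, adj (z j) (z (j + 1))) (h0 : ∀ j ≤ m, Level E B ρ 0 (z j)) (hb : b ≤ m)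
    (hlow : ∀ j, j ≤ b → a ≤ j → ¬ Level E B ρ (i + 1) (z j)) (hab : a ≤ b)
    (ha : Level E B ρ i (z a)) :
    ∃ x, Route E (z a) (z b) x ∧ N * x ≤ (N + i + 1) * (b - a) + N * (8 * ρ i + β i) := by
  classical
  induction hk : b - a using Nat.strong_induction_on generalizing a with
  | _ k ih =>
  have hdist := h.distance i hi
  -- The farthest vertex of level `i` in reach; `a` itself is a candidate because `2 * ρ i ≤ D i`.
  obtain ⟨b', ⟨hab', hb'b, hb'S, hb'⟩, hmax⟩ : ∃ b', (a ≤ b' ∧ b' ≤ b ∧ b' - a + 2 * ρ i ≤ D i ∧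
      Level E B ρ i (z b')) ∧ ∀ j, b' < j → j ≤ b → j - a + 2 * ρ i ≤ D i →
      ¬ Level E B ρ i (z j) := by
    let P := fun b' => a ≤ b' ∧ b' ≤ b ∧ b' - a + 2 * ρ i ≤ D i ∧ Level E B ρ i (z b')
    have hP : P (Nat.findGreatest P b) := Nat.findGreatest_spec (P := P) hab
      ⟨le_rfl, hab, by omega, ha⟩
    exact ⟨_, hP, fun j hj hjb hjS hl => Nat.findGreatest_is_greatest (P := P) hj hjb
      ⟨hP.1.trans hj.le, hjb, hjS, hl⟩⟩
  have h1 := h.route_of_level hi ha hb' (hlow a hab le_rfl)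
    (near_walk hz hab' (hb'b.trans hb)) hb'S
  obtain ⟨e, rfl⟩ := Nat.exists_eq_add_of_le hab'
  rw [Nat.add_sub_cancel_left] at h1 hb'S
  by_cases hex : ∃ c, a + e < c ∧ c ≤ b ∧ Level E B ρ i (z c)
  · obtain ⟨hc1, hc2, hc3⟩ := Nat.find_spec hex
    have hmin : ∀ j, a + e < j → j < Nat.find hex → ¬ Level E B ρ i (z j) := fun j hj hjc hl =>
      Nat.find_min hex hjc ⟨hj, by omega, hl⟩
    generalize Nat.find hex = c at hc1 hc2 hc3 hmin
    -- By maximality of the jump, the next vertex of level `i` is out of reach, and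
    -- `Hierarchy.distance` turns this into payment for the loss.
    have hcS : ¬ (c - a + 2 * ρ i ≤ D i) := fun hS => hmax c hc1 hc2 hS hc3
    obtain ⟨x, hx, hNx⟩ := hc.gap h hi hz h0 hc1 (hc2.trans hb) hmin
      (hlow _ hb'b hab') (hlow _ hc2 (by omega))
    obtain ⟨y, hy, hNy⟩ := ih (b - c) (by omega) (fun j hj hj' => hlow j hj (by omega)) hc2 hc3 rfl
    refine ⟨_, (h1.trans hx).trans hy, ?_⟩
    obtain ⟨f, rfl⟩ := Nat.exists_eq_add_of_le hc1.le
    obtain ⟨g, rfl⟩ := Nat.exists_eq_add_of_le hc2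
    rw [Nat.add_sub_cancel_left] at hNx hNy
    rw [show a + e + f - a = e + f by omega] at hcS
    rw [show k = e + f + g by omega]
    nlinarith
  · push Not at hex
    rcases hb'b.eq_or_lt with hbe | hlt
    · rw [hbe] at h1
      refine ⟨_, h1, ?_⟩
      rw [show k = e by omega]
      nlinarith [Nat.zero_le (i * e), Nat.zero_le (N * ρ i), Nat.zero_le (N * β i)]
    · obtain ⟨x, hx, hNx⟩ := hc.tail h hi hz h0 hlt hb (fun j hj hj' => hex j hj hj')
        (hlow _ hb'b hab')
      refine ⟨_, h1.trans hx, ?_⟩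
      obtain ⟨f, rfl⟩ := Nat.exists_eq_add_of_le hlt.le
      rw [Nat.add_sub_cancel_left] at hNx
      rw [show k = e + f by omega]
      nlinarith [Nat.zero_le (i * e)]

/-- The piece before the first vertex of level `i` costs `β i`, the edge into that vertex `4 * ρ i`,
and the rest `8 * ρ i + β i`. This is the origin of the recursion in `Hierarchy.stretch`. -/
theorem Bound.succ (hc : Bound E B ρ β N m z i) (h : Hierarchy adj E B ρ D β N ℓ) (hi : i < ℓ)
    (hz : ∀ j < m, adj (z j) (z (j + 1))) (h0 : ∀ j ≤ m, Level E B ρ 0 (z j)) :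
    Bound E B ρ β N m z (i + 1) := by
  classical
  intro a b hab hb hlow
  have hβ : N * (2 * β i + 12 * ρ i) ≤ N * β (i + 1) := Nat.mul_le_mul_left _ (h.stretch i hi)
  by_cases hex : ∃ c, a ≤ c ∧ c ≤ b ∧ Level E B ρ i (z c)
  · obtain ⟨hc1, hc2, hc3⟩ := Nat.find_spec hex
    have hmin : ∀ j, a ≤ j → j < Nat.find hex → ¬ Level E B ρ i (z j) := fun j hj hjc hl =>
      Nat.find_min hex hjc ⟨hj, by omega, hl⟩
    generalize Nat.find hex = c at hc1 hc2 hc3 hmin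
    obtain ⟨y, hy, hNy⟩ := hc.start h hi hz h0 hb (fun j hj hj' => hlow j (by omega) hj) hc2 hc3
    rcases hc1.eq_or_lt with rfl | hlt
    · refine ⟨y, hy, ?_⟩
      nlinarith [Nat.zero_le (N * ρ i), Nat.zero_le (N * β i)]
    · obtain ⟨c, rfl⟩ : ∃ c', c = c' + 1 := ⟨c - 1, by omega⟩
      obtain ⟨x, hx, hNx⟩ := hc a c (by omega) (by omega) fun j hj hj' => hmin j hj (by omega)
      refine ⟨_, (hx.trans (h.route_of_adj hi (h0 c (by omega)) (h0 _ (by omega))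
        (hz c (by omega)) (Or.inl (hlow c (by omega) (by omega))))).trans hy, ?_⟩
      obtain ⟨f, rfl⟩ := Nat.exists_eq_add_of_le (Nat.lt_succ_iff.1 hlt)
      obtain ⟨g, rfl⟩ := Nat.exists_eq_add_of_le hc2
      rw [Nat.add_sub_cancel_left] at hNx hNy
      rw [show a + f + 1 + g - a = f + 1 + g by omega]
      nlinarith
  · push Not at hex
    obtain ⟨x, hx, hNx⟩ := hc a b hab hb fun j hj hj' => hex j hj hj'
    refine ⟨x, hx, ?_⟩
    nlinarith [Nat.zero_le (N * ρ i), Nat.zero_le (N * β i), Nat.zero_le (b - a)]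

/-- A walk of length `m` is stretched to at most `(1 + ℓ / N) m + β ℓ`. -/
theorem exists_route (h : Hierarchy adj E B ρ D β N ℓ) (hℓ : B ℓ = ∅)
    (hz : ∀ j < m, adj (z j) (z (j + 1))) (h0 : ∀ j ≤ m, Level E B ρ 0 (z j)) :
    ∃ x, Route E (z 0) (z m) x ∧ N * x ≤ (N + ℓ) * m + N * β ℓ := by
  have key : ∀ i ≤ ℓ, Bound E B ρ β N m z i := by
    intro i
    induction i with
    | zero => exact fun _ a b hab hb hlow => absurd (h0 a (by omega)) (hlow a le_rfl hab)
    | succ i ih => exact fun hi => (ih (by omega)).succ h hi hz h0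
  refine key ℓ le_rfl 0 m (Nat.zero_le _) le_rfl fun j _ _ hl => ?_
  obtain ⟨p, hp, -⟩ := hl ℓ le_rfl
  simp [hℓ] at hp

end Hierarchy

/-! ### From the history of the phases to a hierarchy of centres -/

section

variable {adj : ℕ → ℕ → Prop} {T θ Q n N ℓ i m : ℕ} {E : ℕ → ℕ → ℕ → Prop} {A : ℕ → Finset ℕ}
  {L : ℕ → ℕ → Finset ℕ} {M : ℕ → ℕ} {z : ℕ → ℕ}

theorem radius_le (i : ℕ) : radius T θ n i ≤ T * θ ^ i := by
  induction i with
  | zero => simp [radius]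
  | succ i ih =>
    refine (min_le_left _ _).trans ?_
    rw [pow_succ, ← mul_assoc]
    exact Nat.mul_le_mul_right _ ih

/-- The cut-off, which keeps radii small enough for a word, takes effect only when the radius
already spans every component. -/
theorem radius_eq_or_le (hθ : 1 ≤ θ) (i : ℕ) : radius T θ n i = T * θ ^ i ∨ n ≤ radius T θ n i := by
  induction i with
  | zero => simp [radius]
  | succ i ih =>
    rcases le_total (radius T θ n i * θ) n with h | h
    · rcases ih with h1 | h1
      · left
        rw [radius, min_eq_left h, h1]
        ring
      · right
        exact le_min (h1.trans (Nat.le_mul_of_pos_right _ hθ)) le_rfl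
    · exact Or.inr (le_min h le_rfl)

/-- The hierarchy starts with the survivors of the first phase, hence the index shift, and uses the
radii without the cut-off. With y = Tθ^i the conditions read 4y + 208Ny ≤ 416Ny, 50y ≤ 104Ny and
49Ny + 8y + 1 ≤ 104Ny, which the factor 104 satisfies with room to spare. -/
theorem History.hierarchy (h : History adj T θ Q n (ℓ + 1) E A L M) (hN : N ≠ 0) (hT : T ≠ 0)
    (hθ : θ = 104 * N) (hadj : ∀ u v, adj u v → adj v u) (hlt : ∀ u v, adj u v → u < n ∧ v < n)
    (hA : ∀ u ∈ A 0, u < n) (hsymm : ∀ u v w, E u v w → E v u w)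
    (hnear : ∀ u v w, E u v w → Near adj w u v) (hmono : ∀ u v w w', E u v w → w ≤ w' → E u v w') :
    Hierarchy adj E (fun i => A (i + 1)) (fun i => 4 * (T * θ ^ i)) (fun i => T * θ ^ (i + 1))
      (fun i => T * θ ^ i) N ℓ where
  adj_symm := hadj
  symm := hsymm
  near := hnear
  alt i hi u hu := by
    have hr := radius_le (T := T) (θ := θ) (n := n) (i + 1)
    rcases (h.spec (i + 1) (by omega)).alt u hu with h1 | ⟨q, hq, h1⟩ | ⟨-, h1⟩
    · exact Or.inl h1
    · exact Or.inr (Or.inl ⟨q, hq, Route.of_edge (hmono _ _ _ _ h1 (by omega))⟩)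
    · refine Or.inr (Or.inr fun x hx e he hn => ?_)
      rcases eq_or_ne x u with rfl | hxu
      · exact Route.nil _
      -- If `e` exceeds the actual radius, the cut-off was at work; a ball of radius `n` is a whole
      -- component, so the centre `x` was found all the same.
      rcases Nat.lt_or_ge (radius T θ n (i + 1)) e with hlt' | hge
      · have hn' : n ≤ radius T θ n (i + 1) := by
          rcases radius_eq_or_le (T := T) (θ := θ) (n := n) (by omega) (i + 1) with h2 | h2
          · omega
          · exact h2
        have hx0 := hA x (h.subset_zero (by omega) hx)
        have := Near.of_ball_le (S := Finset.range n) (p := x)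
          (fun v hv => Finset.mem_range.2 (hv.invariant (S := fun v => v < n)
            (fun _ _ h _ => (hlt _ _ h).2) hx0))
          (by simpa using hn') (hn.symm hadj)
        exact (Route.of_edge (h1 x hx hxu _ le_rfl this)).mono hlt'.le
      · exact Route.of_edge (h1 x hx hxu e hge (hn.symm hadj))
  radius i _ := by
    have h1 : T * θ ^ (i + 1) = 104 * (N * (T * θ ^ i)) := by rw [pow_succ, hθ]; ring
    have h2 : 1 * (T * θ ^ i) ≤ N * (T * θ ^ i) := Nat.mul_le_mul_right _ (by omega)
    simp only [h1]
    linarith [Nat.zero_le (T * θ ^ i)]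
  stretch i _ := by
    have h1 : T * θ ^ (i + 1) = 104 * (N * (T * θ ^ i)) := by rw [pow_succ, hθ]; ring
    have h2 : 1 * (T * θ ^ i) ≤ N * (T * θ ^ i) := Nat.mul_le_mul_right _ (by omega)
    simp only [h1]
    linarith [Nat.zero_le (T * θ ^ i)]
  distance i _ := by
    have h1 : T * θ ^ (i + 1) = 104 * (N * (T * θ ^ i)) := by rw [pow_succ, hθ]; ring
    have h2 : 1 * (T * θ ^ i) ≤ N * (T * θ ^ i) := Nat.mul_le_mul_right _ (by omega)
    have h3 : 1 ≤ T * θ ^ i :=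
      Nat.one_le_iff_ne_zero.2 (Nat.mul_ne_zero hT (pow_ne_zero _ (by omega)))
    simp only [h1]
    nlinarith

/-- The vertices of a nonempty walk are not isolated, so they are centres of the first phase. There
every centre is popular, so each has a survivor within `2 * T`, which gives level 0 along the whole
walk. -/
theorem History.exists_route (h : History adj T θ Q n (ℓ + 1) E A L M) (hN : N ≠ 0) (hT : T ≠ 0)
    (hθ : θ = 104 * N) (hadj : ∀ u v, adj u v → adj v u) (hlt : ∀ u v, adj u v → u < n ∧ v < n)
    (hA : ∀ u, u ∈ A 0 ↔ ∃ v, adj u v) (hsymm : ∀ u v w, E u v w → E v u w)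
    (hnear : ∀ u v w, E u v w → Near adj w u v) (hmono : ∀ u v w w', E u v w → w ≤ w' → E u v w')
    (hempty : A (ℓ + 1) = ∅) (hz : ∀ j < m, adj (z j) (z (j + 1))) :
    ∃ x, Route E (z 0) (z m) x ∧ N * x ≤ (N + ℓ) * m + N * (T * θ ^ ℓ) := by
  -- A walk of length zero may sit at an isolated vertex, which is no centre.
  rcases Nat.eq_zero_or_pos m with rfl | hm
  · exact ⟨0, Route.nil _, by simp⟩
  refine (h.hierarchy hN hT hθ hadj hlt (fun u hu => ?_) hsymm hnear hmono).exists_route hempty hz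
    fun j hj i hi => ?_
  · obtain ⟨v, hv⟩ := (hA u).1 hu
    exact (hlt _ _ hv).1
  obtain rfl : i = 0 := by omega
  have hj0 : z j ∈ A 0 := by
    refine (hA _).2 ?_
    rcases hj.eq_or_lt with rfl | hj
    · exact ⟨z (j - 1), hadj _ _ (by simpa [Nat.sub_add_cancel hm] using hz (j - 1) (by omega))⟩
    · exact ⟨_, hz j hj⟩
  rcases (h.spec 0 (Nat.succ_pos _)).alt _ hj0 with h1 | ⟨q, hq, h1⟩ | ⟨h1, -⟩
  · exact ⟨_, h1, Route.nil _⟩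
  · exact ⟨q, hq, Route.of_edge (hmono _ _ _ _ h1 (by simp [radius]; omega))⟩
  · simp [popularity] at h1

end

/-! ### The emulator -/

section

variable {n r u v : ℕ} {G : SimpleGraph (Fin n)}

theorem natAdj_lt (h : natAdj G u v) : u < n ∧ v < n := ⟨h.1, h.2.1⟩

theorem Near.edist_le {u v : Fin n} (h : Near (natAdj G) r u v) : G.edist u v ≤ r := by
  induction r generalizing v with
  | zero =>
    obtain rfl : u = v := Fin.ext h
    simp
  | succ r ih =>
    rcases h with h | ⟨w, hw, hwn, hv, ha⟩
    · exact (ih h).trans (by exact_mod_cast Nat.le_succ r)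
    · refine (SimpleGraph.edist_triangle (v := ⟨w, hwn⟩)).trans ?_
      rw [Nat.cast_add]
      exact add_le_add (ih hw) (by simpa using (SimpleGraph.edist_eq_one_iff_adj.2 ha).le)

end

namespace Ram

/-- The weighted graph that is listed in the output arrays. -/
noncomputable def outputGraph (n : ℕ) (s : Store) : WeightedGraph (Fin n) where
  graph :=
    { Adj := fun u v => u ≠ v ∧ ∃ j < s.var 4, s(s.arr 2 j, s.arr 3 j) = s((u : ℕ), (v : ℕ))
      symm := ⟨fun _ _ h => ⟨h.1.symm, h.2.imp fun _ hj => ⟨hj.1, hj.2.trans Sym2.eq_swap⟩⟩⟩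
      loopless := ⟨fun _ h => h.1 rfl⟩ }
  weight e := sInf {w | ∃ j < s.var 4, s(s.arr 2 j, s.arr 3 j) = e.map Fin.val ∧ w = s.arr 4 j}

theorem outputGraph_adj {n : ℕ} {s : Store} {u v : Fin n} : (outputGraph n s).graph.Adj u v ↔
    u ≠ v ∧ ∃ j < s.var 4, s(s.arr 2 j, s.arr 3 j) = s((u : ℕ), (v : ℕ)) := Iff.rfl

namespace OutInv

variable {n W j j' : ℕ} {s : Store} {adj : ℕ → ℕ → Prop} {G : SimpleGraph (Fin n)}

theorem eq_of_edge (h : OutInv adj n W s) (hj : j < s.var 4) (hj' : j' < s.var 4)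
    (he : s(s.arr 2 j, s.arr 3 j) = s(s.arr 2 j', s.arr 3 j')) : j = j' := by
  have h1 := h.index j hj
  have h2 := h.index j' hj'
  rcases Sym2.eq_iff.1 he with ⟨e2, e3⟩ | ⟨e2, e3⟩ <;> rw [e2, e3] at h1 <;> omega

/-- Every edge is listed once, so the infimum in the definition of the weight is over a singleton.
-/
theorem weight_eq (h : OutInv adj n W s) (hj : j < s.var 4) {u v : Fin n}
    (he : s(s.arr 2 j, s.arr 3 j) = s((u : ℕ), (v : ℕ))) :
    (outputGraph n s).weight s(u, v) = s.arr 4 j := by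
  have : {w | ∃ j < s.var 4, s(s.arr 2 j, s.arr 3 j) = (s(u, v)).map Fin.val ∧ w = s.arr 4 j} =
      {s.arr 4 j} := by
    ext w
    constructor
    · rintro ⟨j', hj', he', rfl⟩
      rw [h.eq_of_edge hj' hj (he'.trans he.symm)]
      rfl
    · rintro rfl
      exact ⟨j, hj, he, rfl⟩
  exact (congrArg sInf this).trans (csInf_singleton _)

theorem outputs (h : OutInv adj n W s) : Outputs s (s.var 4) (outputGraph n s) := by
  refine ⟨rfl, fun j hj => ?_, ?_⟩
  · obtain ⟨h2, h3, hne⟩ := h.lt j hj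
    exact ⟨⟨_, h2⟩, ⟨_, h3⟩, ⟨fun he => hne (congrArg Fin.val he), j, hj, rfl⟩, rfl, rfl,
      (h.weight_eq hj rfl).symm⟩
  · rintro u v ⟨-, j, hj, he⟩
    exact ⟨j, hj, Sym2.eq_iff.1 he⟩

theorem ncard_edgeSet_le (h : OutInv adj n W s) :
    (outputGraph n s).graph.edgeSet.ncard ≤ s.var 4 := by
  let f : Fin (s.var 4) → Sym2 (Fin n) := fun j =>
    s(⟨s.arr 2 j, (h.lt j j.2).1⟩, ⟨s.arr 3 j, (h.lt j j.2).2.1⟩)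
  have hsub : (outputGraph n s).graph.edgeSet ⊆ f '' Set.univ := by
    intro e
    induction e with
    | _ u v =>
      rintro ⟨-, j, hj, he⟩
      refine ⟨⟨j, hj⟩, trivial, ?_⟩
      rcases Sym2.eq_iff.1 he with ⟨e2, e3⟩ | ⟨e2, e3⟩
      · exact Sym2.eq_iff.2 (Or.inl ⟨Fin.ext e2, Fin.ext e3⟩)
      · exact Sym2.eq_iff.2 (Or.inr ⟨Fin.ext e2, Fin.ext e3⟩)
  calc _ ≤ (f '' Set.univ).ncard := Set.ncard_le_ncard hsub
    _ ≤ (Set.univ : Set (Fin (s.var 4))).ncard := Set.ncard_image_le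
    _ = s.var 4 := by simp [Set.ncard_univ]

/-- Every weight is the length of an upper-bounding walk in `G`; the triangle inequality sums them
along a walk. -/
theorem edist_le_dist (h : OutInv (natAdj G) n W s) (u v : Fin n) :
    G.edist u v ≤ (outputGraph n s).dist u v := by
  refine le_iInf fun p => ?_
  induction p with
  | nil => simp
  | @cons u v w ha p ih =>
    obtain ⟨-, j, hj, he⟩ := outputGraph_adj.1 ha
    refine (SimpleGraph.edist_triangle (v := v)).trans ?_
    rw [SimpleGraph.Walk.edges_cons, List.map_cons, List.sum_cons, Nat.cast_add,
      h.weight_eq hj he]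
    refine add_le_add (Near.edist_le ?_) ih
    have hn := (h.near j hj).1
    rcases Sym2.eq_iff.1 he with ⟨e2, e3⟩ | ⟨e2, e3⟩
    · rwa [e2, e3] at hn
    · rw [e2, e3] at hn
      exact hn.symm (natAdj_symm G)

end OutInv

/-- Edges between vertices below `n`. -/
def ListedEdge (n : ℕ) (s : Store) (u v w : ℕ) : Prop := u < n ∧ v < n ∧ HasEdge n s u v w

section

variable {n W u v w x T θ Q N ℓ : ℕ} {s : Store} {adj : ℕ → ℕ → Prop} {G : SimpleGraph (Fin n)}
  {A : ℕ → Finset ℕ} {L : ℕ → ℕ → Finset ℕ} {M : ℕ → ℕ}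

theorem ListedEdge.exists_index (h : OutInv adj n W s) (he : ListedEdge n s u v w) :
    ∃ j < s.var 4, s(s.arr 2 j, s.arr 3 j) = s(u, v) ∧ s.arr 4 j ≤ w := by
  obtain ⟨hu, hv, h0, hw⟩ := he
  obtain ⟨hj, hc⟩ := h.found u hu v hv h0
  exact ⟨_, hj, Sym2.eq_iff.2 hc, hw⟩

theorem ListedEdge.near (h : OutInv adj n W s) (hadj : ∀ u v, adj u v → adj v u)
    (he : ListedEdge n s u v w) : Near adj w u v := by
  obtain ⟨j, hj, he, hw⟩ := he.exists_index h
  have hn := (h.near j hj).1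
  rcases Sym2.eq_iff.1 he with ⟨e2, e3⟩ | ⟨e2, e3⟩
  · rw [e2, e3] at hn
    exact hn.mono hw
  · rw [e2, e3] at hn
    exact (hn.symm hadj).mono hw

theorem OutInv.dist_le (h : OutInv adj n W s) {u : Fin n} (hr : Route (ListedEdge n s) u v x)
    (hv : v < n) : (outputGraph n s).dist u ⟨v, hv⟩ ≤ x := by
  suffices ∃ p : (outputGraph n s).graph.Walk u ⟨v, hv⟩,
      (p.edges.map (outputGraph n s).weight).sum ≤ x by
    obtain ⟨p, hp⟩ := this
    exact (iInf_le _ p).trans (by exact_mod_cast hp)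
  induction hr with
  | nil => exact ⟨SimpleGraph.Walk.nil, by simp⟩
  | @cons v w x y z _ he hz ih =>
    obtain ⟨p, hp⟩ := ih he.1
    obtain ⟨j, hj, hjvw, hw⟩ := he.exists_index h
    have hne : v ≠ w := by
      rintro rfl
      have := (h.lt j hj).2.2
      rcases Sym2.eq_iff.1 hjvw with ⟨e2, e3⟩ | ⟨e2, e3⟩ <;> omega
    have ha : (outputGraph n s).graph.Adj ⟨v, he.1⟩ ⟨w, hv⟩ :=
      outputGraph_adj.2 ⟨fun he => hne (congrArg Fin.val he), j, hj, hjvw⟩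
    refine ⟨p.concat ha, ?_⟩
    rw [SimpleGraph.Walk.edges_concat, List.concat_eq_append, List.map_append, List.sum_append]
    simp only [List.map_cons, List.map_nil, List.sum_singleton]
    rw [h.weight_eq hj hjvw]
    omega

theorem _root_.History.listedEdge (h : History adj T θ Q n N (HasEdge n s) A L M)
    (hA : ∀ u ∈ A 0, u < n) : History adj T θ Q n N (ListedEdge n s) A L M :=
  ⟨fun i hi => (h.spec i hi).mono fun u hu v hv _ he =>
    ⟨hA u (h.subset_zero hi.le hu), hA v (h.subset_zero hi.le hv), he⟩⟩

/-- The stretch bound is applied to a shortest walk, and `ℓ ≤ ε * N` makes the relative error at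
most `ε`. Vertices in different components need only the lower bound. -/
theorem isEmulator (hout : OutInv (natAdj G) n W s)
    (h : History (natAdj G) T θ Q n (ℓ + 1) (HasEdge n s) A L M) (hN : N ≠ 0) (hT : T ≠ 0)
    (hθ : θ = 104 * N) (hA : ∀ u, u ∈ A 0 ↔ ∃ v, natAdj G u v) (hempty : A (ℓ + 1) = ∅)
    {ε β : ℝ} (hε : 0 ≤ ε) (hℓ : (ℓ : ℝ) ≤ ε * N) (hβ : (T : ℝ) * θ ^ ℓ ≤ β) :
    IsEmulator G (outputGraph n s) (1 + ε) β := by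
  intro u v
  refine ⟨hout.edist_le_dist u v, ?_⟩
  by_cases htop : G.edist u v = ⊤
  · have : ENNReal.ofReal (1 + ε) ≠ 0 := by
      rw [Ne, ENNReal.ofReal_eq_zero]
      linarith
    rw [htop, ENat.toENNReal_top, ENNReal.mul_top this, top_add]
    exact le_top
  obtain ⟨p, hp⟩ := (SimpleGraph.edist_ne_top_iff_reachable.1 htop).exists_walk_length_eq_edist
  obtain ⟨x, hx, hNx⟩ := (h.listedEdge fun u hu => by
      obtain ⟨v, hv⟩ := (hA u).1 hu
      exact hv.1).exists_route (m := p.length) (z := fun j => p.getVert j) hN hT hθ (natAdj_symm G)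
    (fun u v huv => natAdj_lt huv) hA
    (fun u v w he => ⟨he.2.1, he.1, he.2.2.symm hout he.1 he.2.1⟩)
    (fun u v w he => he.near hout (natAdj_symm G))
    (fun u v w w' he hw => ⟨he.1, he.2.1, he.2.2.mono hw⟩) hempty
    (fun j hj => ⟨(p.getVert j).2, (p.getVert (j + 1)).2, p.adj_getVert_succ hj⟩)
  simp only [SimpleGraph.Walk.getVert_zero, SimpleGraph.Walk.getVert_length] at hx
  have hd := hout.dist_le hx v.2
  have hN' : (0 : ℝ) < N := by exact_mod_cast Nat.pos_of_ne_zero hN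
  have hreal : (x : ℝ) ≤ (1 + ε) * p.length + β := by
    have h1 : (N : ℝ) * x ≤ (N + ℓ) * p.length + N * (T * θ ^ ℓ) := by exact_mod_cast hNx
    have h2 : (ℓ : ℝ) * p.length ≤ ε * N * p.length :=
      mul_le_mul_of_nonneg_right hℓ (Nat.cast_nonneg _)
    have h3 := mul_le_mul_of_nonneg_left hβ hN'.le
    refine le_of_mul_le_mul_left ?_ hN'
    linarith
  have hβ0 : 0 ≤ β := le_trans (by positivity) hβ
  rw [← hp]
  calc ((outputGraph n s).dist u v : ℝ≥0∞) ≤ ((x : ℕ∞) : ℝ≥0∞) := ENat.toENNReal_le.2 hd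
    _ = ENNReal.ofReal x := by simp
    _ ≤ ENNReal.ofReal ((1 + ε) * p.length + β) := ENNReal.ofReal_le_ofReal hreal
    _ = _ := by
      rw [ENNReal.ofReal_add (by positivity) hβ0, ENNReal.ofReal_mul (by linarith)]
      simp

end

end Ram

/-! ### Estimates -/

section

/-- Apply log x ≤ x - 1 at y/2 rather than at y, which makes the bound sharp at y = 2, and use log 2
≥ 1/2. -/
theorem logb_two_le_sub_one {y : ℝ} (hy : 2 ≤ y) : Real.logb 2 y ≤ y - 1 := by
  have h2 : (1 / 2 : ℝ) ≤ Real.log 2 := by linarith [Real.log_two_gt_d9]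
  have h1 : Real.log (y / 2) ≤ y / 2 - 1 := Real.log_le_sub_one_of_pos (by linarith)
  rw [Real.log_div (by linarith) two_ne_zero] at h1
  rw [← Real.log_div_log, div_le_iff₀ (by linarith)]
  nlinarith

theorem logb_two_le_self {t : ℝ} (ht : 1 ≤ t) : Real.logb 2 t ≤ t := by
  rcases le_total 2 t with h | h
  · linarith [logb_two_le_sub_one h]
  · refine le_trans (Real.logb_le_logb_of_le one_lt_two (by linarith) h) ?_
    rwa [Real.logb_self_eq_one one_lt_two]

variable {n k K : ℕ} {ρ ε : ℝ}

/-- The exponent of the additive stretch, up to a constant. -/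
noncomputable def stretchExponent (n : ℕ) (ρ : ℝ) : ℝ :=
  Real.logb 2 (ρ * Real.logb 2 n) + 1 / ρ

theorem one_le_logb_two (hn : 2 ≤ n) : 1 ≤ Real.logb 2 n := by
  rw [Real.le_logb_iff_rpow_le one_lt_two (by positivity)]
  simpa using (by exact_mod_cast hn : (2 : ℝ) ≤ n)

/-- The summand 1/ρ exceeds log₂(1/ρ) by at least 1, which repays the loss from ρ inside the
logarithm. In particular the exponent is at least 1 even when ρ log₂ n is below 1. -/
theorem logb_add_one_le_stretchExponent (hn : 2 ≤ n) (h0 : 0 < ρ) (h1 : ρ < 1 / 2) :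
    Real.logb 2 (Real.logb 2 n) + 1 ≤ stretchExponent n ρ := by
  have hlog := one_le_logb_two hn
  have hy : 2 ≤ ρ⁻¹ := by
    rw [le_inv_comm₀ two_pos h0]
    linarith
  have := logb_two_le_sub_one hy
  rw [Real.logb_inv] at this
  rw [stretchExponent, Real.logb_mul h0.ne' (by linarith), one_div]
  linarith

theorem one_le_stretchExponent (hn : 2 ≤ n) (h0 : 0 < ρ) (h1 : ρ < 1 / 2) :
    1 ≤ stretchExponent n ρ := by
  have := Real.logb_nonneg one_lt_two (one_le_logb_two hn)
  linarith [logb_add_one_le_stretchExponent hn h0 h1]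

theorem bits_le_logb_add_one (n : ℕ) : (bits n : ℝ) ≤ Real.logb 2 n + 1 := by
  rw [bits, Nat.cast_add, Nat.cast_one, add_le_add_iff_right]
  exact Real.natLog_le_logb n 2

theorem logb_le_bits (hn : 2 ≤ n) : Real.logb 2 n ≤ bits n := by
  rw [Real.logb_le_iff_le_rpow one_lt_two (by positivity), Real.rpow_natCast]
  exact_mod_cast (lt_two_pow_bits n).le

/-- Powers of log n, which come from the radius and the capacity of the first phase, can be absorbed
by a constant base raised to the exponent of the additive stretch. -/
theorem bits_le_two_rpow (hn : 2 ≤ n) (h0 : 0 < ρ) (h1 : ρ < 1 / 2) :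
    (bits n : ℝ) ≤ 2 ^ stretchExponent n ρ := by
  have hlog := one_le_logb_two hn
  calc (bits n : ℝ) ≤ Real.logb 2 n * 2 := by linarith [bits_le_logb_add_one n]
    _ = 2 ^ (Real.logb 2 (Real.logb 2 n) + 1) := by
      rw [Real.rpow_add two_pos, Real.rpow_logb two_pos (by norm_num) (by linarith), Real.rpow_one]
    _ ≤ 2 ^ stretchExponent n ρ := Real.rpow_le_rpow_of_exponent_le one_le_two
      (logb_add_one_le_stretchExponent hn h0 h1)

theorem exponent_cast_le (h0 : 0 < ρ) (hk : k = ⌈1 / ρ⌉₊) (hkb : k ≤ bits n) :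
    (exponent n k : ℝ) ≤ ρ * (Real.logb 2 n + 1) + 1 := by
  have hk1 : 1 / ρ ≤ k := hk ▸ Nat.le_ceil _
  have hk0 : (0 : ℝ) < k := lt_of_lt_of_le (by positivity) hk1
  have hb := bits_le_logb_add_one n
  calc (exponent n k : ℝ) ≤ ((bits n + k - 1 : ℕ) : ℝ) / k := by
        rw [exponent, fullPhases, min_eq_left hkb]
        exact Nat.cast_div_le
    _ ≤ ((bits n : ℝ) + k) / k := by
        gcongr
        exact_mod_cast Nat.sub_le _ _
    _ = bits n * (1 / k) + 1 := by
        field_simp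
    _ ≤ (Real.logb 2 n + 1) * ρ + 1 := by
        have : 1 / (k : ℝ) ≤ ρ := by
          rw [div_le_iff₀ hk0]
          rwa [div_le_iff₀' h0] at hk1
        gcongr
        linarith [Nat.cast_nonneg (α := ℝ) (bits n)]
    _ = _ := by ring

theorem exponent_of_bits_lt (h : bits n < k) : exponent n k = 1 := by
  have : 0 < bits n := by unfold bits; omega
  rw [exponent, fullPhases, min_eq_right h.le]
  exact (Nat.div_eq_iff this).2 (by omega)

theorem one_le_exponent (hk : k ≠ 0) : 1 ≤ exponent n k := by
  have h : 0 < fullPhases n k := by unfold fullPhases bits; omega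
  have hb : 0 < bits n := by unfold bits; omega
  exact (Nat.one_le_div_iff h).2 (by omega)

/-- If k ≤ `bits n`, there are at most 1/ρ + 1 full phases and log₂ of at most 4ρ log₂ n, plus 1,
growing ones. Otherwise ρ is below 1/log₂ n, one bit per phase suffices, and there are `bits n`
phases; with t = 1/(ρ log₂ n) ≥ 1 the exponent is t log₂ n - log₂ t ≥ log₂ n - 1. -/
theorem phaseCount_cast_le (hn : 2 ≤ n) (h0 : 0 < ρ) (h1 : ρ < 1 / 2) (hk : k = ⌈1 / ρ⌉₊) :
    (phaseCount n k : ℝ) ≤ stretchExponent n ρ + 4 := by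
  have hlog := one_le_logb_two hn
  have hlog0 : Real.logb 2 n ≠ 0 := by linarith
  have hk1 : 1 / ρ ≤ k := hk ▸ Nat.le_ceil _
  have hk2 : (k : ℝ) < 1 / ρ + 1 := hk ▸ Nat.ceil_lt_add_one (by positivity)
  have hb := bits_le_logb_add_one n
  have hb' := logb_le_bits hn
  have hρ : ρ * (1 / ρ) = 1 := mul_one_div_cancel h0.ne'
  have hk0 : k ≠ 0 := by
    rintro rfl
    have : 0 < 1 / ρ := by positivity
    simp at hk1
    simp at this
    linarith
  rcases Nat.lt_or_ge (bits n) k with hkb | hkb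
  · have hc : phaseCount n k = bits n := by
      rw [phaseCount, exponent_of_bits_lt hkb, fullPhases, min_eq_right hkb.le]
      simp
    have hkb' : (bits n : ℝ) + 1 ≤ k := by exact_mod_cast hkb
    set t := 1 / ρ / Real.logb 2 n with ht
    have hle : Real.logb 2 n ≤ 1 / ρ := by linarith
    have ht1 : 1 ≤ t := by rwa [ht, one_le_div (by linarith)]
    have hmul : t * Real.logb 2 n = 1 / ρ := div_mul_cancel₀ _ hlog0
    have hL : stretchExponent n ρ = t * Real.logb 2 n - Real.logb 2 t := by
      have : ρ * Real.logb 2 n = t⁻¹ := by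
        rw [ht]
        field_simp
      rw [stretchExponent, this, Real.logb_inv, hmul]
      ring
    have := logb_two_le_self ht1
    rw [hc, hL]
    nlinarith
  · have he := exponent_cast_le h0 hk hkb
    have he1 := one_le_exponent (n := n) hk0
    have he1' : (1 : ℝ) ≤ exponent n k := by exact_mod_cast he1
    have hkb' : (k : ℝ) ≤ bits n := by exact_mod_cast hkb
    have hρl : 1 ≤ ρ * (Real.logb 2 n + 1) := by
      rw [← hρ]
      exact mul_le_mul_of_nonneg_left (by linarith) h0.le
    have hpos : 0 < ρ * Real.logb 2 n := by nlinarith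
    have he4 : (exponent n k : ℝ) ≤ ρ * Real.logb 2 n * 2 ^ 2 := by nlinarith
    have hclog : (Nat.clog 2 (exponent n k) : ℝ) ≤ Real.logb 2 (exponent n k) + 1 := by
      rw [← Nat.cast_ofNat, ← Real.natCeil_logb_natCast]
      exact (Nat.ceil_lt_add_one (Real.logb_nonneg (by norm_num) he1')).le
    have hlogb : Real.logb 2 (exponent n k) ≤ Real.logb 2 (ρ * Real.logb 2 n) + 2 := by
      refine (Real.logb_le_logb_of_le one_lt_two (by linarith) he4).trans_eq ?_
      rw [Real.logb_mul hpos.ne' (by norm_num), Real.logb_pow, Real.logb_self_eq_one one_lt_two]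
      norm_num
    rw [phaseCount, fullPhases, min_eq_left hkb, Nat.cast_add, stretchExponent]
    linarith

/-- The exponent is at most ρ log₂ n + 2 in the main case: rounding up costs 1 and the extra bit of
n costs ρ < 1. -/
theorem two_pow_exponent_cast_le (hn : 2 ≤ n) (h0 : 0 < ρ) (h1 : ρ < 1 / 2)
    (hk : k = ⌈1 / ρ⌉₊) : (2 : ℝ) ^ exponent n k ≤ 4 * (n : ℝ) ^ ρ := by
  have hn1 : (1 : ℝ) ≤ n := by exact_mod_cast (by omega : 1 ≤ n)
  rcases Nat.lt_or_ge (bits n) k with hkb | hkb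
  · rw [exponent_of_bits_lt hkb]
    have := Real.one_le_rpow hn1 h0.le
    linarith
  · have he := exponent_cast_le h0 hk hkb
    calc (2 : ℝ) ^ exponent n k = 2 ^ (exponent n k : ℝ) := (Real.rpow_natCast _ _).symm
      _ ≤ 2 ^ (2 + Real.logb 2 n * ρ) :=
        Real.rpow_le_rpow_of_exponent_le one_le_two (by linarith)
      _ = 4 * (n : ℝ) ^ ρ := by
        rw [Real.rpow_add two_pos, Real.rpow_mul two_pos.le,
          Real.rpow_logb two_pos (by norm_num) (by linarith)]
        norm_num

theorem ceil_inv_le (h0 : 0 < ε) (h1 : ε < 1) : (⌈1 / ε⌉₊ : ℝ) ≤ 2 / ε := by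
  have h := Nat.ceil_lt_add_one (a := 1 / ε) (by positivity)
  have : 1 ≤ 1 / ε := by rw [one_le_div h0]; exact h1.le
  rw [show 2 / ε = 1 / ε + 1 / ε by ring]
  linarith

/-- The dominating factor of the running time is at most the additive stretch. -/
theorem bits_pow_mul_le_additiveStretch (hn : 2 ≤ n) (hε0 : 0 < ε) (hε1 : ε < 1) (h0 : 0 < ρ)
    (h1 : ρ < 1 / 2) (hk : k = ⌈1 / ρ⌉₊) (hK : K = ⌈1 / ε⌉₊) :
    ((phaseCount n k : ℝ) + 2) * ((bits n * bits n) * ((bits n * bits n) *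
      (104 * phaseCount n k * K) ^ phaseCount n k)) ≤ 7 * additiveStretch 16640 5 n ε ρ := by
  have hL := one_le_stretchExponent hn h0 h1
  have hℓ := phaseCount_cast_le hn h0 h1 hk
  have hb := bits_le_two_rpow hn h0 h1
  have hK' : (K : ℝ) ≤ 2 / ε := hK ▸ ceil_inv_le hε0 hε1
  have hdef : additiveStretch 16640 5 n ε ρ =
      (16640 * stretchExponent n ρ / (ε * ρ)) ^ (stretchExponent n ρ + 5) := rfl
  rw [hdef]
  generalize stretchExponent n ρ = x at *
  -- From ℓ ≤ x + 4 ≤ 5x and K ≤ 2/ε: 1040 = 104 · 5 · 2 bounds θ. The factor ℓ + 2 ≤ 7x ≤ 7c raises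
  -- the exponent from x + 4 to x + 5, and the fourth power of `bits n` gives 16^x, so the base is
  -- 16 · 1040 = 16640.
  set c := 1040 * x / ε with hc
  have hxc : x ≤ c := by
    rw [hc, le_div_iff₀ hε0]
    nlinarith
  have hc1 : 1 ≤ c := hL.trans hxc
  have hθ : (104 * phaseCount n k * K : ℝ) ≤ c := by
    calc (104 * phaseCount n k * K : ℝ) ≤ 104 * (x + 4) * (2 / ε) := by gcongr
      _ ≤ 104 * (5 * x) * (2 / ε) := by gcongr; linarith
      _ = c := by rw [hc]; ring
  have hpow : (104 * phaseCount n k * K : ℝ) ^ phaseCount n k ≤ c ^ (x + 4) := by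
    calc (104 * phaseCount n k * K : ℝ) ^ phaseCount n k ≤ c ^ phaseCount n k := by gcongr
      _ = c ^ (phaseCount n k : ℝ) := (Real.rpow_natCast _ _).symm
      _ ≤ c ^ (x + 4) := Real.rpow_le_rpow_of_exponent_le hc1 hℓ
  have h16 : (bits n * bits n : ℝ) * (bits n * bits n) ≤ 16 ^ x := by
    calc (bits n * bits n : ℝ) * (bits n * bits n) ≤ (2 ^ x * 2 ^ x) * (2 ^ x * 2 ^ x) := by gcongr
      _ = 16 ^ x := by
        rw [← Real.mul_rpow, ← Real.mul_rpow] <;> norm_num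
  have hρ2 : 1 ≤ 1 / ρ := by rw [one_le_div h0]; linarith
  have hbase : 16 * c ≤ 16640 * x / (ε * ρ) := by
    calc 16 * c = 16640 * x / ε * 1 := by rw [hc]; ring
      _ ≤ 16640 * x / ε * (1 / ρ) := by gcongr
      _ = _ := by field_simp
  calc ((phaseCount n k : ℝ) + 2) * ((bits n * bits n) * ((bits n * bits n) *
        (104 * phaseCount n k * K) ^ phaseCount n k))
      = ((phaseCount n k : ℝ) + 2) * (((bits n * bits n) * (bits n * bits n)) *
        (104 * phaseCount n k * K) ^ phaseCount n k) := by ring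
    _ ≤ (7 * c) * (16 ^ x * c ^ (x + 4)) := by
      gcongr
      linarith
    _ = 7 * (16 ^ x * c ^ (x + 5)) := by
      rw [show x + 5 = x + 4 + 1 by ring, Real.rpow_add_one (by linarith)]
      ring
    _ ≤ 7 * (16 ^ (x + 5) * c ^ (x + 5)) := by
      gcongr
      · norm_num
      · linarith
    _ = 7 * (16 * c) ^ (x + 5) := by
      rw [Real.mul_rpow (by norm_num) (by linarith)]
    _ ≤ 7 * (16640 * x / (ε * ρ)) ^ (x + 5) := by gcongr

theorem tendsto_bits : Tendsto bits atTop atTop := by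
  refine tendsto_atTop_atTop.2 fun b => ⟨2 ^ b, fun n hn => ?_⟩
  exact (Nat.le_log_of_pow_le (by norm_num) hn).trans (Nat.le_succ _)

theorem isLittleO_div_bits :
    (fun n : ℕ => 4 * (n : ℝ) / bits n) =o[atTop] (fun n : ℕ => (n : ℝ)) := by
  have h : Tendsto (fun n => (4 : ℝ) / bits n) atTop (nhds 0) :=
    (tendsto_natCast_atTop_atTop.comp tendsto_bits).const_div_atTop 4
  have := ((isLittleO_one_iff ℝ).2 h).mul_isBigO (isBigO_refl (fun n : ℕ => (n : ℝ)) atTop)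
  refine this.congr (fun n => by ring) fun n => by ring

end

/-! ### Sizes of words and the final form of the time bound -/

section

variable {n k K m ℓ T Q P : ℕ} {ε ρ : ℝ}

theorem Ram.IsEdgeList.length_le_ncard {G : SimpleGraph (Fin n)} {es : List (Fin n × Fin n)}
    (h : Ram.IsEdgeList G es) : es.length ≤ G.edgeSet.ncard := by
  classical
  calc es.length = (es.map fun e => s(e.1, e.2)).toFinset.card := by
        rw [List.toFinset_card_of_nodup h.1, List.length_map]
    _ = ((es.map fun e => s(e.1, e.2)).toFinset : Set (Sym2 (Fin n))).ncard :=
        (Set.ncard_coe_finset _).symm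
    _ ≤ _ := by
        refine Set.ncard_le_ncard fun x hx => ?_
        obtain ⟨e, he, rfl⟩ := List.mem_map.1 (List.mem_toFinset.1 hx)
        exact (h.2 _ _).2 (Or.inl he)

theorem Ram.IsEdgeList.length_le {G : SimpleGraph (Fin n)} {es : List (Fin n × Fin n)}
    (h : Ram.IsEdgeList G es) : es.length ≤ n * n := by
  simpa using (List.Nodup.of_map _ h.1).length_le_card

theorem two_pow_bits_le (hn : n ≠ 0) : 2 ^ bits n ≤ 2 * n := by
  rw [bits, pow_succ, mul_comm]
  exact Nat.mul_le_mul_left 2 (Nat.pow_log_le_self 2 hn)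

theorem radius_le_max {θ : ℕ} (i : ℕ) : radius T θ n i ≤ max T n := by
  cases i with
  | zero => exact le_max_left _ _
  | succ i => exact (min_le_right _ _).trans (le_max_right _ _)

theorem capacity_le (hQ : 2 ≤ Q) (i : ℕ) : capacity T Q i ≤ T + Q + 1 := by
  cases i with
  | zero => simp only [capacity]; omega
  | succ i =>
    have := threshold_le hQ i
    simp only [capacity]
    omega

theorem two_le_bits (hn : 2 ≤ n) : 2 ≤ bits n := by
  have := Nat.log_pos one_lt_two hn
  unfold bits
  omega

theorem phaseCount_pos (hk : k ≠ 0) : 0 < phaseCount n k := by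
  unfold phaseCount fullPhases bits
  omega

/-- The running time, with all terms collected in one product. -/
theorem time_bound (hT : 1 ≤ T) (hQ : 2 ≤ Q) (hP : 1 ≤ P) {b : ℕ} (hb : b ≤ T) :
    b * 200 + m * 150 + 230 + (ℓ + 2) * ((P + 1) * ((2 * m + 1) * ((T + Q + 1 + 1) * 510))) ≤
      8600 * (m + 1) * ((ℓ + 2) * (T * P)) * Q := by
  have hTP : 1 ≤ T * P := Nat.mul_pos hT hP
  have h2 : T + Q + 2 ≤ 4 * (T * Q) := by nlinarith
  have h3 : P + 1 ≤ 2 * P := by omega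
  have h4 : 2 * m + 1 ≤ 2 * (m + 1) := by omega
  have h5 : (ℓ + 2) * ((P + 1) * ((2 * m + 1) * ((T + Q + 1 + 1) * 510))) ≤
      (ℓ + 2) * ((2 * P) * ((2 * (m + 1)) * ((4 * (T * Q)) * 510))) := by gcongr
  have h6 : b * 200 + m * 150 + 230 ≤ 430 * ((m + 1) * T) := by nlinarith [Nat.zero_le (m * T)]
  have h7 : 430 * ((m + 1) * T) * 1 ≤ 430 * ((m + 1) * T) * ((ℓ + 2) * P * Q) :=
    Nat.mul_le_mul_left _ (Nat.mul_pos (Nat.mul_pos (by omega) hP) (by omega))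
  have h8 : 8600 * (m + 1) * ((ℓ + 2) * (T * P)) * Q =
      430 * ((m + 1) * T) * ((ℓ + 2) * P * Q) +
        (ℓ + 2) * ((2 * P) * ((2 * (m + 1)) * ((4 * (T * Q)) * 510))) +
        10 * ((m + 1) * T * ((ℓ + 2) * P * Q)) := by ring
  omega

/-- With parameters bounded by `b ^ 3`, addresses are of order `b ^ 9`; the remaining factor `b ^ 3
≥ 343` of the word size absorbs the constants. -/
theorem cube_fits {b : ℕ} (hb7 : 7 ≤ b) : (b ^ 3 + 1) ^ 3 + 3 ≤ b ^ 12 := by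
  have h343 : 343 ≤ b ^ 3 := by
    calc 343 = 7 ^ 3 := by norm_num
      _ ≤ b ^ 3 := Nat.pow_le_pow_left hb7 3
  rw [show b ^ 12 = b ^ 3 * (b ^ 3) ^ 3 by ring]
  generalize b ^ 3 = x at *
  have : (x + 1) ^ 3 ≤ (2 * x) ^ 3 := Nat.pow_le_pow_left (by omega) 3
  have h1 : 1 ≤ x ^ 3 := Nat.one_le_pow _ _ (by omega)
  have h2 : 343 * x ^ 3 ≤ x * x ^ 3 := Nat.mul_le_mul_right _ h343
  rw [mul_pow] at this
  omega

theorem radius_fits {b : ℕ} (hb7 : 7 ≤ b) (hℓ : ℓ ≤ 2 * b) (hK : K ≤ b) :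
    b ^ 3 * (104 * ℓ * K) + 104 ≤ b ^ 12 := by
  have hθb : (104 * ℓ * K) ≤ b ^ 5 := by
    have h2 : 208 ≤ b ^ 3 := le_trans (by norm_num) (Nat.pow_le_pow_left hb7 3)
    calc (104 * ℓ * K) ≤ 104 * (2 * b) * b := Nat.mul_le_mul (Nat.mul_le_mul_left _ hℓ) hK
      _ = 208 * b ^ 2 := by ring
      _ ≤ b ^ 3 * b ^ 2 := Nat.mul_le_mul_right _ h2
      _ = b ^ 5 := by ring
  have h1 : b ^ 3 * (104 * ℓ * K) ≤ b ^ 8 := by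
    calc b ^ 3 * (104 * ℓ * K) ≤ b ^ 3 * b ^ 5 := Nat.mul_le_mul_left _ hθb
      _ = b ^ 8 := by ring
  have h2 : 2 * b ^ 8 ≤ b ^ 12 := by
    rw [show b ^ 12 = b ^ 4 * b ^ 8 by ring]
    exact Nat.mul_le_mul_right _ (le_trans (by norm_num) (Nat.pow_le_pow_left hb7 4))
  have h3 : 104 ≤ b ^ 8 := le_trans (by norm_num) (Nat.pow_le_pow_left hb7 8)
  omega

end

/-! ### Choice of the constants and assembly -/

theorem theorem3p4 :
    ∃ (P : Ram.Cmd) (A B D : ℝ) (c : ℕ) (g : ℕ → ℝ),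
      0 < A ∧ 1 ≤ B ∧ 0 ≤ D ∧ g =o[atTop] (fun n : ℕ => (n : ℝ)) ∧
      ∀ (n : ℕ) (_ : 2 ≤ n) (G : SimpleGraph (Fin n)) (es : List (Fin n × Fin n))
        (_ : Ram.IsEdgeList G es) (ε ρ : ℝ) (_ : 0 < ε) (_ : ε < 1) (_ : 0 < ρ) (_ : ρ < 1 / 2),
        ∃ (t : ℕ) (s : Ram.Store) (M : ℕ) (H : WeightedGraph (Fin n)),
          Ram.Exec ((n + ⌈1 / ε⌉₊ + ⌈1 / ρ⌉₊) ^ c) P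
            (Ram.inputStore es ⌈1 / ε⌉₊ ⌈1 / ρ⌉₊) t s ∧
          Ram.Outputs s M H ∧
          (M : ℝ) ≤ n + g n ∧
          (H.graph.edgeSet.ncard : ℝ) ≤ n + g n ∧
          IsEmulator G H (1 + ε) (additiveStretch B D n ε ρ) ∧
          (t : ℝ) ≤ A * ((G.edgeSet.ncard : ℝ) + 1) * additiveStretch B D n ε ρ * (n : ℝ) ^ ρ := by
  -- Here 240800 = 8600 · 7 · 4 collects the constants of `time_bound`, of the additive stretch and
  -- of Q ≤ 4n^ρ. The term 4n / `bits n` is 2ℓn/T with ℓ ≤ 2 `bits n`.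
  refine ⟨Ram.emulatorProgram, 240800, 16640, 5, 12, fun n => 4 * (n : ℝ) / bits n, by norm_num,
    by norm_num, by norm_num, isLittleO_div_bits, ?_⟩
  intro n hn G es hes ε ρ hε0 hε1 hρ0 hρ1
  have hmain := bits_pow_mul_le_additiveStretch hn hε0 hε1 hρ0 hρ1 rfl rfl
  have hQn := two_pow_exponent_cast_le hn hρ0 hρ1 rfl
  have hK1 : 1 / ε ≤ ⌈1 / ε⌉₊ := Nat.le_ceil _
  have hK0 : 2 ≤ ⌈1 / ε⌉₊ := Nat.lt_ceil.2 (by rw [Nat.cast_one, lt_div_iff₀ hε0]; linarith)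
  have hk0 : 3 ≤ ⌈1 / ρ⌉₊ := Nat.lt_ceil.2 (by
    rw [lt_div_iff₀ hρ0]
    push_cast
    linarith)
  generalize ⌈1 / ε⌉₊ = K at *
  generalize ⌈1 / ρ⌉₊ = k at *
  set ℓ := phaseCount n k with hℓ
  set T := bits n * bits n with hT
  set θ := 104 * ℓ * K with hθ
  set Q := 2 ^ exponent n k with hQ
  set b := n + K + k with hb
  have hb2 := two_le_bits hn
  have hbn : bits n ≤ n := bits_le (by omega)
  have hTb : bits n ≤ T := Nat.le_mul_self _
  have hTn : T ≤ n * n := Nat.mul_le_mul hbn hbn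
  have hℓ2 : ℓ ≤ 2 * bits n := phaseCount_le (by omega)
  have hℓ0 : 0 < ℓ := phaseCount_pos (by omega)
  have he1 : 1 ≤ exponent n k := one_le_exponent (by omega)
  have hQ2 : 2 ≤ Q := Nat.le_self_pow (by omega) 2
  have hQn' : Q ≤ 2 * n := (Nat.pow_le_pow_right two_pos (exponent_le (by omega))).trans
    (two_pow_bits_le (by omega))
  have hθ1 : 1 ≤ θ := Nat.mul_pos (by omega) (by omega)
  have hnn : n * n ≤ b * b := Nat.mul_le_mul (by omega) (by omega)
  have hb7 : 7 ≤ b := by omega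
  have hbb : 7 * (n * n) ≤ b ^ 3 := by
    rw [pow_succ, sq, mul_comm]
    exact Nat.mul_le_mul hnn hb7
  have hb3 : b ≤ b ^ 3 := Nat.le_self_pow (by norm_num) b
  have hn2 : 2 * n ≤ n * n := Nat.mul_le_mul_right n hn
  have hm := hes.length_le
  have hQQ : Q * Q ≤ 4 * (n * n) := by
    calc Q * Q ≤ (2 * n) * (2 * n) := Nat.mul_le_mul hQn' hQn'
      _ = 4 * (n * n) := by ring
  have hmax : max T n ≤ n * n := max_le hTn (by omega)
  -- All parameters are at most `b ^ 3` and words hold `b ^ 12`. The bound for the radii is a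
  -- minimum of two: the first is needed for the running time, the second for the word size.
  obtain ⟨t, s, hexec, ht, hout, A, L, M, hA, hM0, hM1, hist⟩ :=
    Ram.wp_emulatorProgram (K := K) (k := k) (X := b ^ 3) (W := b ^ 12)
      (R := min (T * θ ^ ℓ) (max T n)) (C := T + Q + 1) hes (by omega) (by omega) (by omega)
      hT hθ hQ (cube_fits hb7) (by omega) (by omega) (by omega) (by omega) (by omega)
      (fun i hi => le_min ((radius_le i).trans
        (Nat.mul_le_mul_left _ (Nat.pow_le_pow_right hθ1 hi))) (radius_le_max i))
      ((min_le_right _ _).trans (by omega)) (fun i _ => capacity_le hQ2 i) (by omega)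
      (radius_fits hb7 (by omega) (by omega))
      (fun i => (Nat.mul_le_mul (threshold_le hQ2 i) (threshold_le hQ2 i)).trans (by omega))
      (by omega)
  rw [← hℓ] at hM1 hist ht
  have hAn : (A 0).card ≤ n := by
    have : A 0 ⊆ Finset.range n := fun u hu => by
      obtain ⟨v, hv⟩ := (hA u).1 hu
      exact Finset.mem_range.2 hv.1
    simpa using Finset.card_le_card this
  have hempty : A (ℓ + 1) = ∅ := hist.eq_empty (natAdj_symm G) (by omega)
    fun i hi => (Finset.card_le_card (hist.subset_zero hi)).trans hAn
  have hP1 : 1 ≤ T * θ ^ ℓ := Nat.mul_pos (by omega) (pow_pos hθ1 _)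
  have hmain' : (((ℓ + 2) * (T * (T * θ ^ ℓ)) : ℕ) : ℝ) ≤ 7 * additiveStretch 16640 5 n ε ρ := by
    rw [hT, hθ]
    exact_mod_cast hmain
  have hcount : (s.var 4 : ℝ) ≤ n + 4 * (n : ℝ) / bits n := by
    have hc := hist.count_mul_le (natAdj_symm G) hA hAn hQ2 (by omega) hM0
    rw [hM1] at hc
    have hc' : s.var 4 * T ≤ n * T + 4 * bits n * n :=
      hc.trans (Nat.add_le_add_left (Nat.mul_le_mul_right n (by omega)) _)
    have hbpos : (0 : ℝ) < bits n := by exact_mod_cast (by omega : 0 < bits n)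
    have hTpos : (0 : ℝ) < T := by exact_mod_cast (by omega : 0 < T)
    refine le_of_mul_le_mul_right ?_ hTpos
    calc (s.var 4 : ℝ) * T ≤ n * T + 4 * bits n * n := by exact_mod_cast hc'
      _ = (n + 4 * (n : ℝ) / bits n) * T := by
        rw [hT]
        push_cast
        field_simp
  refine ⟨t, s, s.var 4, Ram.outputGraph n s, hexec, hout.outputs, hcount,
    le_trans (by exact_mod_cast hout.ncard_edgeSet_le) hcount, ?_, ?_⟩
  -- With N = ℓK the factor θ is 104N, and ℓ ≤ εN because εK ≥ 1.
  · refine Ram.isEmulator (N := ℓ * K) hout hist (Nat.mul_ne_zero (by omega) (by omega)) (by omega)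
      (by rw [hθ, mul_assoc]) hA hempty hε0.le ?_ ?_
    · have : 1 ≤ ε * K := by rwa [div_le_iff₀' hε0] at hK1
      push_cast
      nlinarith [Nat.cast_nonneg (α := ℝ) ℓ]
    -- The additive stretch is known up to a factor 7 only; the factor (ℓ + 2)T ≥ 12, not needed for
    -- the distances, makes up for it.
    · have h12 : 12 * (T * θ ^ ℓ) ≤ (ℓ + 2) * (T * (T * θ ^ ℓ)) := by
        rw [← mul_assoc (ℓ + 2)]
        have : 2 * 2 ≤ T := Nat.mul_le_mul hb2 hb2
        exact Nat.mul_le_mul_right _ (Nat.mul_le_mul (show 3 ≤ ℓ + 2 by omega) this)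
      have h12' : (12 : ℝ) * (T * θ ^ ℓ) ≤ 7 * additiveStretch 16640 5 n ε ρ :=
        le_trans (by exact_mod_cast h12) hmain'
      have h0 : (0 : ℝ) ≤ T * θ ^ ℓ := by positivity
      linarith
  · have hR : min (T * θ ^ ℓ) (max T n) ≤ T * θ ^ ℓ := min_le_left _ _
    have ht' : t ≤ 8600 * (es.length + 1) * ((ℓ + 2) * (T * (T * θ ^ ℓ))) * Q := by
      refine (ht.trans ?_).trans (time_bound (by omega) hQ2 hP1 hTb)
      gcongr
    have hQn'' : (Q : ℝ) ≤ 4 * (n : ℝ) ^ ρ := by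
      rw [hQ]
      exact_mod_cast hQn
    have hS0 : 0 ≤ additiveStretch 16640 5 n ε ρ := by
      have : (0 : ℝ) ≤ ((ℓ + 2) * (T * (T * θ ^ ℓ)) : ℕ) := Nat.cast_nonneg _
      linarith
    have hme : (es.length : ℝ) ≤ G.edgeSet.ncard := by exact_mod_cast hes.length_le_ncard
    calc (t : ℝ) ≤ 8600 * (es.length + 1) * (((ℓ + 2) * (T * (T * θ ^ ℓ)) : ℕ) : ℝ) * Q := by
          exact_mod_cast ht'
      _ ≤ 8600 * (G.edgeSet.ncard + 1) * (7 * additiveStretch 16640 5 n ε ρ) *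
          (4 * (n : ℝ) ^ ρ) := by gcongr
      _ = _ := by ring
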